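/- Let $n\ge 1$, and let $F:[0,\infty)\to\mathbb R\cup\{-\infty\}$ be admissible, that is, strictly increasing on $[0,\infty)$, continuous on $(0,\infty)$, and with $F(0)=\lim_{r\to0^+}F(r)$. Let $f_F$ be the inverse function of $F$ on $J_F:=F((0,\infty))$. A function $\phi:\mathbb R^n\to[0,\infty)$ is called $F$-convex if $F(\phi((1-\lambda)x+\lambda y))\le(1-\lambda)F(\phi(x))+\lambda F(\phi(y))$ for all $x,y\in\mathbb R^n$ and $\lambda\in(0,1)$, where $-\infty+b=b-\infty=-\infty$ for $b\in[-\infty,\infty)$ and $\kappa\cdot(-\infty)=-\infty$ for $\kappa>0$. For $t>0$ put $$[e^{t\Delta}\phi](x)=\int_{\mathbb R^n}(4\pi t)^{-n/2}e^{-|x-y|^2/(4t)}\phi(y)\,dy ,$$ and let $T(\phi)\in[0,\infty]$ be the maximal existence time of $e^{t\Delta}\phi$, that is, the largest $T$ such that this integral is finite for all $x\in\mathbb R^n$ and $t\in(0,T)$. We say that $F$-convexity is *preserved under the heat flow* if, for every $F$-convex $\phi\ge0$ with $T(\phi)>0$, the function $e^{t\Delta}\phi$ is $F$-convex for all $t\in(0,T(\phi))$;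 and that it is *only trivially preserved* if every $F$-convex $\phi\ge0$ with $T(\phi)>0$ such that $e^{t\Delta}\phi$ is $F$-convex for all $t\in(0,T(\phi))$ is constant on $\mathbb R^n$. 1. If $\lim_{r\to\infty}F(r)<\infty$, then $F$-convexity is only trivially preserved under the heat flow. 2. If $\lim_{r\to\infty}F(r)=\infty$ and $\int_{F(1)}^\infty e^{-Az^2}f_F(z)\,dz=\infty$ for every $A>0$, then $F$-convexity is only trivially preserved under the heat flow. 3. If $F\in C^2((0,\infty))$, $\lim_{r\to\infty}F(r)=\infty$ and $\int_{F(1)}^\infty e^{-Az^2}f_F(z)\,dz<\infty$ for some $A>0$, then $F$-convexity is preserved under the heat flow if and only if $F'>0$ in $(0,\infty)$ and $g_F:=(\log f_F')'$ is convex on $J_F$. -/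

import Mathlib

open MeasureTheory Filter Set
open scoped Topology ENNReal

noncomputable section

namespace HeatFConvex

/-- A function `F : [0,∞) → ℝ ∪ {-∞}` is admissible if it is strictly increasing on `[0,∞)`,
continuous on `(0,∞)`, and `F 0 = lim_{r → 0⁺} F r`. It is represented by a function on `ℝ` with
values in the extended reals; only its values on `[0,∞)` are ever used. -/
structure Admissible (F : ℝ → EReal) : Prop where
  ne_top : ∀ r, 0 ≤ r → F r ≠ ⊤
  strictMonoOn : StrictMonoOn F (Ici 0)
  continuousOn : ContinuousOn F (Ioi 0)
  tendsto_zero : Tendsto F (𝓝[>] 0) (𝓝 (F 0))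

/-- The real-valued version of `F`; for admissible `F` it agrees with `F` on `(0,∞)`. -/
def realOf (F : ℝ → EReal) (r : ℝ) : ℝ := (F r).toReal

/-- `J_F = F((0,∞))`. -/
def J (F : ℝ → EReal) : Set ℝ := {z | ∃ r : ℝ, 0 < r ∧ F r = (z : EReal)}

/-- `f_F`, the inverse function of `F` on `J_F`, with values in `(0,∞)`
(no meaning is attached to its values outside `J_F`). -/
def inv (F : ℝ → EReal) : ℝ → ℝ := Function.invFunOn (realOf F) (Ioi 0)

/-- `g_F = (log f_F')'`. -/
def g (F : ℝ → EReal) : ℝ → ℝ := deriv fun z => Real.log (deriv (inv F) z)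

/-- The integral of `exp (-A z²) f_F(z)` over `(F(1), ∞)`, as an element of `[0,∞]`. -/
def weightIntegral (F : ℝ → EReal) (A : ℝ) : ℝ≥0∞ :=
  ∫⁻ z in Ioi (realOf F 1), ENNReal.ofReal (Real.exp (-A * z ^ 2) * inv F z)

variable {n : ℕ}

/-- A nonnegative function `f` on `ℝⁿ` is `F`-convex. The arithmetic of `EReal` obeys
`-∞ + b = b + (-∞) = -∞` and `κ * (-∞) = -∞` for `κ > 0`. -/
def FConvex (F : ℝ → EReal) (f : EuclideanSpace ℝ (Fin n) → ℝ) : Prop :=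
  (∀ x, 0 ≤ f x) ∧
    ∀ (x y : EuclideanSpace ℝ (Fin n)) (l : ℝ), 0 < l → l < 1 →
      F (f ((1 - l) • x + l • y)) ≤
        ((1 - l : ℝ) : EReal) * F (f x) + (l : EReal) * F (f y)

/-- The Gauss kernel on `ℝⁿ × (0,∞)`. -/
def gaussKernel (x : EuclideanSpace ℝ (Fin n)) (t : ℝ) : ℝ :=
  (4 * Real.pi * t) ^ (-(n : ℝ) / 2) * Real.exp (-‖x‖ ^ 2 / (4 * t))

/-- The heat flow `e^{tΔ} φ` (meaningful for `0 ≤ t < maxTime φ`). -/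
def heatFlow (φ : EuclideanSpace ℝ (Fin n) → ℝ) (t : ℝ) (x : EuclideanSpace ℝ (Fin n)) : ℝ :=
  if 0 < t then ∫ y, gaussKernel (x - y) t * φ y else φ x

/-- `T(φ)`, the maximal existence time of `e^{tΔ} φ`: the largest `T ∈ [0,∞]` such that the
integral that defines `[e^{tΔ} φ](x)` converges for all `t ∈ (0,T)` and `x ∈ ℝⁿ`. -/
def maxTime (φ : EuclideanSpace ℝ (Fin n) → ℝ) : ℝ≥0∞ :=
  sSup {T | ∀ t : ℝ, 0 < t → ENNReal.ofReal t < T →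
    ∀ x : EuclideanSpace ℝ (Fin n), Integrable fun y => gaussKernel (x - y) t * φ y}

/-- `F`-convexity is preserved under the heat flow on `ℝⁿ`. -/
def Preserved (n : ℕ) (F : ℝ → EReal) : Prop :=
  ∀ φ : EuclideanSpace ℝ (Fin n) → ℝ, FConvex F φ → 0 < maxTime φ →
    ∀ t : ℝ, 0 < t → ENNReal.ofReal t < maxTime φ → FConvex F (heatFlow φ t)

/-- `F`-convexity is only trivially preserved under the heat flow on `ℝⁿ`. -/
def OnlyTriviallyPreserved (n : ℕ) (F : ℝ → EReal) : Prop :=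
  ∀ φ : EuclideanSpace ℝ (Fin n) → ℝ, FConvex F φ → 0 < maxTime φ →
    (∀ t : ℝ, 0 < t → ENNReal.ofReal t < maxTime φ → FConvex F (heatFlow φ t)) →
    ∃ c : ℝ, ∀ x, φ x = c

end HeatFConvex

end

noncomputable section

namespace HeatFConvex

open scoped RealInnerProductSpace

/-! ### Maximum principles for `∂ₜw = Δw + g(w)|∇w|²` on the whole space -/

section MaximumPrinciple

/-! Cutting an `F`-convex φ off from below at `r > 0` and applying `F` gives a finite convex
function `u` (`FConvex.convexOn_max`). The two triviality claims are then growth statements, in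
which the flow enters at most through its existence. If `F` is bounded above, `u` is convex and
bounded above, hence constant. If φ is not constant, some `u` has a slope `k > 0` between two points
and grows at least linearly along a ray, so φ grows there at least like `f_F` of a linear function.
A heat flow finite at time `T` forces `φ(y) ≤ C exp((|y|+1)²/(4T))` (`FConvex.growth`). Hence `f_F`
has at most Gaussian growth (`FConvex.inv_growth`), and some weight integral is finite.

Sufficiency. The function `w = F(e^{tΔ}φ)` solves `∂ₜw = Δw + g_F(w)|∇w|²` (`ConvexProfile.isFlow`).
At a first positive maximum of `w(αx+βy) - αw(x) - βw(y)` the three gradients coincide, the second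
order terms have a sign, and convexity of `g_F` bounds what is left by a multiple of this defect. On
the unbounded space a small quadratic penalty is needed, and its error terms are controlled once `w`
has bounded gradient and linear growth and `g_F` has slopes at most some `a` (`IsFlow.convexOn`). A
two-point maximum principle propagates Lipschitz constants along `ℓ' = aℓ³` (`IsFlow.lipschitz`);
that equation blows up at time `1/(2aℓ(0)²)`. The existence time of the flow is exactly strong
enough to prevent this: a slope `s > 0` of `g_F` makes `f_F(z)` grow like `exp(sz²/2)` up to lower
order, so comparison with the Gaussian bound gives `2sk²T ≤ 1` for every slope `k` of `u`
(`ConvexProfile.slope_bound`). Thus either `g_F` is nonincreasing and `u` is approximated by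
Lipschitz infimal convolutions, or `u` is itself Lipschitz with a constant compatible with the
slopes of `g_F`. Letting `r → 0` finishes the argument.

Necessity. For `φ = f_F(max(x_i, m))` the transform `F ∘ φ` is the coordinate `x_i` where `x_i > m`,
and the right time derivative of `F(e^{tΔ}φ)` at `0` is a positive constant times `g_F(x_i)`. The
convexity defect of an affine function is zero, so if it is nonpositive at later times, its time
derivative is nonpositive at time `0`: this is the convexity inequality for `g_F`
(`Preserved.g_convex_ineq`), proved so far only at points where `F' > 0`. It also bounds `g_F =
(-log F'(f_F))'` from below to the right of a zero of `F'`, which keeps `-log F'` from tending to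
`+∞` there; hence `F'` has no zero (`Preserved.deriv_pos`). -/

lemma le_of_sq_le_mul {v l : ℝ} (hl : 0 ≤ l) (h : v ^ 2 ≤ l * v) : v ≤ l := by
  by_contra! hcon
  nlinarith

lemma one_add_mul_add_le (X Y : ℝ) :
    (1 + Y) * (X + Y) ≤ 3 * (1 + (X ^ 2 + Y ^ 2)) := by
  nlinarith [sq_nonneg (X - Y), sq_nonneg (X - 1), sq_nonneg (Y - 1)]

lemma mul_le_of_le_add {d X Y : ℝ} (hX : 0 ≤ X) (h : d ≤ X + Y) :
    d * X ≤ 2 * (1 + (X ^ 2 + Y ^ 2)) := by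
  nlinarith [sq_nonneg (X - Y)]

lemma two_add_add_sq_le (X Y : ℝ) : (2 + X + Y) ^ 2 ≤ 12 * (1 + (X ^ 2 + Y ^ 2)) := by
  nlinarith [sq_nonneg (X - Y), sq_nonneg (X - 2), sq_nonneg (Y - 2)]

lemma one_add_mul_self_le {p S : ℝ} (h : p ^ 2 ≤ S) (hS : 1 ≤ S) : (1 + p) * p ≤ 2 * S := by
  nlinarith [sq_nonneg (p - 1)]

lemma prod_norm_sq_le {E : Type*} [NormedAddCommGroup E] (x y : E) :
    ‖((x, y) : E × E)‖ ^ 2 ≤ ‖x‖ ^ 2 + ‖y‖ ^ 2 := by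
  rw [Prod.norm_def]
  rcases le_total ‖x‖ ‖y‖ with h | h
  · simp only [max_eq_right h]; linarith [sq_nonneg ‖x‖]
  · simp only [max_eq_left h]; linarith [sq_nonneg ‖y‖]

/-- First and second order conditions at a global maximum along a line. -/
lemma deriv_conditions_of_max {θ θ' : ℝ → ℝ} {d : ℝ} (h1 : ∀ s, HasDerivAt θ (θ' s) s)
    (h2 : HasDerivAt θ' d 0) (hmax : ∀ s, θ s ≤ θ 0) : θ' 0 = 0 ∧ d ≤ 0 := by
  have h0 : θ' 0 = 0 :=
    IsLocalMax.hasDerivAt_eq_zero (Eventually.of_forall hmax) (h1 0)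
  refine ⟨h0, ?_⟩
  by_contra! hd
  have hder : deriv θ = θ' := funext fun s => (h1 s).deriv
  -- If `d > 0`, the second derivative test makes `0` a local minimum too, so `θ` is constant near
  -- `0` and `d` vanishes.
  have hmin : IsLocalMin θ 0 := by
    apply isLocalMin_of_deriv_deriv_pos
    · rw [hder, h2.deriv]; exact hd
    · rw [hder, h0]
    · exact (h1 0).continuousAt
  have heq : θ =ᶠ[𝓝 0] fun _ => θ 0 := by
    filter_upwards [hmin] with s hs
    exact le_antisymm (hmax s) hs
  have h3 : θ' =ᶠ[𝓝 0] fun _ => 0 := by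
    have := heq.eventuallyEq_nhds
    filter_upwards [this] with s hs
    have := hs.deriv_eq
    rw [hder] at this
    simpa using this
  have h4 : d = 0 := by
    have := h3.deriv_eq
    rw [h2.deriv] at this
    simpa using this
  linarith

/-- Right increments suffice, so a norm in the penalty can be replaced by its triangle inequality
bound and never has to be differentiated. -/
lemma deriv_nonpos_of_right_max {θ : ℝ → ℝ} {d a : ℝ} (h : HasDerivAt θ d a)
    (hmax : ∀ s, a < s → θ s ≤ θ a) : d ≤ 0 := by
  have h1 := h.hasDerivWithinAt (s := Ioi a)
  rw [hasDerivWithinAt_iff_tendsto_slope' (by simp)] at h1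
  refine le_of_tendsto h1 ?_
  filter_upwards [self_mem_nhdsWithin] with s hs
  rw [slope_def_field]
  exact div_nonpos_of_nonpos_of_nonneg (by linarith [hmax s hs]) (by linarith [mem_Ioi.1 hs])

lemma deriv_nonneg_of_left_max {θ : ℝ → ℝ} {d a c : ℝ} (hca : c < a) (h : HasDerivAt θ d a)
    (hmax : ∀ s, c < s → s < a → θ s ≤ θ a) : 0 ≤ d := by
  have h1 := h.hasDerivWithinAt (s := Iio a)
  rw [hasDerivWithinAt_iff_tendsto_slope' (by simp)] at h1
  refine ge_of_tendsto h1 ?_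
  filter_upwards [self_mem_nhdsWithin, Ioo_mem_nhdsLT hca] with s hs hs'
  rw [slope_def_field]
  exact div_nonneg_of_nonpos (by linarith [hmax s hs'.1 hs'.2]) (by linarith [mem_Iio.1 hs])

/-- If a continuous function on `[0,T] × X`, negative at time `0` and negative outside a compact
set, is somewhere nonnegative, then there is a first time at which it vanishes. -/
lemma exists_first_touching {X : Type*} [TopologicalSpace X] {T : ℝ}
    {Φ : ℝ → X → ℝ} (hc : ContinuousOn (fun p : ℝ × X => Φ p.1 p.2) (Icc 0 T ×ˢ univ))
    {S : Set X} (hS : IsCompact S) (hSc : IsClosed S)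
    (hout : ∀ t ∈ Icc 0 T, ∀ x, x ∉ S → Φ t x < 0)
    (h0 : ∀ x, Φ 0 x < 0) {t₁ : ℝ} (ht₁ : t₁ ∈ Icc 0 T) {x₁ : X} (hx₁ : 0 ≤ Φ t₁ x₁) :
    ∃ t₀ x₀, 0 < t₀ ∧ t₀ ≤ T ∧ Φ t₀ x₀ = 0 ∧ (∀ x, Φ t₀ x ≤ 0) ∧
      ∀ t, 0 < t → t < t₀ → Φ t x₀ ≤ 0 := by
  have hcS := hc.mono (prod_mono_right (subset_univ S) : Icc 0 T ×ˢ S ⊆ Icc 0 T ×ˢ univ)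
  have hK : IsCompact (Icc 0 T ×ˢ S) := isCompact_Icc.prod hS
  have hZc : IsCompact ((Icc 0 T ×ˢ S) ∩ (fun p : ℝ × X => Φ p.1 p.2) ⁻¹' (Ici 0)) := by
    refine hK.of_isClosed_subset ?_ inter_subset_left
    exact hcS.preimage_isClosed_of_isClosed (isClosed_Icc.prod hSc) isClosed_Ici
  have hx₁S : x₁ ∈ S := by
    by_contra h
    linarith [hout t₁ ht₁ x₁ h]
  -- The point minimises time over the compact set where `Φ ≥ 0`. Before that time `Φ` is negative
  -- everywhere, so `Φ ≤ 0` at that time by continuity from the left.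
  obtain ⟨⟨t₀, x₀⟩, ⟨⟨ht₀, hx₀S⟩, hpos⟩, hmin⟩ :=
    hZc.exists_isMinOn ⟨(t₁, x₁), ⟨ht₁, hx₁S⟩, hx₁⟩ continuous_fst.continuousOn
  simp only [mem_preimage, mem_Ici] at hpos ht₀ hx₀S
  have hlt : ∀ t x, 0 ≤ t → t < t₀ → Φ t x < 0 := by
    intro t x ht htt
    by_contra! h
    have hx : x ∈ S := by
      by_contra h'
      linarith [hout t ⟨ht, htt.le.trans ht₀.2⟩ x h']
    have := hmin (show (t, x) ∈ _ from ⟨⟨⟨ht, htt.le.trans ht₀.2⟩, hx⟩, h⟩)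
    simp only [mem_ofPred_eq] at this
    linarith
  have ht₀pos : 0 < t₀ := by
    rcases ht₀.1.lt_or_eq with h | h
    · exact h
    · rw [← h] at hpos; linarith [h0 x₀]
  have hle : ∀ x, Φ t₀ x ≤ 0 := by
    intro x
    have hcx : ContinuousOn (fun t => Φ t x) (Icc 0 T) :=
      hc.comp (f := fun t => (t, x)) (by fun_prop) (fun t ht => ⟨ht, mem_univ _⟩)
    have h1 : Tendsto (fun t => Φ t x) (𝓝[Ioo 0 t₀] t₀) (𝓝 (Φ t₀ x)) :=
      (hcx t₀ ht₀).mono_left (nhdsWithin_mono _ fun t ht => ⟨ht.1.le, ht.2.le.trans ht₀.2⟩)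
    have : (𝓝[Ioo 0 t₀] t₀).NeBot := by
      rw [nhdsWithin_Ioo_eq_nhdsLT ht₀pos]; infer_instance
    refine le_of_tendsto h1 ?_
    filter_upwards [self_mem_nhdsWithin] with t ht using (hlt t x ht.1.le ht.2).le
  exact ⟨t₀, x₀, ht₀pos, ht₀.2, le_antisymm (hle x₀) hpos, hle, fun t h h' => (hlt t x₀ h.le h').le⟩

variable {E : Type*} [NormedAddCommGroup E] [InnerProductSpace ℝ E] {ι : Type*} [Fintype ι]

/-- `w` is a classical solution of `∂ₜ w = ∑ᵢ ∂ᵢᵢ w + g(w) ‖∇w‖²` on `(0,T]`, continuous on `[0,T]`,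
with gradient `P` and second derivatives `H` in the directions `b i`. -/
structure IsFlow (g : ℝ → ℝ) (T : ℝ) (b : ι → E) (w : ℝ → E → ℝ) (P : ℝ → E → E)
    (H : ℝ → E → ι → ℝ) : Prop where
  cont : ContinuousOn (fun p : ℝ × E => w p.1 p.2) (Icc 0 T ×ˢ univ)
  grad : ∀ t, 0 < t → t ≤ T → ∀ x e, HasDerivAt (fun s : ℝ => w t (x + s • e)) ⟪P t x, e⟫ 0
  hess : ∀ t, 0 < t → t ≤ T → ∀ x i,
    HasDerivAt (fun s : ℝ => ⟪P t (x + s • b i), b i⟫) (H t x i) 0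
  time : ∀ t, 0 < t → t ≤ T → ∀ x,
    HasDerivAt (fun s => w s x) (∑ i, H t x i + g (w t x) * ‖P t x‖ ^ 2) t

variable {g : ℝ → ℝ} {T : ℝ} {b : ι → E} {w : ℝ → E → ℝ} {P : ℝ → E → E} {H : ℝ → E → ι → ℝ}

lemma IsFlow.line (hw : IsFlow g T b w P H) {t : ℝ} (ht : 0 < t) (htT : t ≤ T) (x e : E) (s : ℝ) :
    HasDerivAt (fun s : ℝ => w t (x + s • e)) ⟪P t (x + s • e), e⟫ s := by
  have h := hw.grad t ht htT (x + s • e) e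
  rw [← sub_self s] at h
  refine (h.comp_sub_const s s).congr_of_eventuallyEq (Eventually.of_forall fun r => ?_)
  dsimp only
  congr 1
  rw [add_assoc, ← add_smul]
  congr 2
  ring

lemma hasDerivAt_norm_sq_line (x e : E) (s : ℝ) :
    HasDerivAt (fun s : ℝ => ‖x + s • e‖ ^ 2) (2 * ⟪x + s • e, e⟫) s := by
  have h : HasDerivAt (fun s : ℝ => x + s • e) e s := by
    simpa using ((hasDerivAt_id s).smul_const e).const_add x
  exact h.norm_sq

lemma hasDerivAt_inner_line (x e : E) (s : ℝ) :
    HasDerivAt (fun s : ℝ => ⟪x + s • e, e⟫) (‖e‖ ^ 2) s := by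
  have h : HasDerivAt (fun s : ℝ => x + s • e) e s := by
    simpa using ((hasDerivAt_id s).smul_const e).const_add x
  have := h.inner ℝ (hasDerivAt_const s e)
  simpa using this

/-- First and second order conditions at a maximum under simultaneous translation of all points. -/
lemma IsFlow.synchronous (hw : IsFlow g T b w P H) {t : ℝ} (ht : 0 < t) (htT : t ≤ T)
    (c₁ c₂ c₃ q : ℝ) (x₁ x₂ x₃ x y : E)
    (hmax : ∀ (e : E) (s : ℝ), c₁ * w t (x₁ + s • e) + c₂ * w t (x₂ + s • e)
      + c₃ * w t (x₃ + s • e) - q * (‖x + s • e‖ ^ 2 + ‖y + s • e‖ ^ 2) ≤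
      c₁ * w t x₁ + c₂ * w t x₂ + c₃ * w t x₃ - q * (‖x‖ ^ 2 + ‖y‖ ^ 2)) :
    c₁ • P t x₁ + c₂ • P t x₂ + c₃ • P t x₃ = (2 * q) • (x + y) ∧
    ∀ i, c₁ * H t x₁ i + c₂ * H t x₂ i + c₃ * H t x₃ i ≤ 4 * q * ‖b i‖ ^ 2 := by
  have hd : ∀ e s, HasDerivAt (fun s : ℝ => c₁ * w t (x₁ + s • e) + c₂ * w t (x₂ + s • e)
      + c₃ * w t (x₃ + s • e) - q * (‖x + s • e‖ ^ 2 + ‖y + s • e‖ ^ 2))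
      (c₁ * ⟪P t (x₁ + s • e), e⟫ + c₂ * ⟪P t (x₂ + s • e), e⟫ + c₃ * ⟪P t (x₃ + s • e), e⟫
        - q * (2 * ⟪x + s • e, e⟫ + 2 * ⟪y + s • e, e⟫)) s := fun e s =>
    ((((hw.line ht htT x₁ e s).const_mul c₁).add ((hw.line ht htT x₂ e s).const_mul c₂)).add
      ((hw.line ht htT x₃ e s).const_mul c₃)).sub
      (((hasDerivAt_norm_sq_line x e s).add (hasDerivAt_norm_sq_line y e s)).const_mul q)
  constructor
  · refine ext_inner_right ℝ fun e => ?_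
    have h0 := IsLocalMax.hasDerivAt_eq_zero
      (Eventually.of_forall fun s => by simpa using hmax e s) (hd e 0)
    simp only [zero_smul, add_zero] at h0
    simp only [inner_add_left, real_inner_smul_left]
    linarith
  · intro i
    have h2 := ((((hw.hess t ht htT x₁ i).const_mul c₁).add
      ((hw.hess t ht htT x₂ i).const_mul c₂)).add ((hw.hess t ht htT x₃ i).const_mul c₃)).sub
      ((((hasDerivAt_inner_line x (b i) 0).const_mul 2).add
        ((hasDerivAt_inner_line y (b i) 0).const_mul 2)).const_mul q)
    have h3 := (deriv_conditions_of_max (hd (b i)) h2 (fun s => by simpa using hmax (b i) s)).2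
    linarith

set_option maxHeartbeats 1600000 in
/-- Lipschitz bounds propagate, with a constant that solves `ℓ' = a ℓ³`. -/
theorem IsFlow.lipschitz [ProperSpace E] (hw : IsFlow g T b w P H) (hb : ∀ i, ‖b i‖ = 1)
    {a B C₀ m Λ : ℝ} (ha : 0 ≤ a) (hB : 0 ≤ B) (hC₀ : 0 ≤ C₀)
    (hgrow : ∀ t ∈ Icc 0 T, ∀ x, |w t x| ≤ C₀ * (1 + ‖x‖))
    (hm : ∀ t ∈ Icc 0 T, ∀ x, m ≤ w t x)
    (hgB : ∀ t ∈ Icc 0 T, ∀ x, |g (w t x)| ≤ B * (1 + ‖x‖))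
    (hga : ∀ z z', m ≤ z → z ≤ z' → g z' - g z ≤ a * (z' - z))
    {ℓ : ℝ → ℝ} (hℓc : ContinuousOn ℓ (Icc 0 T)) (hℓ0 : ∀ t ∈ Icc 0 T, 0 ≤ ℓ t)
    (hℓΛ : ∀ t ∈ Icc 0 T, ℓ t ≤ Λ)
    (hℓ : ∀ t, 0 < t → t ≤ T → HasDerivAt ℓ (a * ℓ t ^ 3) t)
    (hlip : ∀ x y, w 0 x - w 0 y ≤ ℓ 0 * ‖x - y‖) :
    ∀ t ∈ Icc 0 T, ∀ x y, w t x - w t y ≤ ℓ t * ‖x - y‖ := by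
  intro t₁ ht₁ x₁ y₁
  have h0T : (0 : ℝ) ∈ Icc 0 T := ⟨le_rfl, ht₁.1.trans ht₁.2⟩
  have hΛ : 0 ≤ Λ := (hℓ0 0 h0T).trans (hℓΛ 0 h0T)
  set N : ℝ := (Fintype.card ι : ℝ) with hN
  -- A bound for `q (2 + ‖x‖ + ‖y‖)` at the touching point, where `q = ε exp(Kt)`: the penalty there
  -- is at most the linear growth of `w`, and `(2 + X + Y)² ≤ 12 (1 + X² + Y²)`.
  set c : ℝ := 12 * C₀ with hc
  have hc0 : 0 ≤ c := by positivity
  -- The coefficients of all error terms below, plus one for a strict contradiction.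
  set K : ℝ := 4 * N + a * (Λ + 2 * c) ^ 2 + 8 * a * Λ * (Λ + c) + 6 * B * (2 * Λ + 8 * c) + 1
    with hK
  have hK0 : 0 ≤ K := by positivity
  have key : ∀ ε : ℝ, 0 < ε → w t₁ x₁ - w t₁ y₁ - ℓ t₁ * ‖x₁ - y₁‖
      - ε * Real.exp (K * t₁) * (1 + (‖x₁‖ ^ 2 + ‖y₁‖ ^ 2)) < 0 := by
    intro ε hε
    by_contra! hcon
    have hcont : ContinuousOn (fun p : ℝ × (E × E) => w p.1 p.2.1 - w p.1 p.2.2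
        - ℓ p.1 * ‖p.2.1 - p.2.2‖
        - ε * Real.exp (K * p.1) * (1 + (‖p.2.1‖ ^ 2 + ‖p.2.2‖ ^ 2))) (Icc 0 T ×ˢ univ) := by
      have e1 : ContinuousOn (fun p : ℝ × (E × E) => w p.1 p.2.1) (Icc 0 T ×ˢ univ) :=
        hw.cont.comp (f := fun p : ℝ × (E × E) => (p.1, p.2.1)) (by fun_prop)
          (fun p hp => ⟨hp.1, mem_univ _⟩)
      have e2 : ContinuousOn (fun p : ℝ × (E × E) => w p.1 p.2.2) (Icc 0 T ×ˢ univ) :=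
        hw.cont.comp (f := fun p : ℝ × (E × E) => (p.1, p.2.2)) (by fun_prop)
          (fun p hp => ⟨hp.1, mem_univ _⟩)
      have e3 : ContinuousOn (fun p : ℝ × (E × E) => ℓ p.1) (Icc 0 T ×ˢ univ) :=
        hℓc.comp (by fun_prop) (fun p hp => hp.1)
      exact ((e1.sub e2).sub (e3.mul (by fun_prop))).sub (by fun_prop)
    have hexp : ∀ t ∈ Icc 0 T, ε ≤ ε * Real.exp (K * t) := fun t ht =>
      le_mul_of_one_le_right hε.le (Real.one_le_exp (mul_nonneg hK0 ht.1))
    obtain ⟨t, ⟨x, y⟩, ht, htT, hz, hle, hlt⟩ := exists_first_touching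
      (Φ := fun t (p : E × E) => w t p.1 - w t p.2 - ℓ t * ‖p.1 - p.2‖
        - ε * Real.exp (K * t) * (1 + (‖p.1‖ ^ 2 + ‖p.2‖ ^ 2))) hcont
      -- Outside this ball the quadratic penalty beats the linear growth of `w`.
      (isCompact_closedBall (0 : E × E) (max 1 (4 * C₀ / ε))) Metric.isClosed_closedBall
      (by
        rintro t ht ⟨x, y⟩ hp
        simp only [Metric.mem_closedBall, dist_zero_right, not_le, max_lt_iff] at hp
        obtain ⟨hp1, hp2⟩ := hp
        set M := ‖((x, y) : E × E)‖ with hM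
        have hx : ‖x‖ ≤ M := norm_fst_le (x, y)
        have hy : ‖y‖ ≤ M := norm_snd_le (x, y)
        have hM2 : M ^ 2 ≤ ‖x‖ ^ 2 + ‖y‖ ^ 2 := prod_norm_sq_le x y
        have h1 := (abs_le.1 (hgrow t ht x)).2
        have h2 := (abs_le.1 (hgrow t ht y)).1
        have h3 : C₀ * (1 + ‖x‖) ≤ C₀ * (1 + M) := by gcongr
        have h4 : C₀ * (1 + ‖y‖) ≤ C₀ * (1 + M) := by gcongr
        have h5 : 4 * C₀ < ε * M := by rw [div_lt_iff₀ hε] at hp2; linarith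
        have h6 : 0 ≤ ℓ t * ‖x - y‖ := mul_nonneg (hℓ0 t ht) (norm_nonneg _)
        have h7 : ε * (1 + M ^ 2) ≤ ε * Real.exp (K * t) * (1 + (‖x‖ ^ 2 + ‖y‖ ^ 2)) :=
          mul_le_mul (hexp t ht) (by linarith) (by positivity) (by positivity)
        have h8 : C₀ * (1 + M) ≤ C₀ * (2 * M) := by gcongr; linarith
        have h9 : 4 * C₀ * M ≤ ε * M * M := by gcongr
        change w t x - w t y - ℓ t * ‖x - y‖ - _ < 0
        linarith)
      (by
        rintro ⟨x, y⟩
        have := hlip x y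
        have h2 : 0 < ε * Real.exp (K * 0) * (1 + (‖x‖ ^ 2 + ‖y‖ ^ 2)) := by positivity
        change w 0 x - w 0 y - ℓ 0 * ‖x - y‖ - _ < 0
        linarith)
      ht₁ (x₁ := (x₁, y₁)) hcon
    simp only at hz hlt
    have hle' : ∀ x y, w t x - w t y - ℓ t * ‖x - y‖
        - ε * Real.exp (K * t) * (1 + (‖x‖ ^ 2 + ‖y‖ ^ 2)) ≤ 0 := fun x y => hle (x, y)
    have htI : t ∈ Icc 0 T := ⟨ht.le, htT⟩
    set q : ℝ := ε * Real.exp (K * t) with hq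
    have hq0 : 0 < q := by positivity
    set X := ‖x‖ with hX
    set Y := ‖y‖ with hY
    have hX0 : 0 ≤ X := norm_nonneg _
    have hY0 : 0 ≤ Y := norm_nonneg _
    set l := ℓ t with hl
    have hl0 : 0 ≤ l := hℓ0 t htI
    have hlΛ : l ≤ Λ := hℓΛ t htI
    -- first order conditions
    obtain ⟨hP, hH⟩ := hw.synchronous ht htT 1 (-1) 0 q x y y x y (by
      intro e s
      have h1 := hle' (x + s • e) (y + s • e)
      rw [add_sub_add_right_eq_sub] at h1
      linarith)
    have hP' : P t x - P t y = (2 * q) • (x + y) := by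
      rw [← hP]; simp [sub_eq_add_neg]
    -- Moving `x` alone changes `l‖x - y‖` by at most `l` times the displacement, so the gradient at
    -- `x` is bounded by `l` up to the penalty.
    have hPx : ‖P t x - (2 * q) • x‖ ≤ l := by
      have hdir : ∀ e : E, ⟪P t x - (2 * q) • x, e⟫ ≤ l * ‖e‖ := by
        intro e
        have hd := ((hw.grad t ht htT x e).sub
          ((hasDerivAt_norm_sq_line x e 0).const_mul q)).sub
          ((hasDerivAt_id (0 : ℝ)).mul_const (l * ‖e‖))
        have := deriv_nonpos_of_right_max hd (fun s hs => by
          have h1 := hle' (x + s • e) y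
          have h2 : ‖x + s • e - y‖ ≤ ‖x - y‖ + s * ‖e‖ := by
            have : x + s • e - y = (x - y) + s • e := by abel
            rw [this]
            refine (norm_add_le _ _).trans ?_
            rw [norm_smul, Real.norm_of_nonneg hs.le]
          have h3 : l * ‖x + s • e - y‖ ≤ l * (‖x - y‖ + s * ‖e‖) := by gcongr
          simp only [Pi.sub_apply, id, zero_smul, add_zero, zero_mul, sub_zero]
          linarith)
        simp only [zero_smul, add_zero, one_mul] at this
        rw [inner_sub_left, real_inner_smul_left]
        linarith
      have h1 := hdir (P t x - (2 * q) • x)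
      rw [real_inner_self_eq_norm_sq] at h1
      exact le_of_sq_le_mul hl0 h1
    have hqc : q * (2 + X + Y) ≤ c := by
      have h1 := (abs_le.1 (hgrow t htI x)).2
      have h2 := (abs_le.1 (hgrow t htI y)).1
      have h3 : 0 ≤ l * ‖x - y‖ := by positivity
      have h4 : q * (1 + (X ^ 2 + Y ^ 2)) ≤ C₀ * (2 + X + Y) := by linarith
      have h5 : (2 + X + Y) ^ 2 ≤ 12 * (1 + (X ^ 2 + Y ^ 2)) :=
        two_add_add_sq_le X Y
      have h6 : q * (2 + X + Y) * (2 + X + Y) ≤ c * (2 + X + Y) := by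
        have e1 := mul_le_mul_of_nonneg_left h5 hq0.le
        rw [hc]; linarith
      exact le_of_mul_le_mul_right h6 (by positivity)
    have hqX : q * X ≤ c := le_trans (by gcongr; linarith) hqc
    have hqY : q * Y ≤ c := le_trans (by gcongr; linarith) hqc
    have hPx1 : ‖P t x‖ ≤ l + 2 * (q * X) := by
      have : P t x = (P t x - (2 * q) • x) + (2 * q) • x := by abel
      rw [this]
      refine (norm_add_le _ _).trans ?_
      rw [norm_smul, Real.norm_of_nonneg (by positivity : 0 ≤ 2 * q)]
      linarith
    have hPd : ‖P t x - P t y‖ ≤ 2 * q * (X + Y) := by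
      rw [hP', norm_smul, Real.norm_of_nonneg (by positivity : 0 ≤ 2 * q)]
      gcongr
      exact norm_add_le _ _
    have hPy1 : ‖P t y‖ ≤ l + 6 * c := by
      have : P t y = P t x - (P t x - P t y) := by abel
      rw [this]
      refine (norm_sub_le _ _).trans ?_
      linarith
    -- the time derivative
    have htime := ((((hw.time t ht htT x).sub (hw.time t ht htT y)).sub
      ((hℓ t ht htT).mul_const ‖x - y‖)).sub
      ((((hasDerivAt_id t).const_mul K).exp.const_mul ε).mul_const (1 + (X ^ 2 + Y ^ 2))))
    have hD := deriv_nonneg_of_left_max ht htime (fun s hs hst => by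
      have h1 := hlt s hs hst
      simp only [Pi.sub_apply, id]
      linarith)
    simp only [id, mul_one] at hD
    set S := 1 + (X ^ 2 + Y ^ 2) with hS
    have hsum : ∑ i, H t x i - ∑ i, H t y i ≤ 4 * q * N := by
      rw [← Finset.sum_sub_distrib]
      calc ∑ i, (H t x i - H t y i) ≤ ∑ _i : ι, 4 * q := by
            refine Finset.sum_le_sum fun i _ => ?_
            have := hH i
            rw [hb i] at this
            linarith
        _ = 4 * q * N := by simp [hN]; ring
    set d := ‖x - y‖ with hd
    have hd0 : 0 ≤ d := norm_nonneg _
    have hdXY : d ≤ X + Y := norm_sub_le _ _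
    have hwxy : w t x - w t y = l * d + q * S := by linarith
    have hS1 : 1 ≤ S := by rw [hS]; linarith [sq_nonneg X, sq_nonneg Y]
    have hgd : g (w t x) - g (w t y) ≤ a * (l * d + q * S) := by
      rw [← hwxy]
      refine hga _ _ (hm t htI y) ?_
      have : 0 ≤ l * d + q * S := by positivity
      linarith
    -- The leading term `a (l d) l²` is exactly cancelled by `ℓ' d = a l³ d`; everything else is a
    -- multiple of `q S`.
    have t1 : (g (w t x) - g (w t y)) * ‖P t x‖ ^ 2 ≤
        a * (l * d) * l ^ 2 + 8 * a * Λ * (Λ + c) * (q * S) + a * (Λ + 2 * c) ^ 2 * (q * S) := by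
      have e1 : ‖P t x‖ ^ 2 ≤ (l + 2 * (q * X)) ^ 2 := by gcongr
      have e2 : (g (w t x) - g (w t y)) * ‖P t x‖ ^ 2 ≤
          a * (l * d + q * S) * (l + 2 * (q * X)) ^ 2 :=
        (mul_le_mul_of_nonneg_right hgd (by positivity)).trans
          (mul_le_mul_of_nonneg_left e1 (by positivity))
      have e3 : (l + 2 * (q * X)) ^ 2 ≤ (Λ + 2 * c) ^ 2 := by gcongr
      have e4 : d * X ≤ 2 * S := mul_le_of_le_add hX0 hdXY
      have e5 : a * l * 4 * (l + q * X) * q * (d * X) ≤ a * Λ * 4 * (Λ + c) * q * (2 * S) := by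
        gcongr
      have e6 : a * (q * S) * (l + 2 * (q * X)) ^ 2 ≤ a * (q * S) * (Λ + 2 * c) ^ 2 := by
        gcongr
      have e7 : a * (l * d + q * S) * (l + 2 * (q * X)) ^ 2 = a * (l * d) * l ^ 2
        + a * l * 4 * (l + q * X) * q * (d * X) + a * (q * S) * (l + 2 * (q * X)) ^ 2 := by ring
      linarith
    -- The two gradients differ by `O(q (X + Y))`, which compensates the linear growth of `g(w)`.
    have t2 : g (w t y) * (‖P t x‖ ^ 2 - ‖P t y‖ ^ 2) ≤ 6 * B * (2 * Λ + 8 * c) * (q * S) := by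
      have e1 : |‖P t x‖ ^ 2 - ‖P t y‖ ^ 2| ≤ 2 * q * (X + Y) * (2 * Λ + 8 * c) := by
        have : ‖P t x‖ ^ 2 - ‖P t y‖ ^ 2 = (‖P t x‖ - ‖P t y‖) * (‖P t x‖ + ‖P t y‖) := by ring
        rw [this, abs_mul]
        have r1 : |‖P t x‖ - ‖P t y‖| ≤ 2 * q * (X + Y) := (abs_norm_sub_norm_le _ _).trans hPd
        have r2 : |‖P t x‖ + ‖P t y‖| ≤ 2 * Λ + 8 * c := by
          rw [abs_of_nonneg (by positivity)]; linarith
        gcongr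
      have e2 : (1 + Y) * (X + Y) ≤ 3 * S :=
        one_add_mul_add_le X Y
      calc g (w t y) * (‖P t x‖ ^ 2 - ‖P t y‖ ^ 2)
          ≤ |g (w t y) * (‖P t x‖ ^ 2 - ‖P t y‖ ^ 2)| := le_abs_self _
        _ = |g (w t y)| * |‖P t x‖ ^ 2 - ‖P t y‖ ^ 2| := abs_mul _ _
        _ ≤ (B * (1 + Y)) * (2 * q * (X + Y) * (2 * Λ + 8 * c)) :=
            mul_le_mul (hgB t htI y) e1 (abs_nonneg _) (by positivity)
        _ = 2 * B * (2 * Λ + 8 * c) * q * ((1 + Y) * (X + Y)) := by ring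
        _ ≤ 2 * B * (2 * Λ + 8 * c) * q * (3 * S) := by gcongr
        _ = _ := by ring
    have t3 : 4 * q * N ≤ 4 * N * (q * S) := by
      have : 4 * N * q * 1 ≤ 4 * N * q * S := by gcongr
      linarith
    have hqS : 0 < q * S := by positivity
    have hKS : K * (q * S) = 4 * N * (q * S) + a * (Λ + 2 * c) ^ 2 * (q * S)
      + 8 * a * Λ * (Λ + c) * (q * S) + 6 * B * (2 * Λ + 8 * c) * (q * S) + q * S := by
      rw [hK]; ring
    have hfin : ε * (Real.exp (K * t) * K) * S = K * (q * S) := by rw [hq]; ring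
    have hl3 : a * l ^ 3 * d = a * (l * d) * l ^ 2 := by ring
    linarith
  by_contra! hcon
  -- `K` does not depend on `ε`, so the penalty disappears as `ε → 0`.
  have hlim : Tendsto (fun ε : ℝ => w t₁ x₁ - w t₁ y₁ - ℓ t₁ * ‖x₁ - y₁‖
      - ε * Real.exp (K * t₁) * (1 + (‖x₁‖ ^ 2 + ‖y₁‖ ^ 2))) (𝓝[>] 0)
      (𝓝 (w t₁ x₁ - w t₁ y₁ - ℓ t₁ * ‖x₁ - y₁‖
      - 0 * Real.exp (K * t₁) * (1 + (‖x₁‖ ^ 2 + ‖y₁‖ ^ 2)))) :=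
    (Continuous.tendsto (by fun_prop) 0).mono_left nhdsWithin_le_nhds
  have := le_of_tendsto hlim (by
    filter_upwards [self_mem_nhdsWithin] with ε hε using (key ε hε).le)
  simp only [zero_mul, sub_zero] at this
  linarith

set_option maxHeartbeats 1600000 in
/-- Convexity propagates if `g` is convex. -/
theorem IsFlow.convexOn [ProperSpace E] (hw : IsFlow g T b w P H) (hb : ∀ i, ‖b i‖ = 1)
    {a B C₀ m Λ : ℝ} (ha : 0 ≤ a) (hB : 0 ≤ B) (hC₀ : 0 ≤ C₀) (hΛ : 0 ≤ Λ)
    (hgrow : ∀ t ∈ Icc 0 T, ∀ x, |w t x| ≤ C₀ * (1 + ‖x‖))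
    (hm : ∀ t ∈ Icc 0 T, ∀ x, m ≤ w t x)
    (hgB : ∀ t ∈ Icc 0 T, ∀ x, |g (w t x)| ≤ B * (1 + ‖x‖))
    (hga : ∀ z z', m ≤ z → z ≤ z' → g z' - g z ≤ a * (z' - z))
    (hgc : ConvexOn ℝ (Ici m) g)
    (hlip : ∀ t ∈ Icc 0 T, ∀ x y, w t x - w t y ≤ Λ * ‖x - y‖)
    (hconv : ConvexOn ℝ univ (w 0)) :
    ∀ t ∈ Icc 0 T, ConvexOn ℝ univ (w t) := by
  intro t₁ ht₁
  refine ⟨convex_univ, fun x₁ _ y₁ _ α β hα hβ hαβ => ?_⟩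
  simp only [smul_eq_mul]
  rcases hα.eq_or_lt with h | hα0
  · have : β = 1 := by linarith
    simp [← h, this]
  rcases hβ.eq_or_lt with h | hβ0
  · have : α = 1 := by linarith
    simp [← h, this]
  have hα1 : α ≤ 1 := by linarith
  have hβ1 : β ≤ 1 := by linarith
  set N : ℝ := (Fintype.card ι : ℝ) with hN
  set K : ℝ := 4 * N + a * Λ ^ 2 + 16 * Λ * B + 1 with hK
  have hK0 : 0 ≤ K := by positivity
  have key : ∀ ε : ℝ, 0 < ε → w t₁ (α • x₁ + β • y₁) - α * w t₁ x₁ - β * w t₁ y₁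
      - ε * Real.exp (K * t₁) * (1 + (‖x₁‖ ^ 2 + ‖y₁‖ ^ 2)) < 0 := by
    intro ε hε
    by_contra! hcon
    have hcont : ContinuousOn (fun p : ℝ × (E × E) => w p.1 (α • p.2.1 + β • p.2.2)
        - α * w p.1 p.2.1 - β * w p.1 p.2.2
        - ε * Real.exp (K * p.1) * (1 + (‖p.2.1‖ ^ 2 + ‖p.2.2‖ ^ 2))) (Icc 0 T ×ˢ univ) := by
      have e1 : ContinuousOn (fun p : ℝ × (E × E) => w p.1 p.2.1) (Icc 0 T ×ˢ univ) :=
        hw.cont.comp (f := fun p : ℝ × (E × E) => (p.1, p.2.1)) (by fun_prop)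
          (fun p hp => ⟨hp.1, mem_univ _⟩)
      have e2 : ContinuousOn (fun p : ℝ × (E × E) => w p.1 p.2.2) (Icc 0 T ×ˢ univ) :=
        hw.cont.comp (f := fun p : ℝ × (E × E) => (p.1, p.2.2)) (by fun_prop)
          (fun p hp => ⟨hp.1, mem_univ _⟩)
      have e3 : ContinuousOn (fun p : ℝ × (E × E) => w p.1 (α • p.2.1 + β • p.2.2))
          (Icc 0 T ×ˢ univ) :=
        hw.cont.comp (f := fun p : ℝ × (E × E) => (p.1, α • p.2.1 + β • p.2.2)) (by fun_prop)
          (fun p hp => ⟨hp.1, mem_univ _⟩)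
      exact ((e3.sub (e1.const_mul α)).sub (e2.const_mul β)).sub (by fun_prop)
    have hexp : ∀ t ∈ Icc 0 T, ε ≤ ε * Real.exp (K * t) := fun t ht =>
      le_mul_of_one_le_right hε.le (Real.one_le_exp (mul_nonneg hK0 ht.1))
    obtain ⟨t, ⟨x, y⟩, ht, htT, hz, hle, hlt⟩ := exists_first_touching
      (Φ := fun t (p : E × E) => w t (α • p.1 + β • p.2) - α * w t p.1 - β * w t p.2
        - ε * Real.exp (K * t) * (1 + (‖p.1‖ ^ 2 + ‖p.2‖ ^ 2))) hcont
      (isCompact_closedBall (0 : E × E) (max 1 (4 * C₀ / ε))) Metric.isClosed_closedBall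
      (by
        rintro t ht ⟨x, y⟩ hp
        simp only [Metric.mem_closedBall, dist_zero_right, not_le, max_lt_iff] at hp
        obtain ⟨hp1, hp2⟩ := hp
        set M := ‖((x, y) : E × E)‖ with hM
        have hx : ‖x‖ ≤ M := norm_fst_le (x, y)
        have hy : ‖y‖ ≤ M := norm_snd_le (x, y)
        have hM2 : M ^ 2 ≤ ‖x‖ ^ 2 + ‖y‖ ^ 2 := prod_norm_sq_le x y
        have hzM : ‖α • x + β • y‖ ≤ M := by
          refine (norm_add_le _ _).trans ?_
          rw [norm_smul, norm_smul, Real.norm_of_nonneg hα, Real.norm_of_nonneg hβ]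
          have e1 : α * ‖x‖ ≤ α * M := by gcongr
          have e2 : β * ‖y‖ ≤ β * M := by gcongr
          have e3 : α * M + β * M = M := by rw [← add_mul, hαβ, one_mul]
          linarith
        have h1 := (abs_le.1 (hgrow t ht (α • x + β • y))).2
        have h2 := (abs_le.1 (hgrow t ht x)).1
        have h2' := (abs_le.1 (hgrow t ht y)).1
        have h3 : C₀ * (1 + ‖x‖) ≤ C₀ * (1 + M) := by gcongr
        have h4 : C₀ * (1 + ‖y‖) ≤ C₀ * (1 + M) := by gcongr
        have h4' : C₀ * (1 + ‖α • x + β • y‖) ≤ C₀ * (1 + M) := by gcongr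
        have h5 : 4 * C₀ < ε * M := by rw [div_lt_iff₀ hε] at hp2; linarith
        have h7 : ε * (1 + M ^ 2) ≤ ε * Real.exp (K * t) * (1 + (‖x‖ ^ 2 + ‖y‖ ^ 2)) :=
          mul_le_mul (hexp t ht) (by linarith) (by positivity) (by positivity)
        have h8 : C₀ * (1 + M) ≤ C₀ * (2 * M) := by gcongr; linarith
        have h9 : 4 * C₀ * M ≤ ε * M * M := by gcongr
        have h10 : α * (-(C₀ * (1 + M))) ≤ α * w t x := by gcongr; linarith
        have h11 : β * (-(C₀ * (1 + M))) ≤ β * w t y := by gcongr; linarith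
        have h12 : α * (-(C₀ * (1 + M))) + β * (-(C₀ * (1 + M))) = -(C₀ * (1 + M)) := by
          rw [← add_mul, hαβ, one_mul]
        change w t (α • x + β • y) - α * w t x - β * w t y - _ < 0
        linarith)
      (by
        rintro ⟨x, y⟩
        have := hconv.2 (mem_univ x) (mem_univ y) hα hβ hαβ
        simp only [smul_eq_mul] at this
        have h2 : 0 < ε * Real.exp (K * 0) * (1 + (‖x‖ ^ 2 + ‖y‖ ^ 2)) := by positivity
        change w 0 (α • x + β • y) - α * w 0 x - β * w 0 y - _ < 0
        linarith)
      ht₁ (x₁ := (x₁, y₁)) hcon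
    simp only at hz hlt
    have hle' : ∀ x y, w t (α • x + β • y) - α * w t x - β * w t y
        - ε * Real.exp (K * t) * (1 + (‖x‖ ^ 2 + ‖y‖ ^ 2)) ≤ 0 := fun x y => hle (x, y)
    have htI : t ∈ Icc 0 T := ⟨ht.le, htT⟩
    set q : ℝ := ε * Real.exp (K * t) with hq
    have hq0 : 0 < q := by positivity
    set X := ‖x‖ with hX
    set Y := ‖y‖ with hY
    have hX0 : 0 ≤ X := norm_nonneg _
    have hY0 : 0 ≤ Y := norm_nonneg _
    set z := α • x + β • y with hzdef
    -- Because `α + β = 1`, translating `x` and `y` by the same vector translates `z` by it, so the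
    -- second derivatives at the three points can be combined.
    obtain ⟨-, hH⟩ := hw.synchronous ht htT 1 (-α) (-β) q z x y x y (by
      intro e s
      have h1 := hle' (x + s • e) (y + s • e)
      have h2 : α • (x + s • e) + β • (y + s • e) = z + s • e := by
        rw [hzdef, smul_add, smul_add, add_add_add_comm, ← add_smul, hαβ, one_smul]
      rw [h2] at h1
      linarith)
    -- Displacing `x` alone by `s e` displaces `z` by `s α e`; stationarity then compares the
    -- gradients at `z` and `x`.
    have hPx : α • (P t z - P t x) = (2 * q) • x := by
      refine ext_inner_right ℝ fun e => ?_
      have hd := ((hw.grad t ht htT z (α • e)).sub ((hw.grad t ht htT x e).const_mul α)).sub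
        ((hasDerivAt_norm_sq_line x e 0).const_mul q)
      have h0 := IsLocalMax.hasDerivAt_eq_zero (Eventually.of_forall fun s => by
        have h1 := hle' (x + s • e) y
        have h2 : α • (x + s • e) + β • y = z + s • α • e := by
          rw [hzdef, smul_add, smul_comm α s e]; abel
        rw [h2] at h1
        simp only [Pi.sub_apply, zero_smul, add_zero]
        linarith) hd
      simp only [zero_smul, add_zero, real_inner_smul_right] at h0
      simp only [real_inner_smul_left, inner_sub_left]
      linarith
    have hPy : β • (P t z - P t y) = (2 * q) • y := by
      refine ext_inner_right ℝ fun e => ?_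
      have hd := ((hw.grad t ht htT z (β • e)).sub ((hw.grad t ht htT y e).const_mul β)).sub
        ((hasDerivAt_norm_sq_line y e 0).const_mul q)
      have h0 := IsLocalMax.hasDerivAt_eq_zero (Eventually.of_forall fun s => by
        have h1 := hle' x (y + s • e)
        have h2 : α • x + β • (y + s • e) = z + s • β • e := by
          rw [hzdef, smul_add, smul_comm β s e]; abel
        rw [h2] at h1
        simp only [Pi.sub_apply, zero_smul, add_zero]
        linarith) hd
      simp only [zero_smul, add_zero, real_inner_smul_right] at h0
      simp only [real_inner_smul_left, inner_sub_left]
      linarith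
    have hPΛ : ∀ x, ‖P t x‖ ≤ Λ := by
      intro x
      have hd := (hw.grad t ht htT x (P t x)).sub
        ((hasDerivAt_id (0 : ℝ)).mul_const (Λ * ‖P t x‖))
      have := deriv_nonpos_of_right_max hd (fun s hs => by
        have h1 := hlip t htI (x + s • P t x) x
        rw [add_sub_cancel_left, norm_smul, Real.norm_of_nonneg hs.le] at h1
        simp only [Pi.sub_apply, id, zero_smul, add_zero, zero_mul, sub_zero]
        linarith)
      rw [real_inner_self_eq_norm_sq] at this
      exact le_of_sq_le_mul hΛ (by linarith)
    have htime := ((((hw.time t ht htT z).sub ((hw.time t ht htT x).const_mul α)).sub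
      ((hw.time t ht htT y).const_mul β)).sub
      ((((hasDerivAt_id t).const_mul K).exp.const_mul ε).mul_const (1 + (X ^ 2 + Y ^ 2))))
    have hD := deriv_nonneg_of_left_max ht htime (fun s hs hst => by
      have h1 := hlt s hs hst
      simp only [Pi.sub_apply, id]
      linarith)
    simp only [id, mul_one] at hD
    set S := 1 + (X ^ 2 + Y ^ 2) with hS
    have hsum : ∑ i, H t z i - α * ∑ i, H t x i - β * ∑ i, H t y i ≤ 4 * q * N := by
      rw [Finset.mul_sum, Finset.mul_sum, ← Finset.sum_sub_distrib, ← Finset.sum_sub_distrib]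
      calc ∑ i, (H t z i - α * H t x i - β * H t y i) ≤ ∑ _i : ι, 4 * q := by
            refine Finset.sum_le_sum fun i _ => ?_
            have := hH i
            rw [hb i] at this
            linarith
        _ = 4 * q * N := by simp [hN]; ring
    have hS1 : 1 ≤ S := by rw [hS]; linarith [sq_nonneg X, sq_nonneg Y]
    -- Convexity of `g` enters only here: the combination is at most `g(w(z)) - g(αw(x) + βw(y))`,
    -- and the two arguments differ by the positive amount `q S`.
    have hgd : g (w t z) - α * g (w t x) - β * g (w t y) ≤ a * (q * S) := by
      have h1 := hgc.2 (mem_Ici.2 (hm t htI x)) (mem_Ici.2 (hm t htI y)) hα hβ hαβ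
      simp only [smul_eq_mul] at h1
      have h2 : m ≤ α * w t x + β * w t y := by
        have e1 : α * m ≤ α * w t x := by gcongr; exact hm t htI x
        have e2 : β * m ≤ β * w t y := by gcongr; exact hm t htI y
        have e3 : α * m + β * m = m := by rw [← add_mul, hαβ, one_mul]
        linarith
      have h3 : 0 < q * S := by positivity
      have h4 := hga _ (w t z) h2 (by linarith)
      have h5 : w t z - (α * w t x + β * w t y) = q * S := by linarith
      rw [h5] at h4
      linarith
    have t1 : (g (w t z) - α * g (w t x) - β * g (w t y)) * ‖P t z‖ ^ 2 ≤
        a * Λ ^ 2 * (q * S) := by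
      have e1 : ‖P t z‖ ^ 2 ≤ Λ ^ 2 := by gcongr; exact hPΛ z
      have e2 : a * (q * S) * ‖P t z‖ ^ 2 ≤ a * (q * S) * Λ ^ 2 := by gcongr
      have e3 := mul_le_mul_of_nonneg_right hgd (sq_nonneg ‖P t z‖)
      linarith
    -- The weight `γ` stays with the gradient difference: only the weighted difference is controlled
    -- uniformly in `γ`.
    have aux : ∀ (γ : ℝ) (p : E), 0 < γ → ‖p‖ ^ 2 ≤ S → γ • (P t z - P t p) = (2 * q) • p →
        γ * (g (w t p) * (‖P t z‖ ^ 2 - ‖P t p‖ ^ 2)) ≤ 8 * Λ * B * (q * S) := by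
      intro γ p hγ hpS hp
      have e0 : γ * ‖P t z - P t p‖ = 2 * q * ‖p‖ := by
        have := congrArg norm hp
        rwa [norm_smul, norm_smul, Real.norm_of_nonneg hγ.le,
          Real.norm_of_nonneg (by positivity : 0 ≤ 2 * q)] at this
      have e1 : γ * |‖P t z‖ ^ 2 - ‖P t p‖ ^ 2| ≤ 2 * q * ‖p‖ * (2 * Λ) := by
        have : ‖P t z‖ ^ 2 - ‖P t p‖ ^ 2 = (‖P t z‖ - ‖P t p‖) * (‖P t z‖ + ‖P t p‖) := by ring
        rw [this, abs_mul, ← mul_assoc]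
        have r1 : γ * |‖P t z‖ - ‖P t p‖| ≤ 2 * q * ‖p‖ := by
          rw [← e0]
          gcongr
          exact abs_norm_sub_norm_le _ _
        have r2 : |‖P t z‖ + ‖P t p‖| ≤ 2 * Λ := by
          rw [abs_of_nonneg (by positivity)]; linarith [hPΛ z, hPΛ p]
        gcongr
      have e2 : (1 + ‖p‖) * ‖p‖ ≤ 2 * S := one_add_mul_self_le hpS hS1
      calc γ * (g (w t p) * (‖P t z‖ ^ 2 - ‖P t p‖ ^ 2))
          ≤ γ * (|g (w t p)| * |‖P t z‖ ^ 2 - ‖P t p‖ ^ 2|) := by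
            rw [← abs_mul]; gcongr; exact le_abs_self _
        _ = |g (w t p)| * (γ * |‖P t z‖ ^ 2 - ‖P t p‖ ^ 2|) := by ring
        _ ≤ (B * (1 + ‖p‖)) * (2 * q * ‖p‖ * (2 * Λ)) :=
            mul_le_mul (hgB t htI p) e1 (by positivity) (by positivity)
        _ = 4 * Λ * B * q * ((1 + ‖p‖) * ‖p‖) := by ring
        _ ≤ 4 * Λ * B * q * (2 * S) := by gcongr
        _ = _ := by ring
    have t2 := aux α x hα0 (by rw [hS, ← hX]; linarith [sq_nonneg Y]) hPx
    have t2' := aux β y hβ0 (by rw [hS, ← hY]; linarith [sq_nonneg X]) hPy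
    have t3 : 4 * q * N ≤ 4 * N * (q * S) := by
      have : 4 * N * q * 1 ≤ 4 * N * q * S := by gcongr
      linarith
    have hqS : 0 < q * S := by positivity
    have hKS : K * (q * S) = 4 * N * (q * S) + a * Λ ^ 2 * (q * S)
      + 16 * Λ * B * (q * S) + q * S := by
      rw [hK]; ring
    have hfin : ε * (Real.exp (K * t) * K) * S = K * (q * S) := by rw [hq]; ring
    linarith
  by_contra! hcon
  have hlim : Tendsto (fun ε : ℝ => w t₁ (α • x₁ + β • y₁) - α * w t₁ x₁ - β * w t₁ y₁
      - ε * Real.exp (K * t₁) * (1 + (‖x₁‖ ^ 2 + ‖y₁‖ ^ 2))) (𝓝[>] 0)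
      (𝓝 (w t₁ (α • x₁ + β • y₁) - α * w t₁ x₁ - β * w t₁ y₁
      - 0 * Real.exp (K * t₁) * (1 + (‖x₁‖ ^ 2 + ‖y₁‖ ^ 2)))) :=
    (Continuous.tendsto (by fun_prop) 0).mono_left nhdsWithin_le_nhds
  have := le_of_tendsto hlim (by
    filter_upwards [self_mem_nhdsWithin] with ε hε using (key ε hε).le)
  simp only [zero_mul, sub_zero] at this
  linarith

end MaximumPrinciple

/-! ### The heat flow of functions of Gaussian growth -/

section HeatKernel

variable {n : ℕ}

lemma integrable_exp_neg_mul_norm_sq {b : ℝ} (hb : 0 < b) :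
    Integrable fun y : EuclideanSpace ℝ (Fin n) => Real.exp (-b * ‖y‖ ^ 2) := by
  -- A non-integrable function has Bochner integral `0`, whereas the known Gaussian integral is
  -- positive.
  by_contra h
  have h1 := GaussianFourier.integral_rexp_neg_mul_sq_norm (V := EuclideanSpace ℝ (Fin n)) hb
  rw [integral_undef h] at h1
  have : 0 < (Real.pi / b) ^ (Module.finrank ℝ (EuclideanSpace ℝ (Fin n)) / 2 : ℝ) := by positivity
  linarith

lemma linear_le_quadratic {b : ℝ} (hb : 0 < b) (c s : ℝ) : c * s ≤ b * s ^ 2 + c ^ 2 / (4 * b) := by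
  have h : b * s ^ 2 + c ^ 2 / (4 * b) - c * s = (2 * b * s - c) ^ 2 / (4 * b) := by
    field_simp; ring
  have : 0 ≤ (2 * b * s - c) ^ 2 / (4 * b) := by positivity
  linarith

lemma integrable_exp_quadratic {b : ℝ} (hb : 0 < b) (A c : ℝ) :
    Integrable fun y : EuclideanSpace ℝ (Fin n) => A * Real.exp (-b * ‖y‖ ^ 2 + c * ‖y‖) := by
  have h1 := (integrable_exp_neg_mul_norm_sq (n := n) (half_pos hb)).const_mul
    (Real.exp (c ^ 2 / (4 * (b / 2))))
  refine (h1.mono' (by fun_prop) (Eventually.of_forall fun y => ?_)).const_mul A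
  rw [Real.norm_of_nonneg (Real.exp_pos _).le, ← Real.exp_add]
  refine Real.exp_le_exp.2 ?_
  have := linear_le_quadratic (half_pos hb) c ‖y‖
  linarith

lemma integrable_of_gauss_bound {G : Type*} [NormedAddCommGroup G]
    {ψ : EuclideanSpace ℝ (Fin n) → G} (hψ : AEStronglyMeasurable ψ)
    {A b c : ℝ} (hb : 0 < b) (h : ∀ y, ‖ψ y‖ ≤ A * Real.exp (-b * ‖y‖ ^ 2 + c * ‖y‖)) :
    Integrable ψ :=
  (integrable_exp_quadratic hb A c).mono' hψ (Eventually.of_forall h)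

lemma gaussKernel_pos (z : EuclideanSpace ℝ (Fin n)) {t : ℝ} (ht : 0 < t) :
    0 < gaussKernel z t := by
  unfold gaussKernel; positivity

lemma continuous_gaussKernel (t : ℝ) :
    Continuous fun z : EuclideanSpace ℝ (Fin n) => gaussKernel z t := by
  unfold gaussKernel; fun_prop

lemma gaussKernel_le {t₀ t₁ t : ℝ} (h0 : 0 < t₀) (h : t₀ ≤ t) (h' : t ≤ t₁)
    (z : EuclideanSpace ℝ (Fin n)) :
    gaussKernel z t ≤ (4 * Real.pi * t₀) ^ (-(n : ℝ) / 2) * Real.exp (-(1 / (4 * t₁)) * ‖z‖ ^ 2) := by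
  unfold gaussKernel
  have ht : 0 < t := h0.trans_le h
  refine mul_le_mul ?_ (Real.exp_le_exp.2 ?_) (Real.exp_pos _).le (by positivity)
  · refine Real.rpow_le_rpow_of_nonpos (by positivity) (by gcongr) ?_
    have : (0 : ℝ) ≤ n := Nat.cast_nonneg n
    linarith
  · have : 1 / (4 * t₁) ≤ 1 / (4 * t) := by gcongr
    have h2 := mul_le_mul_of_nonneg_right this (sq_nonneg ‖z‖)
    have h3 : -‖z‖ ^ 2 / (4 * t) = -(1 / (4 * t) * ‖z‖ ^ 2) := by ring
    rw [h3]
    linarith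

/-- A Gaussian bound for the heat kernel times a function of Gaussian growth, locally uniform in
the space and time variables, with room for polynomial factors. -/
lemma kernel_mul_bound {t₀ t₁ C β R D : ℝ} (h0 : 0 < t₀) (h01 : t₀ ≤ t₁) (hD : 0 ≤ D)
    {φ : EuclideanSpace ℝ (Fin n) → ℝ} (hφ : ∀ y, |φ y| ≤ C * Real.exp (β * ‖y‖ ^ 2))
    {t : ℝ} (ht : t ∈ Icc t₀ t₁) {x : EuclideanSpace ℝ (Fin n)} (hx : ‖x‖ ≤ R)
    (y : EuclideanSpace ℝ (Fin n)) {d : ℝ} (hd : d ≤ D * Real.exp (2 * ‖x - y‖)) :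
    d * |gaussKernel (x - y) t * φ y| ≤
      D * Real.exp (2 * R) * (4 * Real.pi * t₀) ^ (-(n : ℝ) / 2) * C *
        Real.exp (-(1 / (4 * t₁) - β) * ‖y‖ ^ 2 + (2 * R / (4 * t₁) + 2) * ‖y‖) := by
  have ht1 : 0 < t₁ := h0.trans_le h01
  have hC : 0 ≤ C := by
    have := (abs_nonneg _).trans (hφ 0)
    simpa using this
  have e1 := gaussKernel_le h0 ht.1 ht.2 (x - y)
  have e2 := hφ y
  have e3 : d ≤ D * Real.exp (2 * R + 2 * ‖y‖) := by
    refine hd.trans ?_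
    gcongr
    linarith [norm_sub_le x y]
  have e4 : (‖y‖ ^ 2 - 2 * R * ‖y‖) ≤ ‖x - y‖ ^ 2 := by
    have h1 : ‖y‖ - ‖x‖ ≤ ‖x - y‖ := by rw [norm_sub_rev]; exact norm_sub_norm_le y x
    have h2 : ‖x‖ - ‖y‖ ≤ ‖x - y‖ := norm_sub_norm_le x y
    have h3 : (‖x‖ - ‖y‖) ^ 2 ≤ ‖x - y‖ ^ 2 := sq_le_sq' (by linarith) h2
    have h4 : ‖x‖ * ‖y‖ ≤ R * ‖y‖ := by gcongr
    nlinarith [sq_nonneg ‖x‖]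
  have e5 : Real.exp (-(1 / (4 * t₁)) * ‖x - y‖ ^ 2) ≤
      Real.exp (-(1 / (4 * t₁)) * (‖y‖ ^ 2 - 2 * R * ‖y‖)) := by
    refine Real.exp_le_exp.2 ?_
    have := mul_le_mul_of_nonneg_left e4 (by positivity : 0 ≤ 1 / (4 * t₁))
    linarith
  rw [abs_mul, abs_of_pos (gaussKernel_pos _ (h0.trans_le ht.1))]
  calc d * (gaussKernel (x - y) t * |φ y|)
      ≤ (D * Real.exp (2 * R + 2 * ‖y‖)) * (((4 * Real.pi * t₀) ^ (-(n : ℝ) / 2) *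
          Real.exp (-(1 / (4 * t₁)) * (‖y‖ ^ 2 - 2 * R * ‖y‖))) *
          (C * Real.exp (β * ‖y‖ ^ 2))) := by
        refine mul_le_mul e3 (mul_le_mul (e1.trans ?_) e2 (abs_nonneg _) (by positivity)) ?_
          (by positivity)
        · gcongr
        · have := gaussKernel_pos (x - y) (h0.trans_le ht.1)
          positivity
    _ = D * (4 * Real.pi * t₀) ^ (-(n : ℝ) / 2) * C * (Real.exp (2 * R + 2 * ‖y‖) *
          Real.exp (-(1 / (4 * t₁)) * (‖y‖ ^ 2 - 2 * R * ‖y‖)) * Real.exp (β * ‖y‖ ^ 2)) := by ring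
    _ = D * (4 * Real.pi * t₀) ^ (-(n : ℝ) / 2) * C * (Real.exp (2 * R) *
          Real.exp (-(1 / (4 * t₁) - β) * ‖y‖ ^ 2 + (2 * R / (4 * t₁) + 2) * ‖y‖)) := by
        rw [← Real.exp_add, ← Real.exp_add, ← Real.exp_add]
        congr 2
        ring
    _ = _ := by ring

/-- Derivatives of the kernel bring linear and quadratic factors in `‖x - y‖`. Both are absorbed
into `exp(2‖x - y‖)`, the form that `kernel_mul_bound` accepts. -/
lemma le_exp_two_mul (s : ℝ) : s ≤ Real.exp (2 * s) := by
  have := Real.add_one_le_exp (2 * s)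
  rcases le_total s 0 with h | h
  · exact h.trans (Real.exp_pos _).le
  · linarith

lemma sq_le_exp_two_mul {s : ℝ} (hs : 0 ≤ s) : s ^ 2 ≤ Real.exp (2 * s) := by
  have h := Real.add_one_le_exp s
  have : Real.exp (2 * s) = Real.exp s ^ 2 := by rw [← Real.exp_nat_mul]; norm_num
  rw [this]
  gcongr
  linarith

variable {φ : EuclideanSpace ℝ (Fin n) → ℝ} {C β : ℝ}

/-- The spatial gradient of the heat flow. -/
def heatGrad (φ : EuclideanSpace ℝ (Fin n) → ℝ) (t : ℝ) (x : EuclideanSpace ℝ (Fin n)) :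
    EuclideanSpace ℝ (Fin n) :=
  ∫ y, (-(1 / (2 * t)) * (gaussKernel (x - y) t * φ y)) • (x - y)

/-- The second derivative of the heat flow in the direction `e`. -/
def heatHess (φ : EuclideanSpace ℝ (Fin n) → ℝ) (t : ℝ) (x e : EuclideanSpace ℝ (Fin n)) : ℝ :=
  ∫ y, (⟪x - y, e⟫ ^ 2 / (4 * t ^ 2) - ‖e‖ ^ 2 / (2 * t)) * (gaussKernel (x - y) t * φ y)

/-- The condition `β < 1/(4t)` says that the Gaussian decay of the kernel beats the growth of `φ`;
the exponential growth of the coefficient is of lower order. -/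
lemma integrable_coeff_mul_kernel {G : Type*} [NormedAddCommGroup G] [NormedSpace ℝ G]
    (hφc : Continuous φ) (hφ : ∀ y, |φ y| ≤ C * Real.exp (β * ‖y‖ ^ 2)) {t : ℝ} (ht : 0 < t)
    (htβ : β < 1 / (4 * t)) (x : EuclideanSpace ℝ (Fin n)) {a : EuclideanSpace ℝ (Fin n) → G}
    (ha : Continuous a) {D : ℝ} (hD : 0 ≤ D)
    (haD : ∀ y, ‖a y‖ ≤ D * Real.exp (2 * ‖x - y‖)) :
    Integrable fun y => (gaussKernel (x - y) t * φ y) • a y := by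
  have hk := continuous_gaussKernel (n := n) t
  refine integrable_of_gauss_bound (Continuous.aestronglyMeasurable (by fun_prop))
    (sub_pos.2 htβ) (fun y => ?_) (A := D * Real.exp (2 * ‖x‖) *
      (4 * Real.pi * t) ^ (-(n : ℝ) / 2) * C) (c := 2 * ‖x‖ / (4 * t) + 2)
  · rw [norm_smul, mul_comm, Real.norm_eq_abs]
    exact kernel_mul_bound ht le_rfl hD hφ ⟨le_rfl, le_rfl⟩ le_rfl y (haD y)

lemma integrable_kernel_mul (hφc : Continuous φ)
    (hφ : ∀ y, |φ y| ≤ C * Real.exp (β * ‖y‖ ^ 2)) {t : ℝ} (ht : 0 < t)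
    (htβ : β < 1 / (4 * t)) (x : EuclideanSpace ℝ (Fin n)) :
    Integrable fun y => gaussKernel (x - y) t * φ y := by
  have := integrable_coeff_mul_kernel hφc hφ ht htβ x (a := fun _ => (1 : ℝ)) continuous_const
    zero_le_one (fun y => by simp)
  simpa using this

lemma hasDerivAt_gaussKernel_line (z e : EuclideanSpace ℝ (Fin n)) (t s : ℝ) :
    HasDerivAt (fun s : ℝ => gaussKernel (z + s • e) t)
      (-(1 / (2 * t)) * gaussKernel (z + s • e) t * ⟪z + s • e, e⟫) s := by
  have h := (((hasDerivAt_norm_sq_line z e s).neg.div_const (4 * t)).exp).const_mul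
    ((4 * Real.pi * t) ^ (-(n : ℝ) / 2))
  refine h.congr_deriv ?_
  unfold gaussKernel
  simp only [Pi.neg_apply]
  rw [show -(2 * ⟪z + s • e, e⟫) / (4 * t) = -(1 / (2 * t)) * ⟪z + s • e, e⟫ by
    rcases eq_or_ne t 0 with rfl | ht
    · simp
    · field_simp; ring]
  ring

lemma hasDerivAt_gaussKernel_line_snd (z e : EuclideanSpace ℝ (Fin n)) (t s : ℝ) :
    HasDerivAt (fun s : ℝ => -(1 / (2 * t)) * gaussKernel (z + s • e) t * ⟪z + s • e, e⟫)
      ((⟪z + s • e, e⟫ ^ 2 / (4 * t ^ 2) - ‖e‖ ^ 2 / (2 * t)) * gaussKernel (z + s • e) t) s := by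
  have h := ((hasDerivAt_gaussKernel_line z e t s).const_mul (-(1 / (2 * t)))).mul
    (hasDerivAt_inner_line z e s)
  refine h.congr_deriv ?_
  rcases eq_or_ne t 0 with rfl | ht
  · simp
  · field_simp; ring

lemma hasDerivAt_gaussKernel_time (z : EuclideanSpace ℝ (Fin n)) {t : ℝ} (ht : 0 < t) :
    HasDerivAt (fun t : ℝ => gaussKernel z t)
      ((‖z‖ ^ 2 / (4 * t ^ 2) - n / (2 * t)) * gaussKernel z t) t := by
  have h1 : HasDerivAt (fun t : ℝ => 4 * Real.pi * t) (4 * Real.pi) t := by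
    simpa using (hasDerivAt_id t).const_mul (4 * Real.pi)
  have h2 := h1.rpow_const (p := -(n : ℝ) / 2) (Or.inl (by positivity))
  have h3 : HasDerivAt (fun t : ℝ => -‖z‖ ^ 2 / (4 * t)) (‖z‖ ^ 2 / (4 * t ^ 2)) t := by
    have h4 : HasDerivAt (fun t : ℝ => 4 * t) 4 t := by
      simpa using (hasDerivAt_id t).const_mul (4 : ℝ)
    refine ((hasDerivAt_const t (-‖z‖ ^ 2)).div h4 (by positivity)).congr_deriv ?_
    field_simp
    ring
  refine (h2.mul h3.exp).congr_deriv ?_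
  unfold gaussKernel
  rw [Real.rpow_sub_one (by positivity)]
  field_simp
  ring

lemma inner_heatGrad (hφc : Continuous φ)
    (hφ : ∀ y, |φ y| ≤ C * Real.exp (β * ‖y‖ ^ 2)) {t : ℝ} (ht : 0 < t)
    (htβ : β < 1 / (4 * t)) (x e : EuclideanSpace ℝ (Fin n)) :
    ⟪heatGrad φ t x, e⟫ = ∫ y, -(1 / (2 * t)) * gaussKernel (x - y) t * ⟪x - y, e⟫ * φ y := by
  have hint : Integrable fun y => (-(1 / (2 * t)) * (gaussKernel (x - y) t * φ y)) • (x - y) := by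
    have := (integrable_coeff_mul_kernel hφc hφ ht htβ x (a := fun y => x - y) (by fun_prop)
      zero_le_one (fun y => by rw [one_mul]; exact le_exp_two_mul _)).smul (-(1 / (2 * t)))
    refine this.congr (Eventually.of_forall fun y => ?_)
    simp only [Pi.smul_apply, smul_smul]
  have h2 := integral_inner (𝕜 := ℝ) hint e
  unfold heatGrad
  rw [real_inner_comm, ← h2]
  refine integral_congr_ae (Eventually.of_forall fun y => ?_)
  simp only [real_inner_smul_right]
  rw [real_inner_comm]
  ring

/-- Differentiation under the integral; displacements with `|s| < 1` are dominated at once by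
`kernel_mul_bound` with radius `‖x‖ + ‖e‖`. -/
lemma hasDerivAt_heatFlow_line (hφc : Continuous φ)
    (hφ : ∀ y, |φ y| ≤ C * Real.exp (β * ‖y‖ ^ 2)) {t : ℝ} (ht : 0 < t)
    (htβ : β < 1 / (4 * t)) (x e : EuclideanSpace ℝ (Fin n)) :
    HasDerivAt (fun s : ℝ => heatFlow φ t (x + s • e)) ⟪heatGrad φ t x, e⟫ 0 := by
  have hk := continuous_gaussKernel (n := n) t
  have hsub : ∀ (s : ℝ) (y : EuclideanSpace ℝ (Fin n)), x + s • e - y = (x - y) + s • e :=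
    fun s y => by abel
  have key := hasDerivAt_integral_of_dominated_loc_of_deriv_le (μ := volume) (𝕜 := ℝ)
    (F := fun s y => gaussKernel (x + s • e - y) t * φ y)
    (F' := fun s y => -(1 / (2 * t)) * gaussKernel (x + s • e - y) t * ⟪x + s • e - y, e⟫ * φ y)
    (x₀ := 0) (s := Metric.ball 0 1)
    (bound := fun y => ‖e‖ / (2 * t) * Real.exp (2 * (‖x‖ + ‖e‖)) *
      (4 * Real.pi * t) ^ (-(n : ℝ) / 2) * C *
        Real.exp (-(1 / (4 * t) - β) * ‖y‖ ^ 2 + (2 * (‖x‖ + ‖e‖) / (4 * t) + 2) * ‖y‖))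
    (Metric.ball_mem_nhds _ one_pos)
    (Eventually.of_forall fun s => Continuous.aestronglyMeasurable (by fun_prop))
    (by simpa using integrable_kernel_mul hφc hφ ht htβ x)
    (Continuous.aestronglyMeasurable (by fun_prop))
    (Eventually.of_forall fun y s hs => by
      have hs1 : |s| ≤ 1 := by
        simpa [Real.dist_eq] using (Metric.mem_ball.1 hs).le
      have hx : ‖x + s • e‖ ≤ ‖x‖ + ‖e‖ := by
        refine (norm_add_le _ _).trans ?_
        rw [norm_smul, Real.norm_eq_abs]
        have := mul_le_mul_of_nonneg_right hs1 (norm_nonneg e)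
        linarith
      refine le_trans (le_of_eq ?_) (kernel_mul_bound (d := |⟪x + s • e - y, e⟫| / (2 * t)) ht le_rfl
        (by positivity) hφ ⟨le_rfl, le_rfl⟩ hx y ?_)
      · rw [Real.norm_eq_abs, abs_mul, abs_mul, abs_mul, abs_mul, abs_neg,
          abs_of_pos (by positivity : 0 < 1 / (2 * t))]
        ring
      · have h1 := abs_real_inner_le_norm (x + s • e - y) e
        have h2 := le_exp_two_mul ‖x + s • e - y‖
        calc |⟪x + s • e - y, e⟫| / (2 * t) ≤ (‖x + s • e - y‖ * ‖e‖) / (2 * t) := by gcongr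
          _ ≤ (Real.exp (2 * ‖x + s • e - y‖) * ‖e‖) / (2 * t) := by gcongr
          _ = _ := by ring)
    (integrable_exp_quadratic (sub_pos.2 htβ) _ _)
    (Eventually.of_forall fun y s _ => by
      simp only [hsub]
      exact (hasDerivAt_gaussKernel_line (x - y) e t s).mul_const (φ y))
  refine (key.2.congr_of_eventuallyEq (Eventually.of_forall fun s => ?_)).congr_deriv ?_
  · simp only [heatFlow, if_pos ht]
  · rw [inner_heatGrad hφc hφ ht htβ]
    simp only [zero_smul, add_zero]

lemma abs_hess_coeff_le (z e : EuclideanSpace ℝ (Fin n)) {t : ℝ} (ht : 0 < t) :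
    |⟪z, e⟫ ^ 2 / (4 * t ^ 2) - ‖e‖ ^ 2 / (2 * t)| ≤
      (‖e‖ ^ 2 / (4 * t ^ 2) + ‖e‖ ^ 2 / (2 * t)) * Real.exp (2 * ‖z‖) := by
  have h1 : ⟪z, e⟫ ^ 2 ≤ ‖z‖ ^ 2 * ‖e‖ ^ 2 := by
    rw [← mul_pow, ← sq_abs]
    gcongr
    exact abs_real_inner_le_norm z e
  have h2 := sq_le_exp_two_mul (norm_nonneg z)
  have h3 : 1 ≤ Real.exp (2 * ‖z‖) := Real.one_le_exp (by positivity)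
  have h4 : ⟪z, e⟫ ^ 2 / (4 * t ^ 2) ≤ Real.exp (2 * ‖z‖) * ‖e‖ ^ 2 / (4 * t ^ 2) := by
    gcongr
    exact h1.trans (by gcongr)
  have h5 : ‖e‖ ^ 2 / (2 * t) * 1 ≤ ‖e‖ ^ 2 / (2 * t) * Real.exp (2 * ‖z‖) := by gcongr
  have h6 : 0 ≤ ⟪z, e⟫ ^ 2 / (4 * t ^ 2) := by positivity
  have h7 : 0 ≤ ‖e‖ ^ 2 / (2 * t) := by positivity
  have h8 : Real.exp (2 * ‖z‖) * ‖e‖ ^ 2 / (4 * t ^ 2) =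
    ‖e‖ ^ 2 / (4 * t ^ 2) * Real.exp (2 * ‖z‖) := by ring
  rw [abs_le, add_mul]
  constructor <;> linarith

lemma hasDerivAt_heatGrad_line (hφc : Continuous φ)
    (hφ : ∀ y, |φ y| ≤ C * Real.exp (β * ‖y‖ ^ 2)) {t : ℝ} (ht : 0 < t)
    (htβ : β < 1 / (4 * t)) (x e : EuclideanSpace ℝ (Fin n)) :
    HasDerivAt (fun s : ℝ => ⟪heatGrad φ t (x + s • e), e⟫) (heatHess φ t x e) 0 := by
  have hk := continuous_gaussKernel (n := n) t
  have hsub : ∀ (s : ℝ) (y : EuclideanSpace ℝ (Fin n)), x + s • e - y = (x - y) + s • e :=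
    fun s y => by abel
  have key := hasDerivAt_integral_of_dominated_loc_of_deriv_le (μ := volume) (𝕜 := ℝ)
    (F := fun s y => -(1 / (2 * t)) * gaussKernel (x + s • e - y) t * ⟪x + s • e - y, e⟫ * φ y)
    (F' := fun s y => (⟪x + s • e - y, e⟫ ^ 2 / (4 * t ^ 2) - ‖e‖ ^ 2 / (2 * t)) *
      gaussKernel (x + s • e - y) t * φ y)
    (x₀ := 0) (s := Metric.ball 0 1)
    (bound := fun y => (‖e‖ ^ 2 / (4 * t ^ 2) + ‖e‖ ^ 2 / (2 * t)) * Real.exp (2 * (‖x‖ + ‖e‖)) *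
      (4 * Real.pi * t) ^ (-(n : ℝ) / 2) * C *
        Real.exp (-(1 / (4 * t) - β) * ‖y‖ ^ 2 + (2 * (‖x‖ + ‖e‖) / (4 * t) + 2) * ‖y‖))
    (Metric.ball_mem_nhds _ one_pos)
    (Eventually.of_forall fun s => Continuous.aestronglyMeasurable (by fun_prop))
    (by
      have := (integrable_coeff_mul_kernel hφc hφ ht htβ x
        (a := fun y => -(1 / (2 * t)) * ⟪x - y, e⟫) (by fun_prop)
        (by positivity : 0 ≤ ‖e‖ / (2 * t)) (fun y => by
          have h1 := abs_real_inner_le_norm (x - y) e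
          have h2 := le_exp_two_mul ‖x - y‖
          rw [norm_mul, norm_neg, Real.norm_of_nonneg (by positivity : 0 ≤ 1 / (2 * t)),
            Real.norm_eq_abs]
          calc 1 / (2 * t) * |⟪x - y, e⟫| ≤ 1 / (2 * t) * (‖x - y‖ * ‖e‖) := by gcongr
            _ ≤ 1 / (2 * t) * (Real.exp (2 * ‖x - y‖) * ‖e‖) := by gcongr
            _ = _ := by ring))
      refine this.congr (Eventually.of_forall fun y => ?_)
      simp only [smul_eq_mul, zero_smul, add_zero]
      ring)
    (Continuous.aestronglyMeasurable (by fun_prop))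
    (Eventually.of_forall fun y s hs => by
      have hs1 : |s| ≤ 1 := by
        simpa [Real.dist_eq] using (Metric.mem_ball.1 hs).le
      have hx : ‖x + s • e‖ ≤ ‖x‖ + ‖e‖ := by
        refine (norm_add_le _ _).trans ?_
        rw [norm_smul, Real.norm_eq_abs]
        have := mul_le_mul_of_nonneg_right hs1 (norm_nonneg e)
        linarith
      refine le_trans (le_of_eq ?_) (kernel_mul_bound ht le_rfl
        (by positivity) hφ ⟨le_rfl, le_rfl⟩ hx y
        (abs_hess_coeff_le (x + s • e - y) e ht))
      rw [Real.norm_eq_abs, ← abs_mul, mul_assoc])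
    (integrable_exp_quadratic (sub_pos.2 htβ) _ _)
    (Eventually.of_forall fun y s _ => by
      simp only [hsub]
      exact (hasDerivAt_gaussKernel_line_snd (x - y) e t s).mul_const (φ y))
  refine (key.2.congr_of_eventuallyEq (Eventually.of_forall fun s => ?_)).congr_deriv ?_
  · exact inner_heatGrad hφc hφ ht htβ (x + s • e) e
  · unfold heatHess
    refine integral_congr_ae (Eventually.of_forall fun y => ?_)
    simp only [zero_smul, add_zero]
    ring

lemma hasDerivAt_heatFlow_time (hφc : Continuous φ)
    (hφ : ∀ y, |φ y| ≤ C * Real.exp (β * ‖y‖ ^ 2)) {t : ℝ} (ht : 0 < t)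
    (htβ : β < 1 / (4 * t)) (x : EuclideanSpace ℝ (Fin n)) :
    HasDerivAt (fun s : ℝ => heatFlow φ s x)
      (∑ i, heatHess φ t x (EuclideanSpace.basisFun (Fin n) ℝ i)) t := by
  -- A slightly later time at which Gaussian decay still wins, so that one majorant serves all times
  -- in `[t/2, t₁]`.
  obtain ⟨t₁, htt₁, ht₁⟩ : ∃ t₁, t < t₁ ∧ β < 1 / (4 * t₁) := by
    have hc : ContinuousAt (fun s : ℝ => 1 / (4 * s)) t :=
      continuousAt_const.div (by fun_prop) (by positivity)
    have h1 : ∀ᶠ s in 𝓝[>] t, β < 1 / (4 * s) := (hc.eventually_const_lt htβ).filter_mono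
      nhdsWithin_le_nhds
    obtain ⟨s, hs, hs'⟩ := (h1.and self_mem_nhdsWithin).exists
    exact ⟨s, hs', hs⟩
  have hk : ∀ s : ℝ, Continuous fun z : EuclideanSpace ℝ (Fin n) => gaussKernel z s :=
    fun s => continuous_gaussKernel s
  have hcoef : ∀ s ∈ Icc (t / 2) t₁, ∀ z : EuclideanSpace ℝ (Fin n),
      |‖z‖ ^ 2 / (4 * s ^ 2) - n / (2 * s)| ≤
        (1 / (4 * (t / 2) ^ 2) + n / (2 * (t / 2))) * Real.exp (2 * ‖z‖) := by
    intro s hs z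
    have hs0 : 0 < s := (half_pos ht).trans_le hs.1
    have hs1 := hs.1
    have ht2 := half_pos ht
    have h2 := sq_le_exp_two_mul (norm_nonneg z)
    have h3 : 1 ≤ Real.exp (2 * ‖z‖) := Real.one_le_exp (by positivity)
    have h4 : ‖z‖ ^ 2 / (4 * s ^ 2) ≤ Real.exp (2 * ‖z‖) / (4 * (t / 2) ^ 2) := by gcongr
    have h5 : n / (2 * s) ≤ n / (2 * (t / 2)) * Real.exp (2 * ‖z‖) := by
      calc (n : ℝ) / (2 * s) ≤ n / (2 * (t / 2)) * 1 := by rw [mul_one]; gcongr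
        _ ≤ _ := by gcongr
    have h6 : 0 ≤ ‖z‖ ^ 2 / (4 * s ^ 2) := by positivity
    have h7 : 0 ≤ (n : ℝ) / (2 * s) := by positivity
    have h8 : Real.exp (2 * ‖z‖) / (4 * (t / 2) ^ 2) =
      1 / (4 * (t / 2) ^ 2) * Real.exp (2 * ‖z‖) := by ring
    rw [abs_le, add_mul]
    constructor <;> linarith
  have key := hasDerivAt_integral_of_dominated_loc_of_deriv_le (μ := volume) (𝕜 := ℝ)
    (F := fun s y => gaussKernel (x - y) s * φ y)
    (F' := fun s y => (‖x - y‖ ^ 2 / (4 * s ^ 2) - n / (2 * s)) * gaussKernel (x - y) s * φ y)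
    (x₀ := t) (s := Icc (t / 2) t₁)
    (bound := fun y => (1 / (4 * (t / 2) ^ 2) + n / (2 * (t / 2))) * Real.exp (2 * ‖x‖) *
      (4 * Real.pi * (t / 2)) ^ (-(n : ℝ) / 2) * C *
        Real.exp (-(1 / (4 * t₁) - β) * ‖y‖ ^ 2 + (2 * ‖x‖ / (4 * t₁) + 2) * ‖y‖))
    (Icc_mem_nhds (by linarith) htt₁)
    (Eventually.of_forall fun s => by
      have := hk s
      exact Continuous.aestronglyMeasurable (by fun_prop))
    (integrable_kernel_mul hφc hφ ht htβ x)
    (by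
      have := hk t
      exact Continuous.aestronglyMeasurable (by fun_prop))
    (Eventually.of_forall fun y s hs => by
      refine le_trans (le_of_eq ?_) (kernel_mul_bound (half_pos ht) (by linarith)
        (by positivity) hφ hs le_rfl y (hcoef s hs (x - y)))
      rw [Real.norm_eq_abs, ← abs_mul, mul_assoc])
    (integrable_exp_quadratic (sub_pos.2 ht₁) _ _)
    (Eventually.of_forall fun y s hs =>
      (hasDerivAt_gaussKernel_time (x - y) ((half_pos ht).trans_le hs.1)).mul_const (φ y))
  refine (key.2.congr_of_eventuallyEq ?_).congr_deriv ?_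
  · filter_upwards [lt_mem_nhds ht] with s hs
    simp only [heatFlow, if_pos hs]
  · unfold heatHess
    -- The heat equation: by Parseval the coefficients in the basis directions sum to `‖x -
    -- y‖²/(4t²) - n/(2t)`, the coefficient of the time derivative.
    rw [← integral_finsetSum]
    · refine integral_congr_ae (Eventually.of_forall fun y => ?_)
      dsimp only
      rw [← Finset.sum_mul, mul_assoc]
      congr 1
      rw [Finset.sum_sub_distrib, ← Finset.sum_div,
        ← OrthonormalBasis.sum_sq_inner_left (EuclideanSpace.basisFun (Fin n) ℝ) (x - y)]
      simp [Finset.sum_const]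
      ring
    · intro i _
      have := integrable_coeff_mul_kernel hφc hφ ht htβ x (a := fun y =>
        ⟪x - y, EuclideanSpace.basisFun (Fin n) ℝ i⟫ ^ 2 / (4 * t ^ 2)
          - ‖EuclideanSpace.basisFun (Fin n) ℝ i‖ ^ 2 / (2 * t)) (by fun_prop)
        (by positivity) (fun y => abs_hess_coeff_le (x - y) _ ht)
      refine this.congr (Eventually.of_forall fun y => ?_)
      simp only [smul_eq_mul]
      ring

lemma integral_gaussKernel_one : ∫ z : EuclideanSpace ℝ (Fin n), gaussKernel z 1 = 1 := by
  unfold gaussKernel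
  rw [integral_const_mul]
  have h := GaussianFourier.integral_rexp_neg_mul_sq_norm (V := EuclideanSpace ℝ (Fin n))
    (b := 1 / 4) (by norm_num)
  have h2 : ∀ z : EuclideanSpace ℝ (Fin n), -‖z‖ ^ 2 / (4 * 1) = -(1 / 4) * ‖z‖ ^ 2 := fun z => by
    ring
  simp only [h2, h]
  rw [finrank_euclideanSpace, Fintype.card_fin, mul_one,
    show Real.pi / (1 / 4) = 4 * Real.pi by ring, ← Real.rpow_add (by positivity)]
  have : -(n : ℝ) / 2 + n / 2 = 0 := by ring
  rw [this, Real.rpow_zero]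

lemma integrable_gaussKernel_one :
    Integrable fun z : EuclideanSpace ℝ (Fin n) => gaussKernel z 1 := by
  by_contra h
  have := integral_gaussKernel_one (n := n)
  rw [integral_undef h] at this
  exact zero_ne_one this

/-- The substitution `y = x - √t z` puts the time dependence into the argument of `φ`. Unlike the
kernel form, this remains meaningful at `t = 0`. -/
lemma heatFlow_eq_scaled (φ : EuclideanSpace ℝ (Fin n) → ℝ) {t : ℝ} (ht : 0 ≤ t)
    (x : EuclideanSpace ℝ (Fin n)) :
    heatFlow φ t x = ∫ z, gaussKernel z 1 * φ (x - √t • z) := by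
  rcases ht.eq_or_lt with rfl | ht
  · simp [heatFlow, integral_mul_const, integral_gaussKernel_one]
  · have hs : 0 < √t := Real.sqrt_pos.2 ht
    simp only [heatFlow, if_pos ht]
    have h1 := integral_sub_left_eq_self (fun y => gaussKernel (x - y) t * φ y) volume x
    rw [← h1]
    simp only [sub_sub_cancel]
    have h2 := Measure.integral_comp_smul (volume : Measure (EuclideanSpace ℝ (Fin n)))
      (fun y => gaussKernel y t * φ (x - y)) (√t)
    rw [finrank_euclideanSpace, Fintype.card_fin, abs_of_pos (by positivity), smul_eq_mul] at h2
    have h3 : ∫ y, gaussKernel y t * φ (x - y) =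
        √t ^ n * ∫ z, gaussKernel (√t • z) t * φ (x - √t • z) := by
      rw [h2]; field_simp
    rw [h3, ← integral_const_mul]
    refine integral_congr_ae (Eventually.of_forall fun z => ?_)
    dsimp only
    rw [← mul_assoc]
    congr 1
    unfold gaussKernel
    rw [norm_smul, mul_pow, Real.norm_of_nonneg hs.le, Real.sq_sqrt ht.le,
      Real.mul_rpow (by positivity) ht.le, mul_one, mul_one]
    have h4 : -(t * ‖z‖ ^ 2) / (4 * t) = -‖z‖ ^ 2 / 4 := by field_simp
    have h5 : √t ^ n * t ^ (-(n : ℝ) / 2) = 1 := by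
      rw [Real.sqrt_eq_rpow, ← Real.rpow_natCast, ← Real.rpow_mul ht.le, ← Real.rpow_add ht]
      have : 1 / 2 * (n : ℝ) + -(n : ℝ) / 2 = 0 := by ring
      rw [this, Real.rpow_zero]
    rw [h4]
    linear_combination ((4 * Real.pi) ^ (-(n : ℝ) / 2) * Real.exp (-‖z‖ ^ 2 / 4)) * h5

lemma scaled_bound (hφ : ∀ y, |φ y| ≤ C * Real.exp (β * ‖y‖ ^ 2)) (hβ : 0 ≤ β) {T : ℝ}
    (hT : 0 ≤ T) {t R : ℝ} (htT : t ≤ T) {x : EuclideanSpace ℝ (Fin n)}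
    (hx : ‖x‖ ≤ R) (z : EuclideanSpace ℝ (Fin n)) :
    |gaussKernel z 1 * φ (x - √t • z)| ≤ (4 * Real.pi * 1) ^ (-(n : ℝ) / 2) * C *
      Real.exp (β * R ^ 2) * Real.exp (-(1 / 4 - β * T) * ‖z‖ ^ 2 + 2 * β * R * √T * ‖z‖) := by
  have hC : 0 ≤ C := by
    have := (abs_nonneg _).trans (hφ 0)
    simpa using this
  have hR : 0 ≤ R := (norm_nonneg _).trans hx
  have e1 : ‖x - √t • z‖ ≤ R + √T * ‖z‖ := by
    refine (norm_sub_le _ _).trans ?_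
    rw [norm_smul, Real.norm_of_nonneg (Real.sqrt_nonneg t)]
    gcongr
  have e2 : |φ (x - √t • z)| ≤ C * Real.exp (β * (R + √T * ‖z‖) ^ 2) :=
    (hφ _).trans (by gcongr)
  rw [abs_mul, abs_of_pos (gaussKernel_pos z one_pos)]
  calc gaussKernel z 1 * |φ (x - √t • z)|
      ≤ gaussKernel z 1 * (C * Real.exp (β * (R + √T * ‖z‖) ^ 2)) :=
        mul_le_mul_of_nonneg_left e2 (gaussKernel_pos z one_pos).le
    _ = (4 * Real.pi * 1) ^ (-(n : ℝ) / 2) * C *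
        (Real.exp (-‖z‖ ^ 2 / (4 * 1)) * Real.exp (β * (R + √T * ‖z‖) ^ 2)) := by
        unfold gaussKernel; ring
    _ = (4 * Real.pi * 1) ^ (-(n : ℝ) / 2) * C * (Real.exp (β * R ^ 2) *
          Real.exp (-(1 / 4 - β * T) * ‖z‖ ^ 2 + 2 * β * R * √T * ‖z‖)) := by
        rw [← Real.exp_add, ← Real.exp_add]
        congr 2
        have := Real.sq_sqrt hT
        linear_combination β * ‖z‖ ^ 2 * this
    _ = _ := by ring

lemma integrable_scaled (hφc : Continuous φ) (hφ : ∀ y, |φ y| ≤ C * Real.exp (β * ‖y‖ ^ 2))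
    (hβ : 0 ≤ β) {t : ℝ} (ht : 0 ≤ t) (htβ : β * t < 1 / 4) (x : EuclideanSpace ℝ (Fin n)) :
    Integrable fun z => gaussKernel z 1 * φ (x - √t • z) := by
  have hk := continuous_gaussKernel (n := n) 1
  exact integrable_of_gauss_bound (Continuous.aestronglyMeasurable (by fun_prop))
    (sub_pos.2 htβ) (fun z => scaled_bound hφ hβ ht le_rfl le_rfl z)

/-- Dominated convergence in the scaled representation, which gives continuity down to the initial
time. -/
lemma continuousOn_heatFlow (hφc : Continuous φ) (hφ : ∀ y, |φ y| ≤ C * Real.exp (β * ‖y‖ ^ 2))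
    (hβ : 0 ≤ β) {T : ℝ} (hTβ : β * T < 1 / 4) :
    ContinuousOn (fun p : ℝ × EuclideanSpace ℝ (Fin n) => heatFlow φ p.1 p.2)
      (Icc 0 T ×ˢ univ) := by
  have hk := continuous_gaussKernel (n := n) 1
  have h1 : ContinuousOn (fun p : ℝ × EuclideanSpace ℝ (Fin n) =>
      ∫ z, gaussKernel z 1 * φ (p.2 - √p.1 • z)) (Icc 0 T ×ˢ univ) := by
    rintro ⟨t, x⟩ ⟨ht, -⟩
    refine continuousWithinAt_of_dominated (bound := fun z => (4 * Real.pi * 1) ^ (-(n : ℝ) / 2) * C *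
      Real.exp (β * (‖x‖ + 1) ^ 2) *
      Real.exp (-(1 / 4 - β * T) * ‖z‖ ^ 2 + 2 * β * (‖x‖ + 1) * √T * ‖z‖))
      (Eventually.of_forall fun p => Continuous.aestronglyMeasurable (by fun_prop)) ?_
      (integrable_exp_quadratic (sub_pos.2 hTβ) _ _)
      (Eventually.of_forall fun z => Continuous.continuousWithinAt (by fun_prop))
    have hx : ∀ᶠ p : ℝ × EuclideanSpace ℝ (Fin n) in 𝓝[Icc 0 T ×ˢ univ] (t, x),
        ‖p.2‖ < ‖x‖ + 1 := by
      refine Filter.Eventually.filter_mono nhdsWithin_le_nhds ?_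
      have hc : ContinuousAt (fun p : ℝ × EuclideanSpace ℝ (Fin n) => ‖p.2‖) (t, x) := by fun_prop
      exact hc.eventually_lt_const (by simp)
    filter_upwards [hx, self_mem_nhdsWithin] with p hp hpT
    exact Eventually.of_forall fun z => scaled_bound hφ hβ (ht.1.trans ht.2) hpT.1.2 hp.le z
  exact h1.congr fun p hp => heatFlow_eq_scaled φ hp.1.1 p.2

lemma heatFlow_mono {ψ : EuclideanSpace ℝ (Fin n) → ℝ} {t : ℝ} (ht : 0 < t)
    {x : EuclideanSpace ℝ (Fin n)} (h1 : Integrable fun y => gaussKernel (x - y) t * φ y)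
    (h2 : Integrable fun y => gaussKernel (x - y) t * ψ y) (h : ∀ y, φ y ≤ ψ y) :
    heatFlow φ t x ≤ heatFlow ψ t x := by
  simp only [heatFlow, if_pos ht]
  exact integral_mono h1 h2 fun y =>
    mul_le_mul_of_nonneg_left (h y) (gaussKernel_pos _ ht).le

lemma heatFlow_const (c : ℝ) {t : ℝ} (ht : 0 ≤ t) (x : EuclideanSpace ℝ (Fin n)) :
    heatFlow (fun _ => c) t x = c := by
  rw [heatFlow_eq_scaled _ ht, integral_mul_const, integral_gaussKernel_one, one_mul]

lemma integrable_kernel {t : ℝ} (ht : 0 < t) (x : EuclideanSpace ℝ (Fin n)) :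
    Integrable fun y => gaussKernel (x - y) t := by
  have := integrable_kernel_mul (φ := fun _ => (1 : ℝ)) (C := 1) (β := 0) continuous_const
    (fun y => by simp) ht (by positivity) x
  simpa using this

end HeatKernel

/-! ### The inverse function `f_F` and its derivatives -/

section Inverse

variable {F : ℝ → EReal}

lemma Admissible.coe_realOf (hF : Admissible F) {r : ℝ} (hr : 0 < r) :
    ((realOf F r : ℝ) : EReal) = F r := by
  refine EReal.coe_toReal (hF.ne_top r hr.le) ?_
  have := hF.strictMonoOn (mem_Ici.2 le_rfl) (mem_Ici.2 hr.le) hr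
  exact (bot_le.trans_lt this).ne'

lemma Admissible.realOf_strictMonoOn (hF : Admissible F) : StrictMonoOn (realOf F) (Ioi 0) := by
  intro r hr s hs hrs
  have h := hF.strictMonoOn (mem_Ici.2 (mem_Ioi.1 hr).le) (mem_Ici.2 (mem_Ioi.1 hs).le) hrs
  rwa [← hF.coe_realOf hr, ← hF.coe_realOf hs, EReal.coe_lt_coe_iff] at h

lemma Admissible.realOf_continuousOn (hF : Admissible F) : ContinuousOn (realOf F) (Ioi 0) := by
  intro r hr
  have hne : F r ≠ ⊤ ∧ F r ≠ ⊥ := by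
    rw [← hF.coe_realOf hr]
    exact ⟨EReal.coe_ne_top _, EReal.coe_ne_bot _⟩
  exact (EReal.tendsto_toReal hne.1 hne.2).comp (hF.continuousOn r hr)

lemma Admissible.realOf_mem_J (hF : Admissible F) {r : ℝ} (hr : 0 < r) : realOf F r ∈ J F :=
  ⟨r, hr, (hF.coe_realOf hr).symm⟩

lemma exists_of_mem_J {z : ℝ} (hz : z ∈ J F) : ∃ r ∈ Ioi (0 : ℝ), realOf F r = z := by
  obtain ⟨r, hr, h⟩ := hz
  exact ⟨r, hr, by rw [realOf, h, EReal.toReal_coe]⟩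

lemma inv_pos' {z : ℝ} (hz : z ∈ J F) : 0 < inv F z :=
  Function.invFunOn_mem (exists_of_mem_J hz)

lemma realOf_inv {z : ℝ} (hz : z ∈ J F) : realOf F (inv F z) = z :=
  Function.invFunOn_eq (exists_of_mem_J hz)

lemma Admissible.inv_realOf (hF : Admissible F) {r : ℝ} (hr : 0 < r) : inv F (realOf F r) = r :=
  hF.realOf_strictMonoOn.injOn (inv_pos' (hF.realOf_mem_J hr)) hr
    (realOf_inv (hF.realOf_mem_J hr))

lemma Admissible.inv_strictMonoOn (hF : Admissible F) : StrictMonoOn (inv F) (J F) := by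
  intro z hz z' hz' hlt
  rw [← hF.realOf_strictMonoOn.lt_iff_lt (inv_pos' hz) (inv_pos' hz'), realOf_inv hz,
    realOf_inv hz']
  exact hlt

lemma Admissible.J_ordConnected (hF : Admissible F) : (J F).OrdConnected := by
  have h : J F = realOf F '' Ioi 0 := by
    ext z
    constructor
    · intro hz
      exact exists_of_mem_J hz
    · rintro ⟨r, hr, rfl⟩
      exact hF.realOf_mem_J hr
  rw [h]
  exact (isPreconnected_Ioi.image _ hF.realOf_continuousOn).ordConnected

lemma Admissible.J_isOpen (hF : Admissible F) : IsOpen (J F) := by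
  rw [isOpen_iff_mem_nhds]
  intro z hz
  have hr := inv_pos' hz
  have h1 : realOf F (inv F z / 2) < z := by
    conv_rhs => rw [← realOf_inv hz]
    exact hF.realOf_strictMonoOn (half_pos hr) hr (half_lt_self hr)
  have h2 : z < realOf F (inv F z * 2) := by
    conv_lhs => rw [← realOf_inv hz]
    exact hF.realOf_strictMonoOn hr (mem_Ioi.2 (by positivity)) (by linarith)
  refine mem_of_superset (Icc_mem_nhds h1 h2) ?_
  exact hF.J_ordConnected.out (hF.realOf_mem_J (half_pos hr)) (hF.realOf_mem_J (by positivity))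

lemma Admissible.mem_J_of_le (hF : Admissible F) (hT : Tendsto F atTop (𝓝 ⊤)) {z z' : ℝ}
    (hz : z ∈ J F) (h : z ≤ z') : z' ∈ J F := by
  have h1 : ∀ᶠ r in atTop, (z' : EReal) < F r :=
    hT.eventually_const_lt (EReal.coe_lt_top z')
  obtain ⟨r, hr, hr0⟩ := (h1.and (eventually_gt_atTop 0)).exists
  rw [← hF.coe_realOf hr0, EReal.coe_lt_coe_iff] at hr
  exact hF.J_ordConnected.out hz (hF.realOf_mem_J hr0) ⟨h, hr.le⟩

/-- `f_F` is strictly monotone and maps `J_F` onto `(0,∞)`, so it cannot jump. -/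
lemma Admissible.inv_continuousAt (hF : Admissible F) {z : ℝ} (hz : z ∈ J F) :
    ContinuousAt (inv F) z := by
  refine hF.inv_strictMonoOn.continuousAt_of_image_mem_nhds (hF.J_isOpen.mem_nhds hz) ?_
  refine mem_of_superset (Ioi_mem_nhds (inv_pos' hz)) ?_
  intro r hr
  exact ⟨realOf F r, hF.realOf_mem_J hr, hF.inv_realOf hr⟩

lemma hasDerivAt_realOf (hC : ContDiffOn ℝ 2 (realOf F) (Ioi 0)) {r : ℝ} (hr : 0 < r) :
    HasDerivAt (realOf F) (deriv (realOf F) r) r :=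
  ((hC.contDiffAt (Ioi_mem_nhds hr)).differentiableAt (by norm_num)).hasDerivAt

lemma hasDerivAt_deriv_realOf (hC : ContDiffOn ℝ 2 (realOf F) (Ioi 0)) {r : ℝ} (hr : 0 < r) :
    HasDerivAt (deriv (realOf F)) (deriv (deriv (realOf F)) r) r := by
  have h : ContDiffOn ℝ 1 (deriv (realOf F)) (Ioi 0) :=
    ((contDiffOn_succ_iff_deriv_of_isOpen (n := 1) isOpen_Ioi).1 hC).2.2
  exact ((h.contDiffAt (Ioi_mem_nhds hr)).differentiableAt (by norm_num)).hasDerivAt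

lemma Admissible.hasDerivAt_inv (hF : Admissible F) (hC : ContDiffOn ℝ 2 (realOf F) (Ioi 0))
    {z : ℝ} (hz : z ∈ J F) (hpos : 0 < deriv (realOf F) (inv F z)) :
    HasDerivAt (inv F) (deriv (realOf F) (inv F z))⁻¹ z := by
  refine HasDerivAt.of_local_left_inverse (hF.inv_continuousAt hz)
    (hasDerivAt_realOf hC (inv_pos' hz)) hpos.ne' ?_
  filter_upwards [hF.J_isOpen.mem_nhds hz] with y hy using realOf_inv hy

/-- `F' > 0` is assumed at one point only and spreads to a neighbourhood by continuity. This makes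
`g_F` computable there before positivity of `F'` is known elsewhere. -/
lemma Admissible.deriv_inv_eventuallyEq (hF : Admissible F)
    (hC : ContDiffOn ℝ 2 (realOf F) (Ioi 0))
    {z : ℝ} (hz : z ∈ J F) (hpos : 0 < deriv (realOf F) (inv F z)) :
    deriv (inv F) =ᶠ[𝓝 z] fun y => (deriv (realOf F) (inv F y))⁻¹ := by
  have hc : ContinuousAt (fun y => deriv (realOf F) (inv F y)) z :=
    ContinuousAt.comp (hasDerivAt_deriv_realOf hC (inv_pos' hz)).continuousAt
      (hF.inv_continuousAt hz)
  filter_upwards [hF.J_isOpen.mem_nhds hz, hc.eventually_const_lt hpos] with y hy hy'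
  exact (hF.hasDerivAt_inv hC hy hy').deriv

/-- Where `F' > 0`, the function `g_F` is the derivative of `log f_F'`, and equals
`-F'' / F'^2` at the corresponding point. -/
lemma Admissible.g_spec (hF : Admissible F) (hC : ContDiffOn ℝ 2 (realOf F) (Ioi 0))
    {z : ℝ} (hz : z ∈ J F) (hpos : 0 < deriv (realOf F) (inv F z)) :
    g F z = -deriv (deriv (realOf F)) (inv F z) / deriv (realOf F) (inv F z) ^ 2 ∧
    HasDerivAt (fun y => -Real.log (deriv (realOf F) (inv F y))) (g F z) z ∧
    HasDerivAt (fun y => (deriv (realOf F) (inv F y))⁻¹)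
      ((deriv (realOf F) (inv F z))⁻¹ * g F z) z := by
  have h1 := HasDerivAt.comp z (hasDerivAt_deriv_realOf hC (inv_pos' hz)) (hF.hasDerivAt_inv hC hz hpos)
  have h2 := (h1.log hpos.ne').neg
  have h3 := h1.inv hpos.ne'
  simp only [Function.comp_apply] at h2 h3
  have hEq : (fun y => Real.log (deriv (inv F) y)) =ᶠ[𝓝 z]
      fun y => -Real.log (deriv (realOf F) (inv F y)) := by
    filter_upwards [hF.deriv_inv_eventuallyEq hC hz hpos] with y hy
    rw [hy, Real.log_inv]
  have hg : g F z = -(deriv (deriv (realOf F)) (inv F z) * (deriv (realOf F) (inv F z))⁻¹ /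
      deriv (realOf F) (inv F z)) := by
    unfold g
    rw [hEq.deriv_eq]
    exact h2.deriv
  refine ⟨?_, ?_, ?_⟩
  · rw [hg]; field_simp
  · rw [hg]; exact h2
  · refine h3.congr_deriv ?_
    rw [hg]; field_simp

end Inverse

/-! ### Growth of `F`-convex functions and the trivial cases -/

section FConvexity

variable {n : ℕ} {F : ℝ → EReal} {φ : EuclideanSpace ℝ (Fin n) → ℝ}

/-- The cut-off removes the possible value `-∞` of `F` at `0`, and a maximum with a constant
preserves `F`-convexity. What remains is ordinary real convexity. -/
lemma FConvex.convexOn_max (hF : Admissible F) (hφ : FConvex F φ) {r : ℝ} (hr : 0 < r) :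
    ConvexOn ℝ univ fun x => realOf F (max (φ x) r) := by
  have hpos : ∀ x, 0 < max (φ x) r := fun x => lt_max_of_lt_right hr
  refine convexOn_iff_forall_pos.2 ⟨convex_univ, fun x _ y _ a b ha hb hab => ?_⟩
  have ha' : a = 1 - b := by linarith
  have hmono := hF.strictMonoOn.monotoneOn
  have hle : ∀ x, F (φ x) ≤ F (max (φ x) r) := fun x =>
    hmono (mem_Ici.2 (hφ.1 x)) (mem_Ici.2 (hpos x).le) (le_max_left _ _)
  have hlr : ∀ x, F r ≤ F (max (φ x) r) := fun x =>
    hmono (mem_Ici.2 hr.le) (mem_Ici.2 (hpos x).le) (le_max_right _ _)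
  have key : F (max (φ (a • x + b • y)) r) ≤
      (a : EReal) * F (max (φ x) r) + (b : EReal) * F (max (φ y) r) := by
    rcases le_total (φ (a • x + b • y)) r with h | h
    · rw [max_eq_right h, ← hF.coe_realOf hr, ← hF.coe_realOf (hpos x), ← hF.coe_realOf (hpos y)]
      have h1 := hlr x
      have h2 := hlr y
      rw [← hF.coe_realOf hr, ← hF.coe_realOf (hpos x), EReal.coe_le_coe_iff] at h1
      rw [← hF.coe_realOf hr, ← hF.coe_realOf (hpos y), EReal.coe_le_coe_iff] at h2
      norm_cast
      have e1 := mul_le_mul_of_nonneg_left h1 ha.le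
      have e2 := mul_le_mul_of_nonneg_left h2 hb.le
      have e3 : a * realOf F r + b * realOf F r = realOf F r := by rw [← add_mul, hab, one_mul]
      linarith
    · rw [max_eq_left h]
      have h1 := hφ.2 x y b hb (by linarith)
      rw [← ha'] at h1
      refine h1.trans (add_le_add ?_ ?_)
      · exact mul_le_mul_of_nonneg_left (hle x) (EReal.coe_nonneg.2 ha.le)
      · exact mul_le_mul_of_nonneg_left (hle y) (EReal.coe_nonneg.2 hb.le)
  rw [← hF.coe_realOf (hpos _), ← hF.coe_realOf (hpos x), ← hF.coe_realOf (hpos y)] at key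
  simp only [smul_eq_mul]
  exact_mod_cast key

lemma fconvex_of_convexOn (hF : Admissible F) (hpos : ∀ x, 0 < φ x)
    (h : ConvexOn ℝ univ fun x => realOf F (φ x)) : FConvex F φ := by
  refine ⟨fun x => (hpos x).le, fun x y l hl hl1 => ?_⟩
  have := h.2 (mem_univ x) (mem_univ y) (by linarith : 0 ≤ 1 - l) hl.le (by ring)
  rw [← hF.coe_realOf (hpos _), ← hF.coe_realOf (hpos x), ← hF.coe_realOf (hpos y)]
  simp only [smul_eq_mul] at this
  exact_mod_cast this

/-- Quasiconvexity at a midpoint: otherwise a cut-off strictly between the two sides would violate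
convexity. -/
lemma FConvex.le_max (hF : Admissible F) (hφ : FConvex F φ) (y h : EuclideanSpace ℝ (Fin n)) :
    φ y ≤ max (φ (y + h)) (φ (y - h)) := by
  by_contra! hcon
  set r := max (φ (y + h)) (φ (y - h)) with hr
  have hr0 : 0 ≤ r := (hφ.1 (y + h)).trans (le_max_left _ _)
  obtain ⟨ρ, h1, h2⟩ := exists_between hcon
  have hρ : 0 < ρ := hr0.trans_lt h1
  have hconv := (hφ.convexOn_max hF hρ).2 (mem_univ (y + h)) (mem_univ (y - h))
    (by norm_num : (0 : ℝ) ≤ 1 / 2) (by norm_num : (0 : ℝ) ≤ 1 / 2) (by norm_num)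
  have hmid : (1 / 2 : ℝ) • (y + h) + (1 / 2 : ℝ) • (y - h) = y := by
    rw [← smul_add, add_add_sub_cancel, ← two_smul ℝ y, smul_smul]; norm_num
  rw [hmid] at hconv
  simp only [max_eq_left h2.le, max_eq_right (((le_max_left _ _).trans hr.ge).trans h1.le),
    max_eq_right (((le_max_right _ _).trans hr.ge).trans h1.le), smul_eq_mul] at hconv
  have := hF.realOf_strictMonoOn hρ (hρ.trans h2) h2
  linarith

/-- Finite convex functions on `ℝⁿ` are continuous; applying `f_F` makes each cut-off continuous,
and the cut-offs converge uniformly to `φ` as `r → 0`. -/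
lemma FConvex.continuous (hF : Admissible F) (hφ : FConvex F φ) : Continuous φ := by
  have h1 : ∀ r : ℝ, 0 < r → Continuous fun x => max (φ x) r := by
    intro r hr
    have hc : Continuous fun x => realOf F (max (φ x) r) := continuousOn_univ.1 ((hφ.convexOn_max hF hr).continuousOn isOpen_univ)
    have h2 : (fun x => max (φ x) r) = fun x => inv F (realOf F (max (φ x) r)) := by
      ext x
      rw [hF.inv_realOf (lt_max_of_lt_right hr)]
    rw [h2]
    refine continuous_iff_continuousAt.2 fun x => ?_
    exact ContinuousAt.comp (f := fun x => realOf F (max (φ x) r))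
      (hF.inv_continuousAt (hF.realOf_mem_J (lt_max_of_lt_right hr))) hc.continuousAt
  have h2 : TendstoUniformly (fun (r : ℝ) x => max (φ x) r) φ (𝓝[>] 0) := by
    rw [Metric.tendstoUniformly_iff]
    intro ε hε
    filter_upwards [Ioo_mem_nhdsGT hε] with r hr x
    have h0 := hφ.1 x
    rw [Real.dist_eq, abs_sub_comm, abs_of_nonneg (by linarith [le_max_left (φ x) r])]
    rcases max_cases (φ x) r with h | h
    · rw [h.1]; linarith [hr.1]
    · rw [h.1]; linarith [hr.2]
  refine h2.continuous (Eventually.frequently ?_)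
  filter_upwards [self_mem_nhdsWithin] with r hr using h1 r hr

lemma integrable_of_lt_maxTime {t : ℝ} (ht : 0 < t) (h : ENNReal.ofReal t < maxTime φ)
    (x : EuclideanSpace ℝ (Fin n)) : Integrable fun y => gaussKernel (x - y) t * φ y := by
  obtain ⟨T, hT, hlt⟩ := lt_sSup_iff.1 h
  exact hT t ht hlt x

lemma exists_gt_of_lt_maxTime {t : ℝ} (h : ENNReal.ofReal t < maxTime φ) :
    ∃ T, t < T ∧ ENNReal.ofReal T < maxTime φ := by
  obtain ⟨T, -, h1, h2⟩ := ENNReal.lt_iff_exists_real_btwn.1 h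
  refine ⟨T, ?_, h2⟩
  by_contra! hcon
  exact absurd (ENNReal.ofReal_le_ofReal hcon) (not_le.2 h1)

/-- An `F`-convex function with finite heat flow at time `T` has Gaussian growth. -/
lemma FConvex.growth (hF : Admissible F) (hφ : FConvex F φ) {T : ℝ} (hT : 0 < T)
    (hint : Integrable fun y => gaussKernel (0 - y) T * φ y) :
    ∃ C, 0 < C ∧ ∀ y, φ y ≤ C * Real.exp ((‖y‖ + 1) ^ 2 / (4 * T)) := by
  set ψ : EuclideanSpace ℝ (Fin n) → ℝ := fun y => gaussKernel (0 - y) T * φ y with hψ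
  have hψ0 : ∀ y, 0 ≤ ψ y := fun y => mul_nonneg (gaussKernel_pos _ hT).le (hφ.1 y)
  set V := volume.real (Metric.ball (0 : EuclideanSpace ℝ (Fin n)) 1) with hV
  have hVpos : 0 < V := ENNReal.toReal_pos (Metric.measure_ball_pos _ _ one_pos).ne'
    measure_ball_lt_top.ne
  set A : ℝ := (4 * Real.pi * T) ^ (-(n : ℝ) / 2) with hA
  have hApos : 0 < A := by positivity
  set I := ∫ y, ψ y with hI
  have hI0 : 0 ≤ I := integral_nonneg hψ0
  have hlow : ∀ y h : EuclideanSpace ℝ (Fin n), ‖h‖ ≤ 1 →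
      A * Real.exp (-((‖y‖ + 1) ^ 2 / (4 * T))) * φ (y + h) ≤ ψ (y + h) := by
    intro y h hh
    refine mul_le_mul_of_nonneg_right ?_ (hφ.1 _)
    unfold gaussKernel
    rw [zero_sub, norm_neg, neg_div (4 * T)]
    have : ‖y + h‖ ≤ ‖y‖ + 1 := (norm_add_le _ _).trans (by linarith)
    gcongr
  refine ⟨(2 * I + 1) / (V * A), by positivity, fun y => ?_⟩
  set c := A * Real.exp (-((‖y‖ + 1) ^ 2 / (4 * T))) with hc
  have hcpos : 0 < c := by positivity
  have hp : Integrable fun h => ψ (y + h) := hint.comp_add_left y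
  have hm : Integrable fun h => ψ (y - h) := hint.comp_sub_left y
  -- Integrate `φ(y) ≤ φ(y+h) + φ(y-h)` over the unit ball; at the points `y ± h` the kernel is at
  -- least `c`.
  have h1 : V * (c * φ y) ≤ 2 * I := by
    calc V * (c * φ y) = ∫ _h in Metric.ball (0 : EuclideanSpace ℝ (Fin n)) 1, c * φ y := by
          rw [setIntegral_const, smul_eq_mul]
      _ ≤ ∫ h in Metric.ball (0 : EuclideanSpace ℝ (Fin n)) 1, (ψ (y + h) + ψ (y - h)) := by
          refine setIntegral_mono_on ?_ (hp.add hm).integrableOn measurableSet_ball ?_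
          · exact integrableOn_const measure_ball_lt_top.ne
          · intro h hh
            have hh1 : ‖h‖ ≤ 1 := (mem_ball_zero_iff.1 hh).le
            have e1 := hlow y h hh1
            have e2 := hlow y (-h) (by rwa [norm_neg])
            rw [← sub_eq_add_neg] at e2
            have e3 : φ y ≤ φ (y + h) + φ (y - h) := by
              refine (hφ.le_max hF y h).trans (max_le ?_ ?_)
              · linarith [hφ.1 (y - h)]
              · linarith [hφ.1 (y + h)]
            have e4 := mul_le_mul_of_nonneg_left e3 hcpos.le
            linarith
      _ ≤ ∫ h, (ψ (y + h) + ψ (y - h)) :=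
          setIntegral_le_integral (hp.add hm)
            (Eventually.of_forall fun h => add_nonneg (hψ0 _) (hψ0 _))
      _ = 2 * I := by
          rw [integral_add hp hm, integral_add_left_eq_self (fun h => ψ h),
            integral_sub_left_eq_self (fun h => ψ h)]
          ring
  have h2 : φ y * (V * c) ≤ 2 * I + 1 := by linarith
  have h3 : φ y ≤ (2 * I + 1) / (V * c) := by rwa [le_div_iff₀ (by positivity)]
  refine h3.trans (le_of_eq ?_)
  rw [hc, Real.exp_neg]
  field_simp

/-- The linear part of `(‖y‖ + 1)²` is paid for by any rate larger than `1/(4T)`. -/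
lemma FConvex.gauss_bound (hF : Admissible F) (hφ : FConvex F φ) {T : ℝ} (hT : 0 < T)
    (hint : Integrable fun y => gaussKernel (0 - y) T * φ y) {β : ℝ} (hβ : 1 / (4 * T) < β) :
    ∃ C, 0 < C ∧ ∀ y, φ y ≤ C * Real.exp (β * ‖y‖ ^ 2) := by
  obtain ⟨C, hC, h⟩ := hφ.growth hF hT hint
  have hd : 0 < β - 1 / (4 * T) := sub_pos.2 hβ
  refine ⟨C * Real.exp ((2 / (4 * T)) ^ 2 / (4 * (β - 1 / (4 * T))) + 1 / (4 * T)), by positivity,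
    fun y => (h y).trans ?_⟩
  rw [mul_assoc, ← Real.exp_add]
  have h1 := linear_le_quadratic hd (2 / (4 * T)) ‖y‖
  gcongr
  have h2 : (‖y‖ + 1) ^ 2 / (4 * T) = 1 / (4 * T) * ‖y‖ ^ 2 + 2 / (4 * T) * ‖y‖ + 1 / (4 * T) := by
    field_simp; ring
  rw [h2]
  linarith

/-- A nonconstant `F`-convex function with finite heat flow at time `T` forces Gaussian growth
of `f_F`, with a rate given by a slope of the function. -/
lemma FConvex.inv_growth (hF : Admissible F) (hφ : FConvex F φ) {T : ℝ} (hT : 0 < T)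
    (hint : Integrable fun y => gaussKernel (0 - y) T * φ y) {r : ℝ} (hr : 0 < r)
    {x y : EuclideanSpace ℝ (Fin n)} {k : ℝ} (hk : 0 < k) (hxy : x ≠ y)
    (hslope : realOf F (max (φ x) r) + k * ‖y - x‖ ≤ realOf F (max (φ y) r)) :
    ∃ C c : ℝ, 0 < C ∧ ∀ z ∈ J F, realOf F (max (φ y) r) ≤ z →
      inv F z ≤ C * Real.exp ((z / k + c) ^ 2 / (4 * T)) := by
  obtain ⟨C, hC, h⟩ := hφ.growth hF hT hint
  set u := fun x => realOf F (max (φ x) r) with hu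
  have hconv : ConvexOn ℝ univ u := hφ.convexOn_max hF hr
  have hd : 0 < ‖y - x‖ := norm_pos_iff.2 (sub_ne_zero.2 hxy.symm)
  set e := (‖y - x‖)⁻¹ • (y - x) with he
  have hen : ‖e‖ = 1 := by rw [he, norm_smul, norm_inv, norm_norm, inv_mul_cancel₀ hd.ne']
  refine ⟨C + r, ‖x‖ + 1 - u x / k, by positivity, fun z hz hzy => ?_⟩
  -- The distance from `x`, in the direction of `y`, at which the line of slope `k` reaches height
  -- `z`. Beyond `y` the convex function lies above this line.
  set s := (z - u x) / k with hs
  have hks : k * s = z - u x := by rw [hs]; field_simp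
  have hsd : ‖y - x‖ ≤ s := by
    rw [hs, le_div_iff₀ hk]
    change u x + k * ‖y - x‖ ≤ u y at hslope
    change u y ≤ z at hzy
    linarith
  have hs0 : 0 < s := hd.trans_le hsd
  have hz' : z ≤ u (x + s • e) := by
    have hyc : (1 - ‖y - x‖ / s) • x + (‖y - x‖ / s) • (x + s • e) = y := by
      rw [smul_add, ← add_assoc, ← add_smul, sub_add_cancel, one_smul, he, smul_smul, smul_smul]
      have : ‖y - x‖ / s * s * ‖y - x‖⁻¹ = 1 := by field_simp
      rw [this, one_smul, add_sub_cancel]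
    have h1 := hconv.2 (mem_univ x) (mem_univ (x + s • e))
      (sub_nonneg.2 ((div_le_one hs0).2 hsd)) (by positivity : 0 ≤ ‖y - x‖ / s) (by ring)
    rw [hyc] at h1
    simp only [smul_eq_mul] at h1
    have h2 : u x + k * ‖y - x‖ ≤ (1 - ‖y - x‖ / s) * u x + ‖y - x‖ / s * u (x + s • e) :=
      hslope.trans h1
    have h3 : k * ‖y - x‖ ≤ ‖y - x‖ / s * (u (x + s • e) - u x) := by linarith
    have h4 : ‖y - x‖ * (k * s) ≤ ‖y - x‖ * (u (x + s • e) - u x) := by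
      have := mul_le_mul_of_nonneg_right h3 hs0.le
      have e1 : ‖y - x‖ / s * (u (x + s • e) - u x) * s = ‖y - x‖ * (u (x + s • e) - u x) := by
        field_simp
      rw [e1] at this
      linarith
    have h5 := le_of_mul_le_mul_left h4 hd
    linarith
  have hpos : 0 < max (φ (x + s • e)) r := lt_max_of_lt_right hr
  have h1 : inv F z ≤ max (φ (x + s • e)) r := by
    have := hF.inv_strictMonoOn.monotoneOn hz (hF.realOf_mem_J hpos) hz'
    rwa [hF.inv_realOf hpos] at this
  have h2 : φ (x + s • e) ≤ C * Real.exp ((z / k + (‖x‖ + 1 - u x / k)) ^ 2 / (4 * T)) := by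
    refine (h _).trans ?_
    have e1 : ‖x + s • e‖ + 1 ≤ z / k + (‖x‖ + 1 - u x / k) := by
      have : ‖x + s • e‖ ≤ ‖x‖ + s := by
        refine (norm_add_le _ _).trans ?_
        rw [norm_smul, hen, Real.norm_of_nonneg hs0.le, mul_one]
      have e2 : s = z / k - u x / k := by rw [hs]; ring
      linarith
    gcongr
  refine h1.trans (max_le ?_ ?_)
  · refine h2.trans ?_
    gcongr
    linarith
  · have : 1 ≤ Real.exp ((z / k + (‖x‖ + 1 - u x / k)) ^ 2 / (4 * T)) :=
      Real.one_le_exp (by positivity)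
    nlinarith

lemma convexOn_const_of_bddAbove {E : Type*} [NormedAddCommGroup E] [NormedSpace ℝ E] {u : E → ℝ}
    (hu : ConvexOn ℝ univ u) {M : ℝ} (hM : ∀ x, u x ≤ M) (x y : E) : u x ≤ u y := by
  by_contra! hcon
  -- extrapolate from `y` through `x`
  set s := (M - u y) / (u x - u y) + 1 with hs
  have hd : 0 < u x - u y := sub_pos.2 hcon
  have h0 : 0 ≤ (M - u y) / (u x - u y) := div_nonneg (by linarith [hM y]) hd.le
  have hs1 : 1 ≤ s := by linarith
  have hs0 : 0 < s := by linarith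
  have hxc : (1 - 1 / s) • y + (1 / s) • (y + s • (x - y)) = x := by
    rw [smul_add, ← add_assoc, ← add_smul, sub_add_cancel, one_smul, smul_smul,
      one_div_mul_cancel hs0.ne', one_smul, add_sub_cancel]
  have h1 := hu.2 (mem_univ y) (mem_univ (y + s • (x - y)))
    (sub_nonneg.2 ((div_le_one hs0).2 hs1)) (by positivity : 0 ≤ 1 / s) (by ring)
  rw [hxc] at h1
  simp only [smul_eq_mul] at h1
  have h2 := hM (y + s • (x - y))
  have h3 : s * (u x - u y) ≤ M - u y := by
    have := mul_le_mul_of_nonneg_left h1 hs0.le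
    have e1 : s * ((1 - 1 / s) * u y + 1 / s * u (y + s • (x - y))) =
      s * u y - u y + u (y + s • (x - y)) := by field_simp
    rw [e1] at this
    linarith
  have h4 : s * (u x - u y) = (M - u y) + (u x - u y) := by
    rw [hs]; field_simp
  linarith

/-- Here every `F`-convex function is constant; the flow plays no role. -/
theorem onlyTriviallyPreserved_of_bounded (hF : Admissible F)
    (hL : ∃ L : EReal, L < ⊤ ∧ Tendsto F atTop (𝓝 L)) : OnlyTriviallyPreserved n F := by
  intro φ hφ _ _
  obtain ⟨L, hL, hlim⟩ := hL
  have hle : ∀ r : ℝ, 0 < r → F r ≤ L := by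
    intro r hr
    refine ge_of_tendsto hlim ?_
    filter_upwards [eventually_ge_atTop r] with s hs
    exact hF.strictMonoOn.monotoneOn (mem_Ici.2 hr.le) (mem_Ici.2 (hr.le.trans hs)) hs
  have hbd : ∀ r : ℝ, 0 < r → realOf F r ≤ L.toReal := by
    intro r hr
    refine EReal.toReal_le_toReal (hle r hr) ?_ hL.ne
    rw [← hF.coe_realOf hr]
    exact EReal.coe_ne_bot _
  have hmono : ∀ x y, φ x ≤ φ y := by
    intro x y
    by_contra! hcon
    obtain ⟨r, h1, h2⟩ := exists_between hcon
    have hr : 0 < r := (hφ.1 y).trans_lt h1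
    have := convexOn_const_of_bddAbove (hφ.convexOn_max hF hr)
      (fun x => hbd _ (lt_max_of_lt_right hr)) x y
    rw [max_eq_left h2.le, max_eq_right h1.le] at this
    exact absurd this (not_le.2 (hF.realOf_strictMonoOn hr (hr.trans h2) h2))
  exact ⟨φ 0, fun x => le_antisymm (hmono _ _) (hmono _ _)⟩

theorem onlyTriviallyPreserved_of_weightIntegral_eq_top (hF : Admissible F)
    (hT : Tendsto F atTop (𝓝 ⊤)) (hW : ∀ A : ℝ, 0 < A → weightIntegral F A = ⊤) :
    OnlyTriviallyPreserved n F := by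
  intro φ hφ hmax _
  have hmono : ∀ x y, φ x ≤ φ y := by
    intro y x
    by_contra! hcon
    obtain ⟨r, h1, h2⟩ := exists_between hcon
    have hr : 0 < r := (hφ.1 x).trans_lt h1
    obtain ⟨T, hT0, hTm⟩ := exists_gt_of_lt_maxTime (t := 0) (φ := φ) (by simpa using hmax)
    have hxy : x ≠ y := by rintro rfl; exact lt_irrefl _ hcon
    have hd : 0 < ‖y - x‖ := norm_pos_iff.2 (sub_ne_zero.2 hxy.symm)
    have hlt : realOf F (max (φ x) r) < realOf F (max (φ y) r) := by
      rw [max_eq_left h2.le, max_eq_right h1.le]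
      exact hF.realOf_strictMonoOn hr (hr.trans h2) h2
    set k := (realOf F (max (φ y) r) - realOf F (max (φ x) r)) / ‖y - x‖ with hk
    have hkpos : 0 < k := div_pos (sub_pos.2 hlt) hd
    obtain ⟨C, c, hC, hg⟩ := hφ.inv_growth hF hT0 (integrable_of_lt_maxTime hT0 hTm 0) hr hkpos hxy
      (by rw [hk, div_mul_cancel₀ _ hd.ne']; linarith)
    set U := realOf F (max (φ y) r) with hU
    have hUJ : U ∈ J F := hF.realOf_mem_J (lt_max_of_lt_right hr)
    -- From `(z/k + c)² ≤ 2(z/k)² + 2c²`; the constant `D` also covers the levels below `U`.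
    set B := 2 * (1 / k) ^ 2 / (4 * T) with hB
    set D := C * Real.exp (2 * c ^ 2 / (4 * T)) + inv F U with hD
    have hDpos : 0 < D := add_pos (by positivity) (inv_pos' hUJ)
    have hBpos : 0 < B := by positivity
    have hbound : ∀ z ∈ Ioi (realOf F 1), Real.exp (-(B + 1) * z ^ 2) * inv F z ≤
        D * Real.exp (-1 * z ^ 2) := by
      intro z hz
      have hzJ : z ∈ J F := hF.mem_J_of_le hT (hF.realOf_mem_J one_pos) (mem_Ioi.1 hz).le
      have h3 : inv F z ≤ D * Real.exp (B * z ^ 2) := by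
        rcases le_total U z with h | h
        · refine (hg z hzJ h).trans ?_
          have e1 : (z / k + c) ^ 2 / (4 * T) ≤ 2 * c ^ 2 / (4 * T) + B * z ^ 2 := by
            have e2 : 2 * c ^ 2 / (4 * T) + B * z ^ 2 = (2 * c ^ 2 + 2 * (z / k) ^ 2) / (4 * T) := by
              rw [hB]; ring
            rw [e2]
            gcongr
            nlinarith [sq_nonneg (z / k - c)]
          calc C * Real.exp ((z / k + c) ^ 2 / (4 * T))
              ≤ C * Real.exp (2 * c ^ 2 / (4 * T) + B * z ^ 2) := by gcongr
            _ = C * Real.exp (2 * c ^ 2 / (4 * T)) * Real.exp (B * z ^ 2) := by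
              rw [Real.exp_add]; ring
            _ ≤ _ := by
              gcongr
              rw [hD]
              linarith [inv_pos' hUJ]
        · have e1 := hF.inv_strictMonoOn.monotoneOn hzJ hUJ h
          have e2 : 1 ≤ Real.exp (B * z ^ 2) := Real.one_le_exp (by positivity)
          have e3 : inv F U ≤ D := by
            rw [hD]
            have : 0 < C * Real.exp (2 * c ^ 2 / (4 * T)) := by positivity
            linarith
          calc inv F z ≤ D * 1 := by linarith
            _ ≤ _ := by gcongr
      calc Real.exp (-(B + 1) * z ^ 2) * inv F z
          ≤ Real.exp (-(B + 1) * z ^ 2) * (D * Real.exp (B * z ^ 2)) := by gcongr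
        _ = D * (Real.exp (-(B + 1) * z ^ 2) * Real.exp (B * z ^ 2)) := by ring
        _ = _ := by rw [← Real.exp_add]; congr 2; ring
    -- The extra `1` in the weight leaves the integrable factor `exp(-z²)`.
    have hfin : weightIntegral F (B + 1) < ⊤ := by
      have hI : Integrable fun z : ℝ => D * Real.exp (-1 * z ^ 2) :=
        (integrable_exp_neg_mul_sq one_pos).const_mul D
      calc weightIntegral F (B + 1)
          ≤ ∫⁻ z in Ioi (realOf F 1), ENNReal.ofReal (D * Real.exp (-1 * z ^ 2)) :=
            setLIntegral_mono' measurableSet_Ioi fun z hz => ENNReal.ofReal_le_ofReal (hbound z hz)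
        _ ≤ ∫⁻ z, ENNReal.ofReal (D * Real.exp (-1 * z ^ 2)) := setLIntegral_le_lintegral _ _
        _ < ⊤ := hI.lintegral_lt_top
    rw [hW _ (by positivity)] at hfin
    exact lt_irrefl _ hfin
  exact ⟨φ 0, fun x => le_antisymm (hmono _ _) (hmono _ _)⟩

end FConvexity

/-! ### Lipschitz approximation of convex functions from below -/

section InfConvolution

variable {E : Type*} [NormedAddCommGroup E]

/-- The infimal convolution of `u` with `k ‖·‖`. -/
def infConv (u : E → ℝ) (k : ℝ) (x : E) : ℝ := ⨅ y, (u y + k * ‖x - y‖)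

variable {u : E → ℝ} {k m : ℝ}

lemma infConv_le (hm : ∀ x, m ≤ u x) (hk : 0 ≤ k) (x y : E) : infConv u k x ≤ u y + k * ‖x - y‖ :=
  ciInf_le ⟨m, by rintro _ ⟨y, rfl⟩; have := hm y; dsimp only; nlinarith [norm_nonneg (x - y)]⟩ y

lemma infConv_le_self (hm : ∀ x, m ≤ u x) (hk : 0 ≤ k) (x : E) : infConv u k x ≤ u x := by
  simpa using infConv_le hm hk x x

lemma le_infConv (hm : ∀ x, m ≤ u x) (hk : 0 ≤ k) (x : E) : m ≤ infConv u k x :=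
  le_ciInf fun y => by have := hm y; nlinarith [norm_nonneg (x - y)]

lemma infConv_lipschitz (hm : ∀ x, m ≤ u x) (hk : 0 ≤ k) (x y : E) :
    infConv u k x - infConv u k y ≤ k * ‖x - y‖ := by
  rw [sub_le_comm]
  refine le_ciInf fun z => ?_
  have h1 := infConv_le hm hk x z
  have h2 : ‖x - z‖ ≤ ‖x - y‖ + ‖y - z‖ := norm_sub_le_norm_sub_add_norm_sub x y z
  have h3 := mul_le_mul_of_nonneg_left h2 hk
  linarith

lemma infConv_convexOn [NormedSpace ℝ E] (hm : ∀ x, m ≤ u x) (hk : 0 ≤ k)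
    (hu : ConvexOn ℝ univ u) : ConvexOn ℝ univ (infConv u k) := by
  refine ⟨convex_univ, fun x _ y _ α β hα hβ hαβ => le_of_forall_pos_le_add fun ε hε => ?_⟩
  obtain ⟨p, hp⟩ := exists_lt_of_ciInf_lt (lt_add_of_pos_right (infConv u k x) hε)
  obtain ⟨q, hq⟩ := exists_lt_of_ciInf_lt (lt_add_of_pos_right (infConv u k y) hε)
  have h1 := infConv_le hm hk (α • x + β • y) (α • p + β • q)
  have h2 := hu.2 (mem_univ p) (mem_univ q) hα hβ hαβ
  have h3 : ‖α • x + β • y - (α • p + β • q)‖ ≤ α * ‖x - p‖ + β * ‖y - q‖ := by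
    have : α • x + β • y - (α • p + β • q) = α • (x - p) + β • (y - q) := by
      rw [smul_sub, smul_sub]; abel
    rw [this]
    refine (norm_add_le _ _).trans ?_
    rw [norm_smul, norm_smul, Real.norm_of_nonneg hα, Real.norm_of_nonneg hβ]
  have h4 := mul_le_mul_of_nonneg_left h3 hk
  have h5 := mul_le_mul_of_nonneg_left hp.le hα
  have h6 := mul_le_mul_of_nonneg_left hq.le hβ
  have h7 : α * ε + β * ε = ε := by rw [← add_mul, hαβ, one_mul]
  simp only [smul_eq_mul] at h2 ⊢
  linarith

/-- Competitors near `x` give almost `u x` by continuity; those at distance at least `δ` cost `k δ`,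
which makes up for the lower bound `m` when `k` is large. -/
lemma tendsto_infConv (hm : ∀ x, m ≤ u x) (hu : Continuous u) (x : E) :
    Tendsto (fun k : ℕ => infConv u k x) atTop (𝓝 (u x)) := by
  rw [tendsto_order]
  constructor
  · intro c hc
    obtain ⟨c', hcc', hc'⟩ := exists_between hc
    obtain ⟨δ, hδ, hball⟩ := Metric.eventually_nhds_iff.1 (hu.continuousAt.eventually_const_lt hc')
    obtain ⟨K, hK⟩ := exists_nat_ge ((c' - m) / δ)
    filter_upwards [eventually_ge_atTop K] with k hk
    refine lt_of_lt_of_le hcc' (le_ciInf fun y => ?_)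
    have hk0 : (0 : ℝ) ≤ k := Nat.cast_nonneg k
    rcases lt_or_ge (dist y x) δ with h | h
    · have := hball h
      nlinarith [norm_nonneg (x - y)]
    · rw [dist_eq_norm, norm_sub_rev] at h
      have h1 : (c' - m) / δ ≤ k := hK.trans (by exact_mod_cast hk)
      rw [div_le_iff₀ hδ] at h1
      have h2 := mul_le_mul_of_nonneg_left h hk0
      linarith [hm y]
  · intro c hc
    exact Eventually.of_forall fun k => (infConv_le_self hm (Nat.cast_nonneg k) x).trans_lt hc

end InfConvolution

/-! ### Two elementary facts on real functions -/

section RealLemmas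

lemma le_of_hasDerivAt_nonpos {q q' : ℝ → ℝ} {a b : ℝ} (hab : a ≤ b)
    (h : ∀ s ∈ Icc a b, HasDerivAt q (q' s) s) (hn : ∀ s ∈ Icc a b, q' s ≤ 0) : q b ≤ q a := by
  rcases hab.eq_or_lt with rfl | hlt
  · exact le_rfl
  obtain ⟨c, hc, hcs⟩ := exists_hasDerivAt_eq_slope q q' hlt
    (fun s hs => (h s hs).continuousAt.continuousWithinAt)
    (fun s hs => h s (Ioo_subset_Icc_self hs))
  have h1 := hn c (Ioo_subset_Icc_self hc)
  rw [hcs, div_nonpos_iff] at h1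
  rcases h1 with h1 | h1
  · linarith [h1.2]
  · linarith [h1.1]

/-- Serves to compare the leading coefficients of two Gaussian exponents. -/
lemma nonpos_of_quadratic_le {A B C z₀ : ℝ} (h : ∀ z, z₀ ≤ z → A * z ^ 2 + B * z + C ≤ 0) :
    A ≤ 0 := by
  by_contra! hA
  set z := max (max z₀ 1) ((|B| + |C| + 1) / A) with hz
  have h1 : 1 ≤ z := (le_max_right _ _).trans (le_max_left _ _)
  have h2 : (|B| + |C| + 1) / A ≤ z := le_max_right _ _
  have h3 := h z ((le_max_left _ _).trans (le_max_left _ _))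
  rw [div_le_iff₀ hA] at h2
  have h4 : -|B| * z ≤ B * z := mul_le_mul_of_nonneg_right (neg_abs_le B) (by linarith)
  have h5 : -|C| * z ≤ C := by nlinarith [neg_abs_le C, abs_nonneg C]
  have h6 : (|B| + |C| + 1) * z ≤ z * A * z := mul_le_mul_of_nonneg_right h2 (by linarith)
  nlinarith

end RealLemmas

/-! ### Growth of `f_F` when `g_F` is convex -/

section Profile

/-- The hypotheses on `F` under which `F`-convexity is preserved. -/
structure ConvexProfile (F : ℝ → EReal) : Prop where
  admissible : Admissible F
  contDiffOn : ContDiffOn ℝ 2 (realOf F) (Ioi 0)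
  tendsto_top : Tendsto F atTop (𝓝 ⊤)
  deriv_pos : ∀ r : ℝ, 0 < r → 0 < deriv (realOf F) r
  convexOn : ConvexOn ℝ (J F) (g F)

/-- The derivative of `f_F`, as the reciprocal of `F'`. -/
def invDeriv (F : ℝ → EReal) (z : ℝ) : ℝ := (deriv (realOf F) (inv F z))⁻¹

variable {F : ℝ → EReal}

lemma ConvexProfile.invDeriv_pos (h : ConvexProfile F) {z : ℝ} (hz : z ∈ J F) :
    0 < invDeriv F z :=
  inv_pos.2 (h.deriv_pos _ (inv_pos' hz))

lemma ConvexProfile.hasDerivAt_inv (h : ConvexProfile F) {z : ℝ} (hz : z ∈ J F) :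
    HasDerivAt (inv F) (invDeriv F z) z :=
  h.admissible.hasDerivAt_inv h.contDiffOn hz (h.deriv_pos _ (inv_pos' hz))

lemma ConvexProfile.hasDerivAt_log (h : ConvexProfile F) {z : ℝ} (hz : z ∈ J F) :
    HasDerivAt (fun y => Real.log (invDeriv F y)) (g F z) z := by
  have := (h.admissible.g_spec h.contDiffOn hz (h.deriv_pos _ (inv_pos' hz))).2.1
  simpa only [invDeriv, Real.log_inv] using this

lemma ConvexProfile.mem_J (h : ConvexProfile F) {z z' : ℝ} (hz : z ∈ J F) (hzz : z ≤ z') :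
    z' ∈ J F :=
  h.admissible.mem_J_of_le h.tendsto_top hz hzz

/-- `log f_F'` has derivative `g_F`, so a linear bound on `g_F` integrates to a quadratic exponent.
-/
lemma ConvexProfile.invDeriv_add_le (h : ConvexProfile F) {N s a : ℝ} (hN : N ∈ J F) (hs : 0 ≤ s)
    (hga : ∀ z, N ≤ z → g F z - g F N ≤ a * (z - N)) :
    invDeriv F (N + s) ≤ invDeriv F N * Real.exp (g F N * s + a * s ^ 2 / 2) := by
  have hmem : ∀ r ∈ Icc 0 s, N + r ∈ J F := fun r hr => h.mem_J hN (by linarith [hr.1])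
  have h1 := le_of_hasDerivAt_nonpos hs
    (q := fun r => Real.log (invDeriv F (N + r)) - (g F N * r + a * r ^ 2 / 2))
    (q' := fun r => g F (N + r) - (g F N + a * r)) (fun r hr => by
      have e1 := (h.hasDerivAt_log (hmem r hr)).comp_const_add N r
      have e2 : HasDerivAt (fun r : ℝ => g F N * r + a * r ^ 2 / 2) (g F N + a * r) r := by
        refine (((hasDerivAt_id r).const_mul (g F N)).add
          ((((hasDerivAt_id r).pow 2).const_mul a).div_const 2)).congr_deriv ?_
        simp only [id, mul_one]
        push_cast
        ring
      exact e1.sub e2) (fun r hr => by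
      have := hga (N + r) (by linarith [hr.1])
      linarith)
  simp only [add_zero, mul_zero] at h1
  have hp1 := h.invDeriv_pos (h.mem_J hN (by linarith : N ≤ N + s))
  have hp2 := h.invDeriv_pos hN
  rw [← Real.exp_log hp1, ← Real.exp_log hp2, ← Real.exp_add]
  refine Real.exp_le_exp.2 ?_
  norm_num at h1
  linarith

lemma ConvexProfile.le_invDeriv_add (h : ConvexProfile F) {N s a c : ℝ} (hN : N ∈ J F) (hs : 0 ≤ s)
    (hga : ∀ z, N ≤ z → z ≤ N + s → c + a * (z - N) ≤ g F z) :
    invDeriv F N * Real.exp (c * s + a * s ^ 2 / 2) ≤ invDeriv F (N + s) := by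
  have hmem : ∀ r ∈ Icc 0 s, N + r ∈ J F := fun r hr => h.mem_J hN (by linarith [hr.1])
  have h1 := le_of_hasDerivAt_nonpos hs
    (q := fun r => (c * r + a * r ^ 2 / 2) - Real.log (invDeriv F (N + r)))
    (q' := fun r => (c + a * r) - g F (N + r)) (fun r hr => by
      have e1 := (h.hasDerivAt_log (hmem r hr)).comp_const_add N r
      have e2 : HasDerivAt (fun r : ℝ => c * r + a * r ^ 2 / 2) (c + a * r) r := by
        refine (((hasDerivAt_id r).const_mul c).add
          ((((hasDerivAt_id r).pow 2).const_mul a).div_const 2)).congr_deriv ?_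
        simp only [id, mul_one]
        push_cast
        ring
      exact e2.sub e1) (fun r hr => by
      have := hga (N + r) (by linarith [hr.1]) (by linarith [hr.2])
      linarith)
  simp only [add_zero, mul_zero] at h1
  have hp1 := h.invDeriv_pos (h.mem_J hN (by linarith : N ≤ N + s))
  have hp2 := h.invDeriv_pos hN
  rw [← Real.exp_log hp1, ← Real.exp_log hp2, ← Real.exp_add]
  refine Real.exp_le_exp.2 ?_
  norm_num at h1
  linarith

lemma ConvexProfile.inv_add_le (h : ConvexProfile F) {N s M : ℝ} (hN : N ∈ J F) (hs : 0 ≤ s)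
    (hM : ∀ z ∈ Icc N (N + s), invDeriv F z ≤ M) : inv F (N + s) ≤ inv F N + M * s := by
  have h1 := le_of_hasDerivAt_nonpos (by linarith : N ≤ N + s)
    (q := fun z => inv F z - M * z) (q' := fun z => invDeriv F z - M * 1)
    (fun z hz => (h.hasDerivAt_inv (h.mem_J hN hz.1)).sub ((hasDerivAt_id z).const_mul M))
    (fun z hz => by linarith [hM z hz])
  linarith

lemma ConvexProfile.le_inv_add (h : ConvexProfile F) {N s M : ℝ} (hN : N ∈ J F) (hs : 0 ≤ s)
    (hM : ∀ z ∈ Icc N (N + s), M ≤ invDeriv F z) : inv F N + M * s ≤ inv F (N + s) := by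
  have h1 := le_of_hasDerivAt_nonpos (by linarith : N ≤ N + s)
    (q := fun z => M * z - inv F z) (q' := fun z => M * 1 - invDeriv F z)
    (fun z hz => ((hasDerivAt_id z).const_mul M).sub (h.hasDerivAt_inv (h.mem_J hN hz.1)))
    (fun z hz => by linarith [hM z hz])
  linarith

/-- The chord of a convex function, continued to the right, lies below the graph. -/
lemma ConvexProfile.g_lower (h : ConvexProfile F) {x y z : ℝ} (hx : x ∈ J F) (hxy : x < y)
    (hyz : y ≤ z) : g F y + (g F y - g F x) / (y - x) * (z - y) ≤ g F z := by
  rcases hyz.eq_or_lt with rfl | hlt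
  · simp
  have h1 := h.convexOn.slope_mono_adjacent hx (h.mem_J hx (hxy.le.trans hyz)) hxy hlt
  rw [le_div_iff₀ (by linarith)] at h1
  linarith

/-- The upper bound is the assumed slope bound. The lower one continues a chord starting at some `m'
< m`, which exists because `J_F` is open. -/
lemma ConvexProfile.g_linear_bound (h : ConvexProfile F) {m a : ℝ} (hm : m ∈ J F) (ha : 0 ≤ a)
    (hga : ∀ z, m ≤ z → g F z - g F m ≤ a * (z - m)) :
    ∃ C, 0 ≤ C ∧ ∀ z, m ≤ z → |g F z| ≤ C * (1 + |z|) := by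
  obtain ⟨m', hm'J, hm'⟩ : ∃ m' ∈ J F, m' < m := by
    have h0 : ∀ᶠ z in 𝓝 m, z ∈ J F := h.admissible.J_isOpen.mem_nhds hm
    have h1 : ∀ᶠ z in 𝓝[<] m, z ∈ J F := h0.filter_mono nhdsWithin_le_nhds
    obtain ⟨z, hz, hz'⟩ := (h1.and self_mem_nhdsWithin).exists
    exact ⟨z, hz, hz'⟩
  set σ := (g F m - g F m') / (m - m') with hσ
  refine ⟨|g F m| + (|σ| + a) * (1 + |m|), by positivity, fun z hz => ?_⟩
  have h1 := h.g_lower hm'J hm' hz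
  have h2 := hga z hz
  have h3 : |g F z| ≤ |g F m| + (|σ| + a) * (z - m) := by
    have e1 : -|σ| * (z - m) ≤ σ * (z - m) :=
      mul_le_mul_of_nonneg_right (neg_abs_le σ) (by linarith)
    have e2 : 0 ≤ a * (z - m) := mul_nonneg ha (by linarith)
    have e3 : 0 ≤ |σ| * (z - m) := mul_nonneg (abs_nonneg _) (by linarith)
    rw [abs_le]
    constructor
    · linarith [neg_abs_le (g F m)]
    · linarith [le_abs_self (g F m)]
  have h4 : z - m ≤ (1 + |m|) * (1 + |z|) := by
    nlinarith [le_abs_self z, neg_abs_le m, abs_nonneg z, abs_nonneg m]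
  have h5 : (|σ| + a) * (z - m) ≤ (|σ| + a) * ((1 + |m|) * (1 + |z|)) := by gcongr
  have h6 : |g F m| * 1 ≤ |g F m| * (1 + |z|) := by
    gcongr; linarith [abs_nonneg z]
  linarith

/-- A slope `s` of `g_F` and a slope `k` of `F ∘ φ` are related through the existence time. -/
lemma ConvexProfile.slope_bound {n : ℕ} {φ : EuclideanSpace ℝ (Fin n) → ℝ} (h : ConvexProfile F)
    (hφ : FConvex F φ) {T : ℝ} (hT : 0 < T)
    (hint : Integrable fun y => gaussKernel (0 - y) T * φ y) {r : ℝ} (hr : 0 < r)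
    {x y : EuclideanSpace ℝ (Fin n)} {k : ℝ} (hk : 0 < k) (hxy : x ≠ y)
    (hslope : realOf F (max (φ x) r) + k * ‖y - x‖ ≤ realOf F (max (φ y) r))
    {p q : ℝ} (hp : p ∈ J F) (hpq : p < q) (hs : 0 < (g F q - g F p) / (q - p)) :
    2 * ((g F q - g F p) / (q - p)) * k ^ 2 * T ≤ 1 := by
  obtain ⟨C, c, hC, hg⟩ := hφ.inv_growth h.admissible hT hint hr hk hxy hslope
  set s := (g F q - g F p) / (q - p) with hsdef
  have hq : q ∈ J F := h.mem_J hp hpq.le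
  set U := realOf F (max (φ y) r) with hU
  have hl : ∀ d, 0 ≤ d → invDeriv F q * Real.exp (g F q * d + s * d ^ 2 / 2) ≤
      invDeriv F (q + d) := fun d hd => h.le_invDeriv_add hq hd fun z hz _ => by
    have := h.g_lower hp hpq hz
    linarith
  set γ := |g F q| with hγ
  -- Integrating the lower bound for `f_F'` over an interval of length one transfers the growth
  -- `exp(s d²/2)`, up to a linear exponent, to `f_F`.
  have hlow : ∀ d, 0 ≤ d →
      invDeriv F q * Real.exp (-γ * (d + 1) + s * d ^ 2 / 2) ≤ inv F (q + d + 1) := by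
    intro d hd
    have hqd : q + d ∈ J F := h.mem_J hq (by linarith)
    have h1 := h.le_inv_add hqd zero_le_one
      (M := invDeriv F q * Real.exp (-γ * (d + 1) + s * d ^ 2 / 2)) (fun z hz => by
        have e1 := hl (z - q) (by linarith [hz.1])
        rw [add_sub_cancel] at e1
        refine le_trans ?_ e1
        refine mul_le_mul_of_nonneg_left (Real.exp_le_exp.2 ?_) (h.invDeriv_pos hq).le
        have hzq : d ≤ z - q := by linarith [hz.1]
        have e2 : -γ * (z - q) ≤ g F q * (z - q) :=
          mul_le_mul_of_nonneg_right (neg_abs_le _) (hd.trans hzq)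
        have e3 : γ * (z - q) ≤ γ * (d + 1) :=
          mul_le_mul_of_nonneg_left (by linarith [hz.2]) (abs_nonneg _)
        have e4 : s * d ^ 2 / 2 ≤ s * (z - q) ^ 2 / 2 := by gcongr
        linarith)
    have := inv_pos' hqd
    linarith
  -- The lower bound `exp(s d²/2)` and the upper bound `exp(d²/(4Tk²))` are compatible only if the
  -- quadratic coefficients are ordered.
  have hA : s / 2 - (1 / k) ^ 2 / (4 * T) ≤ 0 := by
    have hq' := h.invDeriv_pos hq
    refine nonpos_of_quadratic_le (z₀ := max 0 (U - q - 1))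
      (B := -γ - 2 * (1 / k) * ((q + 1) / k + c) / (4 * T))
      (C := Real.log (invDeriv F q) - γ - Real.log C - ((q + 1) / k + c) ^ 2 / (4 * T))
      fun d hd => ?_
    have hd0 : 0 ≤ d := (le_max_left _ _).trans hd
    have hdU : U - q - 1 ≤ d := (le_max_right _ _).trans hd
    have h1 := (hlow d hd0).trans (hg (q + d + 1) (h.mem_J hq (by linarith)) (by linarith))
    have h2 := Real.log_le_log (by positivity) h1
    rw [Real.log_mul hq'.ne' (Real.exp_pos _).ne', Real.log_exp,
      Real.log_mul hC.ne' (Real.exp_pos _).ne', Real.log_exp] at h2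
    have h3 : ((q + d + 1) / k + c) ^ 2 / (4 * T) = (1 / k) ^ 2 / (4 * T) * d ^ 2 +
      2 * (1 / k) * ((q + 1) / k + c) / (4 * T) * d + ((q + 1) / k + c) ^ 2 / (4 * T) := by
      field_simp; ring
    rw [h3] at h2
    linarith
  have h4 : (1 / k) ^ 2 / (4 * T) * (4 * T * k ^ 2) = 1 := by field_simp
  have h5 := mul_le_mul_of_nonneg_right (sub_nonpos.1 hA) (by positivity : 0 ≤ 4 * T * k ^ 2)
  linarith

end Profile

/-! ### Convexity along the flow for Lipschitz initial data -/

section Sufficiency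

variable {n : ℕ} {F : ℝ → EReal} {φ : EuclideanSpace ℝ (Fin n) → ℝ}

lemma mul_lt_quarter_iff {β t : ℝ} (ht : 0 < t) : β * t < 1 / 4 ↔ β < 1 / (4 * t) := by
  rw [lt_div_iff₀ (by positivity : 0 < 4 * t)]
  constructor <;> intro h <;> linarith

lemma le_heatFlow {C β ρ : ℝ} (hφc : Continuous φ)
    (hφ : ∀ y, |φ y| ≤ C * Real.exp (β * ‖y‖ ^ 2)) (hβ : 0 ≤ β) (hρ : ∀ y, ρ ≤ φ y) {t : ℝ}
    (ht : 0 ≤ t) (htβ : β * t < 1 / 4) (x : EuclideanSpace ℝ (Fin n)) : ρ ≤ heatFlow φ t x := by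
  rw [heatFlow_eq_scaled φ ht]
  have h1 : ρ = ∫ z : EuclideanSpace ℝ (Fin n), gaussKernel z 1 * ρ := by
    rw [integral_mul_const, integral_gaussKernel_one, one_mul]
  rw [h1]
  exact integral_mono (integrable_gaussKernel_one.mul_const ρ)
    (integrable_scaled hφc hφ hβ ht htβ x) fun z =>
    mul_le_mul_of_nonneg_left (hρ _) (gaussKernel_pos z one_pos).le

/-- `w = F(e^{tΔ}φ)` solves `∂ₜ w = Δw + g_F(w) |∇w|²`. -/
lemma ConvexProfile.isFlow (h : ConvexProfile F) {C β ρ T : ℝ} (hφc : Continuous φ)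
    (hφ : ∀ y, |φ y| ≤ C * Real.exp (β * ‖y‖ ^ 2)) (hβ : 0 ≤ β) (hρ0 : 0 < ρ) (hρ : ∀ y, ρ ≤ φ y)
    (hTβ : β * T < 1 / 4) :
    IsFlow (g F) T (fun i => EuclideanSpace.basisFun (Fin n) ℝ i)
      (fun t x => realOf F (heatFlow φ t x))
      (fun t x => deriv (realOf F) (heatFlow φ t x) • heatGrad φ t x)
      (fun t x i => deriv (realOf F) (heatFlow φ t x) *
          heatHess φ t x (EuclideanSpace.basisFun (Fin n) ℝ i) +
        deriv (deriv (realOf F)) (heatFlow φ t x) *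
          ⟪heatGrad φ t x, EuclideanSpace.basisFun (Fin n) ℝ i⟫ ^ 2) := by
  have htβ : ∀ t, t ≤ T → β * t < 1 / 4 := fun t ht =>
    (mul_le_mul_of_nonneg_left ht hβ).trans_lt hTβ
  have hv : ∀ t, 0 ≤ t → t ≤ T → ∀ x, 0 < heatFlow φ t x := fun t ht htT x =>
    hρ0.trans_le (le_heatFlow hφc hφ hβ hρ ht (htβ t htT) x)
  refine ⟨?_, ?_, ?_, ?_⟩
  · exact h.admissible.realOf_continuousOn.comp (continuousOn_heatFlow hφc hφ hβ hTβ)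
      fun p hp => hv p.1 hp.1.1 hp.1.2 p.2
  · intro t ht htT x e
    have h1 := hasDerivAt_heatFlow_line hφc hφ ht ((mul_lt_quarter_iff ht).1 (htβ t htT)) x e
    have h2 : HasDerivAt (realOf F) (deriv (realOf F) (heatFlow φ t x))
        ((fun s : ℝ => heatFlow φ t (x + s • e)) 0) := by
      simpa using hasDerivAt_realOf h.contDiffOn (hv t ht.le htT x)
    refine (HasDerivAt.comp (0 : ℝ) h2 h1).congr_deriv ?_
    rw [real_inner_smul_left]
  · intro t ht htT x i
    set e := EuclideanSpace.basisFun (Fin n) ℝ i with he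
    have hlt := (mul_lt_quarter_iff ht).1 (htβ t htT)
    have h1 := hasDerivAt_heatFlow_line hφc hφ ht hlt x e
    have h2 : HasDerivAt (deriv (realOf F)) (deriv (deriv (realOf F)) (heatFlow φ t x))
        ((fun s : ℝ => heatFlow φ t (x + s • e)) 0) := by
      simpa using hasDerivAt_deriv_realOf h.contDiffOn (hv t ht.le htT x)
    have h3 := (HasDerivAt.comp (0 : ℝ) h2 h1).mul (hasDerivAt_heatGrad_line hφc hφ ht hlt x e)
    simp only [real_inner_smul_left]
    refine h3.congr_deriv ?_
    simp only [Function.comp_apply, zero_smul, add_zero]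
    ring
  · intro t ht htT x
    have hlt := (mul_lt_quarter_iff ht).1 (htβ t htT)
    have h1 := hasDerivAt_heatFlow_time hφc hφ ht hlt x
    have hvx := hv t ht.le htT x
    have h2 := HasDerivAt.comp t (hasDerivAt_realOf h.contDiffOn hvx) h1
    refine h2.congr_deriv ?_
    -- With `v` the heat flow, `∂ₜw = F'Δv = Δw - F''|∇v|²`, and `g_F = -F''/F'²` turns the last
    -- term into `g_F(w)|∇w|²`.
    have hg := (h.admissible.g_spec h.contDiffOn (h.admissible.realOf_mem_J hvx)
      (h.deriv_pos _ (inv_pos' (h.admissible.realOf_mem_J hvx)))).1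
    rw [h.admissible.inv_realOf hvx] at hg
    have hd := h.deriv_pos _ hvx
    rw [hg, norm_smul, mul_pow, Real.norm_of_nonneg hd.le, Finset.sum_add_distrib, ← Finset.mul_sum,
      ← Finset.mul_sum, OrthonormalBasis.sum_sq_inner_left]
    field_simp
    ring

/-- Linear growth of `F(e^{tΔ}φ)` when `F ∘ φ` is Lipschitz. -/
lemma ConvexProfile.linear_growth (h : ConvexProfile F) {C β ρ T L a : ℝ} (hφc : Continuous φ)
    (hφ : ∀ y, |φ y| ≤ C * Real.exp (β * ‖y‖ ^ 2)) (hβ : 0 ≤ β) (hρ0 : 0 < ρ) (hρ : ∀ y, ρ ≤ φ y)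
    (hTβ : β * T < 1 / 4) (hT : 0 < T) (hL : 0 < L) (ha : 0 < a)
    (hlip : ∀ x y, realOf F (φ x) - realOf F (φ y) ≤ L * ‖x - y‖)
    (hga : ∀ z z', realOf F ρ ≤ z → z ≤ z' → g F z' - g F z ≤ a * (z' - z))
    (haT : 2 * a * L ^ 2 * T < 1) :
    ∃ C₀, 0 ≤ C₀ ∧ ∀ t ∈ Icc 0 T, ∀ x, |realOf F (heatFlow φ t x)| ≤ C₀ * (1 + ‖x‖) := by
  set m := realOf F ρ with hm
  have hmJ : m ∈ J F := h.admissible.realOf_mem_J hρ0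
  have hmono := h.admissible.realOf_strictMonoOn.monotoneOn
  obtain ⟨C₁, hC₁, hg₁⟩ := h.g_linear_bound hmJ ha.le (fun z hz => hga m z le_rfl hz)
  set Γ := |g F m| + a * |m| with hΓ
  have hΓ0 : 0 ≤ Γ := by positivity
  -- `2aL²T < 1` leaves room in the Gaussian exponent. The part `a/D` pays for the cross term `a z₀
  -- Y`, since `D z₀ ≤ Y` where that term matters.
  obtain ⟨D, hD1, hD⟩ : ∃ D : ℝ, 1 ≤ D ∧ (a / 2 + a / D) * (L ^ 2 * T) < 1 / 4 := by
    have hlim : Tendsto (fun D : ℝ => (a / 2 + a / D) * (L ^ 2 * T)) atTop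
        (𝓝 ((a / 2 + 0) * (L ^ 2 * T))) :=
      (tendsto_const_nhds.add (tendsto_const_nhds.div_atTop tendsto_id)).mul_const _
    have := hlim.eventually_lt_const (show (a / 2 + 0) * (L ^ 2 * T) < 1 / 4 by linarith)
    obtain ⟨D, h1, h2⟩ := (this.and (eventually_ge_atTop 1)).exists
    exact ⟨D, h2, h1⟩
  have hD0 : 0 < D := by linarith
  set b := a / 2 + a / D with hb
  set c₃ := 2 + Γ + 2 * C₁ with hc₃
  set Q : ℝ → ℝ := fun Y => Real.exp (b * Y ^ 2 + c₃ * Y + c₃) with hQ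
  -- pointwise estimate
  have hpt : ∀ z₀ R Y, m ≤ z₀ → 0 ≤ z₀ → D * z₀ ≤ R → 0 ≤ Y →
      inv F (z₀ + Y) ≤ inv F (z₀ + R) +
        invDeriv F (z₀ + R) * Real.exp (-C₁ * (2 + (z₀ + R))) * Real.exp (-R) * Q Y := by
    intro z₀ R Y hmz hz₀ hR hY
    have hR0 : 0 ≤ R := (mul_nonneg hD0.le hz₀).trans hR
    have hz₀J : z₀ ∈ J F := h.mem_J hmJ hmz
    have hNJ : z₀ + R ∈ J F := h.mem_J hz₀J (by linarith)
    have hpos := h.invDeriv_pos hNJ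
    -- Up to `R` monotonicity is enough; past `R` the growth of `f_F` is integrated from `z₀ + R`.
    rcases le_total Y R with hYR | hRY
    · have e1 := h.admissible.inv_strictMonoOn.monotoneOn (h.mem_J hz₀J (by linarith)) hNJ
        (by linarith : z₀ + Y ≤ z₀ + R)
      have e2 : 0 ≤ invDeriv F (z₀ + R) * Real.exp (-C₁ * (2 + (z₀ + R))) * Real.exp (-R) * Q Y := by
        positivity
      linarith
    · set N := z₀ + R with hN
      set S := Y - R with hS
      have hS0 : 0 ≤ S := sub_nonneg.2 hRY
      have hSY : S ≤ Y := by linarith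
      have hzY : D * z₀ ≤ Y := hR.trans hRY
      have hz₀Y : z₀ ≤ Y / D := by rw [le_div_iff₀ hD0]; linarith
      have hz₀Y' : z₀ ≤ Y := hz₀Y.trans (div_le_self hY hD1)
      have hgN : g F N ≤ Γ + a * N := by
        have e1 := hga m N le_rfl (by linarith)
        have e2 : -(a * |m|) ≤ a * m := by
          have := mul_le_mul_of_nonneg_left (neg_abs_le m) ha.le
          linarith
        linarith [le_abs_self (g F m)]
      have e1 := h.inv_add_le hNJ hS0
        (M := invDeriv F N * Real.exp ((Γ + a * N) * S + a * S ^ 2 / 2)) (fun z hz => by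
          have r1 := h.invDeriv_add_le hNJ (by linarith [hz.1] : 0 ≤ z - N)
            (fun z hz => hga N z (by linarith) hz)
          rw [add_sub_cancel] at r1
          refine r1.trans (mul_le_mul_of_nonneg_left (Real.exp_le_exp.2 ?_) hpos.le)
          have hzN : 0 ≤ z - N := by linarith [hz.1]
          have hzS : z - N ≤ S := by linarith [hz.2]
          have r2 : g F N * (z - N) ≤ (Γ + a * N) * (z - N) := mul_le_mul_of_nonneg_right hgN hzN
          have r3 : (Γ + a * N) * (z - N) ≤ (Γ + a * N) * S := by gcongr
          have r4 : a * (z - N) ^ 2 / 2 ≤ a * S ^ 2 / 2 := by gcongr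
          linarith)
      have hNS : N + S = z₀ + Y := by rw [hN, hS]; ring
      rw [hNS] at e1
      refine e1.trans ?_
      have e2 : S ≤ Real.exp Y := by linarith [Real.add_one_le_exp Y]
      have e3 : Real.exp ((Γ + a * N) * S + a * S ^ 2 / 2) * S ≤
          Real.exp (-C₁ * (2 + N)) * Real.exp (-R) * Q Y := by
        calc Real.exp ((Γ + a * N) * S + a * S ^ 2 / 2) * S
            ≤ Real.exp ((Γ + a * N) * S + a * S ^ 2 / 2) * Real.exp Y := by gcongr
          _ = Real.exp ((Γ + a * N) * S + a * S ^ 2 / 2 + Y) := (Real.exp_add _ _).symm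
          _ ≤ Real.exp (-C₁ * (2 + N) + -R + (b * Y ^ 2 + c₃ * Y + c₃)) := by
              refine Real.exp_le_exp.2 ?_
              have q1 : Γ * S ≤ Γ * Y := by gcongr
              have q2 : a * N * S + a * S ^ 2 / 2 = a * z₀ * S + a * (Y ^ 2 - R ^ 2) / 2 := by
                rw [hN, hS]; ring
              have q3 : a * z₀ * S ≤ a * (Y / D) * Y := by gcongr
              have q4 : 0 ≤ a * R ^ 2 := by positivity
              have q5 : C₁ * (2 + N) ≤ C₁ * (2 + 2 * Y) := by
                gcongr; linarith
              have q6 : b * Y ^ 2 = a * Y ^ 2 / 2 + a * (Y / D) * Y := by rw [hb]; ring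
              have q7 : c₃ * Y + c₃ = 2 * Y + Γ * Y + 2 * C₁ * Y + 2 + Γ + 2 * C₁ := by
                rw [hc₃]; ring
              linarith
          _ = _ := by rw [Real.exp_add, Real.exp_add]
      calc inv F N + invDeriv F N * Real.exp ((Γ + a * N) * S + a * S ^ 2 / 2) * S
          = inv F N + invDeriv F N * (Real.exp ((Γ + a * N) * S + a * S ^ 2 / 2) * S) := by ring
        _ ≤ inv F N + invDeriv F N * (Real.exp (-C₁ * (2 + N)) * Real.exp (-R) * Q Y) := by gcongr
        _ = _ := by ring
  -- integrability of the majorant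
  set κ := L * √T with hκ
  have hκ0 : 0 ≤ κ := by positivity
  have hκ2 : κ ^ 2 = L ^ 2 * T := by rw [hκ, mul_pow, Real.sq_sqrt hT.le]
  have hQint : Integrable fun z : EuclideanSpace ℝ (Fin n) => gaussKernel z 1 * Q (κ * ‖z‖) := by
    have hb' : 0 < 1 / 4 - b * (L ^ 2 * T) := sub_pos.2 hD
    refine (integrable_exp_quadratic (n := n) hb' ((4 * Real.pi * 1) ^ (-(n : ℝ) / 2) * Real.exp c₃)
      (c₃ * κ)).congr (Eventually.of_forall fun z => ?_)
    simp only [hQ, gaussKernel]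
    rw [mul_assoc _ (Real.exp c₃), mul_assoc _ (Real.exp (-‖z‖ ^ 2 / (4 * 1))), ← Real.exp_add,
      ← Real.exp_add, mul_pow, hκ2]
    congr 2
    ring
  set I := ∫ z : EuclideanSpace ℝ (Fin n), gaussKernel z 1 * Q (κ * ‖z‖) with hI
  have hI0 : 0 ≤ I := integral_nonneg fun z =>
    mul_nonneg (gaussKernel_pos z one_pos).le (Real.exp_pos _).le
  set u₀ := |realOf F (φ 0)| with hu₀
  have hφpos : ∀ y, 0 < φ y := fun y => hρ0.trans_le (hρ y)
  have hmain : ∀ t ∈ Icc 0 T, ∀ x, realOf F (heatFlow φ t x) ≤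
      (1 + D) * (u₀ + L * ‖x‖) + I + 1 := by
    intro t ht x
    set z₀ := u₀ + L * ‖x‖ with hz₀
    have hz₀0 : 0 ≤ z₀ := by positivity
    have hmz : m ≤ z₀ := by
      have e1 : m ≤ realOf F (φ 0) := hmono hρ0 (hφpos 0) (hρ 0)
      have e2 : 0 ≤ L * ‖x‖ := by positivity
      linarith [le_abs_self (realOf F (φ 0))]
    -- The summand `I` makes `exp(-R) I ≤ 1`, so the tail integral costs only one small increment of
    -- `f_F`.
    set R := D * z₀ + I with hR
    have hDz : D * z₀ ≤ R := by linarith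
    have hR0 : 0 ≤ R := by positivity
    set N := z₀ + R with hN
    have hz₀J : z₀ ∈ J F := h.mem_J hmJ hmz
    have hNJ : N ∈ J F := h.mem_J hz₀J (by linarith)
    have hpos := h.invDeriv_pos hNJ
    have hN1J : N + 1 ∈ J F := h.mem_J hNJ (by linarith)
    set A := invDeriv F N * Real.exp (-C₁ * (2 + N)) * Real.exp (-R) with hA
    have hbound : heatFlow φ t x ≤ inv F N + A * I := by
      rw [heatFlow_eq_scaled φ ht.1]
      have htβ : β * t < 1 / 4 := (mul_le_mul_of_nonneg_left ht.2 hβ).trans_lt hTβ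
      have hrhs : ∫ z : EuclideanSpace ℝ (Fin n),
          (gaussKernel z 1 * inv F N + A * (gaussKernel z 1 * Q (κ * ‖z‖))) = inv F N + A * I := by
        rw [integral_add (integrable_gaussKernel_one.mul_const _) (hQint.const_mul A),
          integral_mul_const, integral_gaussKernel_one, one_mul, integral_const_mul]
      rw [← hrhs]
      refine integral_mono (integrable_scaled hφc hφ hβ ht.1 htβ x)
        ((integrable_gaussKernel_one.mul_const _).add (hQint.const_mul A)) fun z => ?_
      dsimp only
      have e1 : realOf F (φ (x - √t • z)) ≤ z₀ + κ * ‖z‖ := by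
        have r1 := hlip (x - √t • z) 0
        rw [sub_zero] at r1
        have r2 : ‖x - √t • z‖ ≤ ‖x‖ + √T * ‖z‖ := by
          refine (norm_sub_le _ _).trans ?_
          rw [norm_smul, Real.norm_of_nonneg (Real.sqrt_nonneg t)]
          have := Real.sqrt_le_sqrt ht.2
          gcongr
        have r3 := mul_le_mul_of_nonneg_left r2 hL.le
        have r4 : L * (‖x‖ + √T * ‖z‖) = L * ‖x‖ + κ * ‖z‖ := by rw [hκ]; ring
        linarith [le_abs_self (realOf F (φ 0))]
      have e2 : φ (x - √t • z) ≤ inv F (z₀ + κ * ‖z‖) := by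
        have hYJ : z₀ + κ * ‖z‖ ∈ J F := h.mem_J hz₀J (by
          have : 0 ≤ κ * ‖z‖ := by positivity
          linarith)
        have := h.admissible.inv_strictMonoOn.monotoneOn
          (h.admissible.realOf_mem_J (hφpos _)) hYJ e1
        rwa [h.admissible.inv_realOf (hφpos _)] at this
      have e3 := e2.trans (hpt z₀ R (κ * ‖z‖) hmz hz₀0 hDz (by positivity))
      have e4 := mul_le_mul_of_nonneg_left e3 (gaussKernel_pos z one_pos).le
      refine e4.trans (le_of_eq ?_)
      rw [hA]
      ring
    have hAI : A * I ≤ invDeriv F N * Real.exp (-C₁ * (2 + N)) := by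
      have e1 : Real.exp (-R) * I ≤ 1 := by
        have r1 : I ≤ Real.exp R := by linarith [Real.add_one_le_exp R, mul_nonneg hD0.le hz₀0]
        calc Real.exp (-R) * I ≤ Real.exp (-R) * Real.exp R := by gcongr
          _ = 1 := by rw [← Real.exp_add]; simp
      calc A * I = invDeriv F N * Real.exp (-C₁ * (2 + N)) * (Real.exp (-R) * I) := by
            rw [hA]; ring
        _ ≤ invDeriv F N * Real.exp (-C₁ * (2 + N)) * 1 := by gcongr
        _ = _ := mul_one _
    -- On `[N, N+1]` one has `g_F ≥ -C₁(2 + N)`, so `f_F'` stays above `f_F'(N) exp(-C₁(2 + N))`.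
    -- Hence the flow is at most `f_F(N + 1)`, with `N` linear in `‖x‖`.
    have hstep : inv F N + invDeriv F N * Real.exp (-C₁ * (2 + N)) * 1 ≤ inv F (N + 1) := by
      refine h.le_inv_add hNJ zero_le_one fun z hz => ?_
      have hzN : 0 ≤ z - N := by linarith [hz.1]
      have r1 := h.le_invDeriv_add hNJ hzN (a := 0) (c := -C₁ * (2 + N)) (fun y hy hy' => by
        have s1 := (abs_le.1 (hg₁ y (by linarith))).1
        have s2 : |y| ≤ N + 1 := by
          rw [abs_of_nonneg (by linarith)]; linarith [hz.2]
        have s3 : C₁ * (1 + |y|) ≤ C₁ * (2 + N) :=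
          mul_le_mul_of_nonneg_left (by linarith) hC₁
        linarith)
      rw [add_sub_cancel] at r1
      refine le_trans (mul_le_mul_of_nonneg_left (Real.exp_le_exp.2 ?_) hpos.le) r1
      have s1 : C₁ * (2 + N) * (z - N) ≤ C₁ * (2 + N) * 1 := by
        have : 0 ≤ N := by positivity
        gcongr
        linarith [hz.2]
      linarith
    have hfin : heatFlow φ t x ≤ inv F (N + 1) := by linarith
    have htβ : β * t < 1 / 4 := (mul_le_mul_of_nonneg_left ht.2 hβ).trans_lt hTβ
    have hv : 0 < heatFlow φ t x := hρ0.trans_le (le_heatFlow hφc hφ hβ hρ ht.1 htβ x)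
    have := hmono hv (inv_pos' hN1J) hfin
    rw [realOf_inv hN1J] at this
    linarith
  have hlow : ∀ t ∈ Icc 0 T, ∀ x, m ≤ realOf F (heatFlow φ t x) := by
    intro t ht x
    have htβ : β * t < 1 / 4 := (mul_le_mul_of_nonneg_left ht.2 hβ).trans_lt hTβ
    have hv := le_heatFlow hφc hφ hβ hρ ht.1 htβ x
    exact hmono hρ0 (hρ0.trans_le hv) hv
  refine ⟨|m| + ((1 + D) * u₀ + I + 1) + (1 + D) * L, by positivity, fun t ht x => ?_⟩
  have h1 := hmain t ht x
  have h2 := hlow t ht x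
  have h3 : 0 ≤ (|m| + ((1 + D) * u₀ + I + 1)) * ‖x‖ := by positivity
  have h4 : 0 ≤ (1 + D) * u₀ + I + 1 := by positivity
  have h5 : 0 ≤ (1 + D) * L * ‖x‖ := by positivity
  have h6 : 0 ≤ (1 + D) * L := by positivity
  rw [abs_le]
  constructor
  · linarith [neg_abs_le m]
  · linarith [abs_nonneg m]

/-- Preservation for functions with a Lipschitz `F`-transform. -/
theorem ConvexProfile.convexOn_heatFlow_of_lipschitz (h : ConvexProfile F) {C β ρ T T₁ L : ℝ}
    (hφc : Continuous φ) (hφ : ∀ y, |φ y| ≤ C * Real.exp (β * ‖y‖ ^ 2)) (hβ : 0 ≤ β)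
    (hρ0 : 0 < ρ) (hρ : ∀ y, ρ ≤ φ y) (hTβ : β * T < 1 / 4) (hT : 0 < T) (hTT₁ : T < T₁)
    (hL : 0 < L) (hlip : ∀ x y, realOf F (φ x) - realOf F (φ y) ≤ L * ‖x - y‖)
    (hconv : ConvexOn ℝ univ fun x => realOf F (φ x))
    (hga : ∀ z z', z ∈ J F → z ≤ z' → g F z' - g F z ≤ 1 / (2 * L ^ 2 * T₁) * (z' - z)) :
    ConvexOn ℝ univ fun x => realOf F (heatFlow φ T x) := by
  have hT₁ : 0 < T₁ := hT.trans hTT₁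
  set a := 1 / (2 * L ^ 2 * T₁) with ha
  have ha0 : 0 < a := by positivity
  set m := realOf F ρ with hm
  have hmJ : m ∈ J F := h.admissible.realOf_mem_J hρ0
  have hga' : ∀ z z', m ≤ z → z ≤ z' → g F z' - g F z ≤ a * (z' - z) := fun z z' hz hzz =>
    hga z z' (h.mem_J hmJ hz) hzz
  have haT : 2 * a * L ^ 2 * T < 1 := by
    have : 2 * a * L ^ 2 * T = T / T₁ := by rw [ha]; field_simp
    rw [this, div_lt_one hT₁]
    exact hTT₁
  have hflow := h.isFlow hφc hφ hβ hρ0 hρ hTβ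
  obtain ⟨C₀, hC₀, hgrow⟩ := h.linear_growth hφc hφ hβ hρ0 hρ hTβ hT hL ha0 hlip hga' haT
  obtain ⟨C₁, hC₁, hg₁⟩ := h.g_linear_bound hmJ ha0.le (fun z hz => hga' m z le_rfl hz)
  have hlow : ∀ t ∈ Icc 0 T, ∀ x, m ≤ realOf F (heatFlow φ t x) := by
    intro t ht x
    have htβ : β * t < 1 / 4 := (mul_le_mul_of_nonneg_left ht.2 hβ).trans_lt hTβ
    have hv := le_heatFlow hφc hφ hβ hρ ht.1 htβ x
    exact h.admissible.realOf_strictMonoOn.monotoneOn hρ0 (hρ0.trans_le hv) hv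
  have hgB : ∀ t ∈ Icc 0 T, ∀ x, |g F (realOf F (heatFlow φ t x))| ≤
      C₁ * (1 + C₀) * (1 + ‖x‖) := by
    intro t ht x
    have e1 := hg₁ _ (hlow t ht x)
    have e2 := hgrow t ht x
    calc _ ≤ C₁ * (1 + |realOf F (heatFlow φ t x)|) := e1
      _ ≤ C₁ * ((1 + ‖x‖) + C₀ * (1 + ‖x‖)) := by gcongr; linarith [norm_nonneg x]
      _ = _ := by ring
  have hb : ∀ i, ‖EuclideanSpace.basisFun (Fin n) ℝ i‖ = 1 := fun i => by simp
  -- The solution of `ℓ' = aℓ³` with blow-up time `T₁`; the choice `a = 1/(2L²T₁)` gives `ℓ(0) = L`.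
  set ℓ : ℝ → ℝ := fun t => (√(2 * a * (T₁ - t)))⁻¹ with hℓ
  have hin : ∀ t, t ≤ T → 0 < 2 * a * (T₁ - t) := fun t ht => by
    have : 0 < T₁ - t := by linarith
    positivity
  have hℓd : ∀ t, 0 < t → t ≤ T → HasDerivAt ℓ (a * ℓ t ^ 3) t := by
    intro t _ ht
    have h1 : HasDerivAt (fun t : ℝ => 2 * a * (T₁ - t)) (-(2 * a)) t := by
      simpa using ((hasDerivAt_id t).const_sub T₁).const_mul (2 * a)
    have h2 := (h1.sqrt (hin t ht).ne').inv (Real.sqrt_pos.2 (hin t ht)).ne'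
    refine h2.congr_deriv ?_
    have hs := Real.sqrt_pos.2 (hin t ht)
    simp only [hℓ]
    field_simp
  have hℓc : ContinuousOn ℓ (Icc 0 T) := by
    intro t ht
    have : ContinuousAt (fun t : ℝ => √(2 * a * (T₁ - t))) t := by fun_prop
    exact (this.inv₀ (Real.sqrt_pos.2 (hin t ht.2)).ne').continuousWithinAt
  have hlip' := hflow.lipschitz hb ha0.le (by positivity : 0 ≤ C₁ * (1 + C₀)) hC₀ hgrow hlow hgB hga'
    hℓc (fun t _ => by positivity) (Λ := ℓ T) (fun t ht => by
      have h1 := Real.sqrt_pos.2 (hin T le_rfl)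
      simp only [hℓ]
      gcongr
      exact ht.2) hℓd (fun x y => by
      have h1 : ℓ 0 = L := by
        simp only [hℓ]
        have : 2 * a * (T₁ - 0) = (L⁻¹) ^ 2 := by rw [ha]; field_simp; ring
        rw [this, Real.sqrt_sq (by positivity), inv_inv]
      rw [h1]
      have h2 : ∀ x, heatFlow φ 0 x = φ x := fun x => by simp [heatFlow]
      simp only [h2]
      exact hlip x y)
  have hℓmono : ∀ t ∈ Icc 0 T, ℓ t ≤ ℓ T := fun t ht => by
    have h1 := Real.sqrt_pos.2 (hin T le_rfl)
    simp only [hℓ]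
    gcongr
    exact ht.2
  refine hflow.convexOn hb ha0.le (by positivity : 0 ≤ C₁ * (1 + C₀)) hC₀
    (by positivity : 0 ≤ ℓ T) hgrow hlow hgB hga' ?_ (fun t ht x y => (hlip' t ht x y).trans ?_) ?_
    T ⟨hT.le, le_rfl⟩
  · exact h.convexOn.subset (fun z hz => h.mem_J hmJ hz) (convex_Ici m)
  · exact mul_le_mul_of_nonneg_right (hℓmono t ht) (norm_nonneg _)
  · have h2 : ∀ x, heatFlow φ 0 x = φ x := fun x => by simp [heatFlow]
    simpa only [h2] using hconv

end Sufficiency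

/-! ### From Lipschitz data to arbitrary `F`-convex functions -/

section Preservation

variable {n : ℕ} {F : ℝ → EReal} {φ : EuclideanSpace ℝ (Fin n) → ℝ}

lemma convexOn_of_tendsto {E ι : Type*} [NormedAddCommGroup E] [NormedSpace ℝ E] {l : Filter ι}
    [l.NeBot] {u : ι → E → ℝ} {v : E → ℝ} (hlim : ∀ x, Tendsto (fun i => u i x) l (𝓝 (v x)))
    (hu : ∀ᶠ i in l, ConvexOn ℝ univ (u i)) : ConvexOn ℝ univ v := by
  refine ⟨convex_univ, fun x _ y _ α β hα hβ hαβ => ?_⟩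
  refine le_of_tendsto_of_tendsto (hlim _) (((hlim x).const_smul α).add ((hlim y).const_smul β)) ?_
  filter_upwards [hu] with i hi
  exact hi.2 (mem_univ x) (mem_univ y) hα hβ hαβ

lemma ConvexProfile.convexOn_heatFlow_max (h : ConvexProfile F) (hφ : FConvex F φ) {r : ℝ}
    (hr : 0 < r) {t : ℝ} (ht : 0 < t) (htm : ENNReal.ofReal t < maxTime φ) :
    ConvexOn ℝ univ fun x => realOf F (heatFlow (fun y => max (φ y) r) t x) := by
  have hF := h.admissible
  -- A later existence time is needed twice: for a growth rate `β` that is admissible at time `t`,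
  -- and to keep the Lipschitz bound finite up to `t`.
  obtain ⟨T₁, htT₁, hT₁m⟩ := exists_gt_of_lt_maxTime htm
  have hT₁ : 0 < T₁ := ht.trans htT₁
  have hint := integrable_of_lt_maxTime hT₁ hT₁m (0 : EuclideanSpace ℝ (Fin n))
  obtain ⟨β, hβ1, hβ2⟩ := exists_between
    (show 1 / (4 * T₁) < 1 / (4 * t) by gcongr)
  have hβ0 : 0 ≤ β := le_trans (by positivity) hβ1.le
  have htβ : β * t < 1 / 4 := (mul_lt_quarter_iff ht).2 hβ2
  obtain ⟨C, hC, hbd⟩ := hφ.gauss_bound hF hT₁ hint hβ1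
  set ψ : EuclideanSpace ℝ (Fin n) → ℝ := fun y => max (φ y) r with hψ
  set u : EuclideanSpace ℝ (Fin n) → ℝ := fun x => realOf F (ψ x) with hu
  have hψpos : ∀ y, 0 < ψ y := fun y => lt_max_of_lt_right hr
  have hψr : ∀ y, r ≤ ψ y := fun y => le_max_right _ _
  have hψc : Continuous ψ := (hφ.continuous hF).max continuous_const
  have hψbd : ∀ y, |ψ y| ≤ (C + r) * Real.exp (β * ‖y‖ ^ 2) := by
    intro y
    rw [abs_of_pos (hψpos y)]
    have h1 : 1 ≤ Real.exp (β * ‖y‖ ^ 2) := Real.one_le_exp (by positivity)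
    refine max_le ((hbd y).trans ?_) ?_
    · gcongr; linarith
    · have : (C + r) * 1 ≤ (C + r) * Real.exp (β * ‖y‖ ^ 2) := by gcongr
      linarith
  have huconv : ConvexOn ℝ univ u := hφ.convexOn_max hF hr
  set m := realOf F r with hm
  have hmJ : m ∈ J F := hF.realOf_mem_J hr
  have hum : ∀ x, m ≤ u x := fun x => hF.realOf_strictMonoOn.monotoneOn hr (hψpos x) (hψr x)
  have huJ : ∀ x, u x ∈ J F := fun x => hF.realOf_mem_J (hψpos x)
  have huc : Continuous u := continuousOn_univ.1 (huconv.continuousOn isOpen_univ)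
  by_cases hanti : ∀ z z', z ∈ J F → z ≤ z' → g F z' ≤ g F z
  · -- `g` is nonincreasing: approximate from below by Lipschitz functions
    set ψk : ℕ → EuclideanSpace ℝ (Fin n) → ℝ := fun k x => inv F (infConv u k x) with hψk
    have hkJ : ∀ (k : ℕ) x, infConv u k x ∈ J F := fun k x =>
      h.mem_J hmJ (le_infConv hum (Nat.cast_nonneg k) x)
    have hkc : ∀ k : ℕ, Continuous (ψk k) := by
      intro k
      have h1 : Continuous (infConv u k) := continuousOn_univ.1
        ((infConv_convexOn hum (Nat.cast_nonneg k) huconv).continuousOn isOpen_univ)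
      refine continuous_iff_continuousAt.2 fun x => ?_
      exact ContinuousAt.comp (f := infConv u k) (hF.inv_continuousAt (hkJ k x)) h1.continuousAt
    have hkr : ∀ (k : ℕ) x, r ≤ ψk k x := by
      intro k x
      have := hF.inv_strictMonoOn.monotoneOn hmJ (hkJ k x) (le_infConv hum (Nat.cast_nonneg k) x)
      rwa [hm, hF.inv_realOf hr] at this
    have hkle : ∀ (k : ℕ) x, ψk k x ≤ ψ x := by
      intro k x
      have := hF.inv_strictMonoOn.monotoneOn (hkJ k x) (huJ x)
        (infConv_le_self hum (Nat.cast_nonneg k) x)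
      rwa [hu, hF.inv_realOf (hψpos x)] at this
    have hkF : ∀ (k : ℕ) x, realOf F (ψk k x) = infConv u k x := fun k x => realOf_inv (hkJ k x)
    have hkpos : ∀ (k : ℕ) x, 0 < ψk k x := fun k x => hr.trans_le (hkr k x)
    refine convexOn_of_tendsto (l := atTop) (u := fun (k : ℕ) x => realOf F (heatFlow (ψk k) t x))
      ?_ ?_
    · intro x
      have hv : 0 < heatFlow ψ t x := hr.trans_le (le_heatFlow hψc hψbd hβ0 hψr ht.le htβ x)
      have hlim : Tendsto (fun k => heatFlow (ψk k) t x) atTop (𝓝 (heatFlow ψ t x)) := by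
        simp only [heatFlow, if_pos ht]
        have hk := continuous_gaussKernel (n := n) t
        refine tendsto_integral_of_dominated_convergence
          (fun y => gaussKernel (x - y) t * ψ y) (fun k => ?_)
          (integrable_kernel_mul hψc hψbd ht hβ2 x) (fun k => Eventually.of_forall fun y => ?_)
          (Eventually.of_forall fun y => ?_)
        · have := hkc k
          exact Continuous.aestronglyMeasurable (by fun_prop)
        · have hp := gaussKernel_pos (x - y) ht
          rw [Real.norm_of_nonneg (mul_nonneg hp.le (hkpos k y).le)]
          exact mul_le_mul_of_nonneg_left (hkle k y) hp.le
        · refine Tendsto.const_mul _ ?_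
          have h1 := (hF.inv_continuousAt (huJ y)).tendsto.comp (tendsto_infConv hum huc y)
          rwa [hu, hF.inv_realOf (hψpos y)] at h1
      exact ((hF.realOf_continuousOn.continuousAt (Ioi_mem_nhds hv)).tendsto).comp hlim
    · filter_upwards [eventually_gt_atTop 0] with k hk
      have hk0 : (0 : ℝ) < k := Nat.cast_pos.2 hk
      refine h.convexOn_heatFlow_of_lipschitz (C := C + r) (hkc k) (fun y => ?_) hβ0 hr (hkr k) htβ ht htT₁ hk0
        (fun x y => ?_) ?_ (fun z z' hz hzz => ?_)
      · rw [abs_of_pos (hkpos k y)]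
        exact (hkle k y).trans ((le_abs_self _).trans (hψbd y))
      · rw [hkF, hkF]
        exact infConv_lipschitz hum hk0.le x y
      · simp only [hkF]
        exact infConv_convexOn hum hk0.le huconv
      -- Any Lipschitz constant is allowed here, since the slopes of `g` are nonpositive.
      · have h1 := hanti z z' hz hzz
        have h2 : 0 ≤ 1 / (2 * (k : ℝ) ^ 2 * T₁) * (z' - z) :=
          mul_nonneg (by positivity) (by linarith)
        linarith
  · -- `g` has a positive slope: `u` is automatically Lipschitz
    push Not at hanti
    obtain ⟨p, q, hpJ, hpq', hgpq⟩ := hanti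
    have hpq : p < q := lt_of_le_of_ne hpq' (by rintro rfl; exact lt_irrefl _ hgpq)
    by_cases hcst : ∀ x y, u x ≤ u y
    · have hψcst : ψ = fun _ => ψ 0 := by
        ext x
        exact hF.realOf_strictMonoOn.injOn (hψpos x) (hψpos 0) (le_antisymm (hcst x 0) (hcst 0 x))
      rw [hψcst]
      simp only [heatFlow_const _ ht.le]
      exact convexOn_const _ convex_univ
    push Not at hcst
    obtain ⟨y₀, x₀, hxy₀⟩ := hcst
    -- The positive slopes attained by `u`. A single positive slope of `g` bounds them all, and
    -- their supremum is the Lipschitz constant.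
    set K : Set ℝ := {k | 0 < k ∧ ∃ x y, x ≠ y ∧ u x + k * ‖y - x‖ ≤ u y} with hK
    have hkey : ∀ k ∈ K, ∀ p q, p ∈ J F → p < q → 0 < (g F q - g F p) / (q - p) →
        2 * ((g F q - g F p) / (q - p)) * k ^ 2 * T₁ ≤ 1 := by
      rintro k ⟨hk, x, y, hxy, hs⟩ p q hp hpq hpos
      exact h.slope_bound hφ hT₁ hint hr hk hxy hs hp hpq hpos
    have hmem : ∀ x y, u x < u y → (u y - u x) / ‖y - x‖ ∈ K := by
      intro x y hxy
      have hne : x ≠ y := by rintro rfl; exact lt_irrefl _ hxy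
      have hd : 0 < ‖y - x‖ := norm_pos_iff.2 (sub_ne_zero.2 hne.symm)
      refine ⟨div_pos (by linarith) hd, x, y, hne, ?_⟩
      rw [div_mul_cancel₀ _ hd.ne']
      linarith
    have hbddAux : ∀ p q, p ∈ J F → p < q → 0 < (g F q - g F p) / (q - p) → ∀ k ∈ K,
        k ≤ √(1 / (2 * ((g F q - g F p) / (q - p)) * T₁)) := by
      intro p q hp hpq hpos k hk
      have h1 := hkey k hk p q hp hpq hpos
      refine Real.le_sqrt_of_sq_le ?_
      rw [le_div_iff₀ (by positivity)]
      linarith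
    have hs0 : 0 < (g F q - g F p) / (q - p) := div_pos (by linarith) (by linarith)
    have hKbdd : BddAbove K := ⟨_, hbddAux p q hpJ hpq hs0⟩
    have hKne : K.Nonempty := ⟨_, hmem x₀ y₀ hxy₀⟩
    set L := sSup K with hL
    have hLpos : 0 < L := (hmem x₀ y₀ hxy₀).1.trans_le (le_csSup hKbdd (hmem x₀ y₀ hxy₀))
    refine h.convexOn_heatFlow_of_lipschitz hψc hψbd hβ0 hr hψr htβ ht htT₁ hLpos
      (fun x y => ?_) huconv (fun z z' hz hzz => ?_)
    · change u x - u y ≤ L * ‖x - y‖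
      rcases le_or_gt (u x) (u y) with hle | hlt
      · have : 0 ≤ L * ‖x - y‖ := by positivity
        linarith
      · have hne : y ≠ x := by rintro rfl; exact lt_irrefl _ hlt
        have hd : 0 < ‖x - y‖ := norm_pos_iff.2 (sub_ne_zero.2 hne.symm)
        have := le_csSup hKbdd (hmem y x hlt)
        rwa [div_le_iff₀ hd] at this
    · rcases le_or_gt (g F z') (g F z) with hle | hlt
      · have : 0 ≤ 1 / (2 * L ^ 2 * T₁) * (z' - z) := mul_nonneg (by positivity) (by linarith)
        linarith
      · have hzz' : z < z' := lt_of_le_of_ne hzz (by rintro rfl; exact lt_irrefl _ hlt)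
        have hd : 0 < z' - z := by linarith
        set s := (g F z' - g F z) / (z' - z) with hs
        have hspos : 0 < s := div_pos (by linarith) hd
        -- Passing to the supremum over slopes of `u`, for fixed `s`, gives `2sL²T₁ ≤ 1`, the slope
        -- bound on `g` that was needed.
        have h1 : L ≤ √(1 / (2 * s * T₁)) := csSup_le hKne (hbddAux z z' hz hzz' hspos)
        have h2 : L ^ 2 ≤ 1 / (2 * s * T₁) := by
          have := pow_le_pow_left₀ hLpos.le h1 2
          rwa [Real.sq_sqrt (by positivity)] at this
        have h3 : s ≤ 1 / (2 * L ^ 2 * T₁) := by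
          rw [le_div_iff₀ (by positivity)] at h2 ⊢
          linarith
        rw [hs, div_le_iff₀ hd] at h3
        exact h3

lemma heatFlow_pos (hφc : Continuous φ) (hφ0 : ∀ y, 0 ≤ φ y) {t : ℝ} (ht : 0 < t)
    {x : EuclideanSpace ℝ (Fin n)} (hint : Integrable fun y => gaussKernel (x - y) t * φ y)
    {y₀ : EuclideanSpace ℝ (Fin n)} (hy₀ : 0 < φ y₀) : 0 < heatFlow φ t x := by
  simp only [heatFlow, if_pos ht]
  rw [integral_pos_iff_support_of_nonneg
    (fun y => mul_nonneg (gaussKernel_pos _ ht).le (hφ0 y)) hint]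
  have hk := continuous_gaussKernel (n := n) t
  have hopen : IsOpen (Function.support fun y => gaussKernel (x - y) t * φ y) :=
    Continuous.isOpen_support (by fun_prop)
  exact hopen.measure_pos volume ⟨y₀, (mul_pos (gaussKernel_pos _ ht) hy₀).ne'⟩

theorem ConvexProfile.preserved (h : ConvexProfile F) (n : ℕ) : Preserved n F := by
  intro φ hφ _ t ht htm
  have hF := h.admissible
  have hint : ∀ x, Integrable fun y => gaussKernel (x - y) t * φ y :=
    integrable_of_lt_maxTime ht htm
  have hφc := hφ.continuous hF
  -- The zero function is set apart because `F 0` may be `-∞`; every other flow is strictly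
  -- positive.
  by_cases h0 : ∀ y, φ y = 0
  · have hφ0 : φ = fun _ => 0 := funext h0
    have hv : heatFlow φ t = φ := by
      ext x
      rw [hφ0, heatFlow_const 0 ht.le]
    rw [hv]
    exact hφ
  push Not at h0
  obtain ⟨y₀, hy₀⟩ := h0
  have hy₀' : 0 < φ y₀ := lt_of_le_of_ne (hφ.1 y₀) (Ne.symm hy₀)
  have hv : ∀ x, 0 < heatFlow φ t x := fun x => heatFlow_pos hφc hφ.1 ht (hint x) hy₀'
  refine fconvex_of_convexOn hF hv ?_
  refine convexOn_of_tendsto (l := 𝓝[>] (0 : ℝ))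
    (u := fun r x => realOf F (heatFlow (fun y => max (φ y) r) t x)) (fun x => ?_) ?_
  · refine ((hF.realOf_continuousOn.continuousAt (Ioi_mem_nhds (hv x))).tendsto).comp ?_
    have hr : ∀ r : ℝ, 0 < r → Integrable fun y => gaussKernel (x - y) t * (φ y + r) := by
      intro r _
      simp only [mul_add]
      exact (hint x).add ((integrable_kernel ht x).mul_const r)
    have hi : ∀ r : ℝ, 0 < r → Integrable fun y => gaussKernel (x - y) t * max (φ y) r := by
      intro r hr0
      have hk := continuous_gaussKernel (n := n) t
      refine (hr r hr0).mono' (Continuous.aestronglyMeasurable (by fun_prop))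
        (Eventually.of_forall fun y => ?_)
      have hp := gaussKernel_pos (x - y) ht
      rw [Real.norm_of_nonneg (mul_nonneg hp.le ((hφ.1 y).trans (le_max_left _ _)))]
      exact mul_le_mul_of_nonneg_left (max_le (by linarith) (by linarith [hφ.1 y])) hp.le
    -- Constants are stationary, so the cut-off raises the flow by at most `r`, which gives
    -- convergence as `r → 0`.
    have hup : ∀ r : ℝ, 0 < r → heatFlow (fun y => max (φ y) r) t x ≤ heatFlow φ t x + r := by
      intro r hr0
      have e1 := heatFlow_mono ht (hi r hr0) (hr r hr0)
        (fun y => max_le (by linarith) (by linarith [hφ.1 y]))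
      have e2 : heatFlow (fun y => φ y + r) t x = heatFlow φ t x + r := by
        have e3 := heatFlow_const r ht.le x
        simp only [heatFlow, if_pos ht] at e3 ⊢
        simp only [mul_add]
        rw [integral_add (hint x) ((integrable_kernel ht x).mul_const r), e3]
      linarith
    have hlo : ∀ r : ℝ, 0 < r → heatFlow φ t x ≤ heatFlow (fun y => max (φ y) r) t x :=
      fun r hr0 => heatFlow_mono ht (hint x) (hi r hr0) fun y => le_max_left _ _
    have hlim : Tendsto (fun r : ℝ => heatFlow φ t x + r) (𝓝[>] 0) (𝓝 (heatFlow φ t x)) := by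
      have : Tendsto (fun r : ℝ => heatFlow φ t x + r) (𝓝 0) (𝓝 (heatFlow φ t x + 0)) :=
        Continuous.tendsto (by fun_prop) 0
      rw [add_zero] at this
      exact this.mono_left nhdsWithin_le_nhds
    refine tendsto_of_tendsto_of_tendsto_of_le_of_le' tendsto_const_nhds hlim ?_ ?_
    · filter_upwards [self_mem_nhdsWithin] with r hr0 using hlo r hr0
    · filter_upwards [self_mem_nhdsWithin] with r hr0 using hup r hr0
  · filter_upwards [self_mem_nhdsWithin] with r hr0
    exact h.convexOn_heatFlow_max hφ hr0 ht htm

end Preservation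

/-! ### Test functions and the converse -/

section Necessity

variable {n : ℕ} {F : ℝ → EReal}

/-- One application of l'Hôpital's rule; the remaining quotient is a difference quotient of `f₁`, so
`f₁` need only be differentiable at `z`. -/
lemma second_difference_tendsto {f f₁ : ℝ → ℝ} {z d : ℝ}
    (h1 : ∀ᶠ y in 𝓝 z, HasDerivAt f (f₁ y) y) (h2 : HasDerivAt f₁ d z) :
    Tendsto (fun s => (f (z + s) + f (z - s) - 2 * f z) / s ^ 2) (𝓝[≠] 0) (𝓝 d) := by
  have hp : Tendsto (fun s : ℝ => z + s) (𝓝 0) (𝓝 z) := by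
    have h : Continuous fun s : ℝ => z + s := by fun_prop
    simpa using h.tendsto 0
  have hm : Tendsto (fun s : ℝ => z - s) (𝓝 0) (𝓝 z) := by
    have h : Continuous fun s : ℝ => z - s := by fun_prop
    simpa using h.tendsto 0
  have hf : ContinuousAt f z := h1.self_of_nhds.continuousAt
  refine HasDerivAt.lhopital_zero_nhdsNE (f' := fun s => f₁ (z + s) - f₁ (z - s))
    (g' := fun s => 2 * s) ?_ ?_ ?_ ?_ ?_ ?_
  · refine Filter.Eventually.filter_mono nhdsWithin_le_nhds ?_
    filter_upwards [hp.eventually h1, hm.eventually h1] with s hs hs'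
    have e1 := hs.comp_const_add z s
    have e2 := hs'.comp_const_sub z s
    exact ((e1.add e2).sub_const (2 * f z)).congr_deriv (by ring)
  · exact Eventually.of_forall fun s => by simpa using hasDerivAt_pow 2 s
  · filter_upwards [self_mem_nhdsWithin] with s hs
    exact mul_ne_zero two_ne_zero hs
  · have e1 : Tendsto (fun s => f (z + s) + f (z - s) - 2 * f z) (𝓝 0)
        (𝓝 (f z + f z - 2 * f z)) :=
      ((hf.tendsto.comp hp).add (hf.tendsto.comp hm)).sub_const _
    have e2 : f z + f z - 2 * f z = 0 := by ring
    rw [e2] at e1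
    exact e1.mono_left nhdsWithin_le_nhds
  · have e1 : Tendsto (fun s : ℝ => s ^ 2) (𝓝 0) (𝓝 (0 ^ 2)) := (continuous_pow 2).tendsto 0
    rw [zero_pow two_ne_zero] at e1
    exact e1.mono_left nhdsWithin_le_nhds
  · have e1 : HasDerivAt (fun s => f₁ (z + s) - f₁ (z - s)) (2 * d) 0 := by
      have r1 : HasDerivAt f₁ d (z + 0) := by simpa using h2
      have r2 : HasDerivAt f₁ d (z - 0) := by simpa using h2
      exact ((r1.comp_const_add z 0).sub (r2.comp_const_sub z 0)).congr_deriv (by ring)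
    have e2 := (hasDerivAt_iff_tendsto_slope.1 e1).const_mul (1 / 2)
    have e3 : 1 / 2 * (2 * d) = d := by ring
    rw [e3] at e2
    refine e2.congr' ?_
    filter_upwards [self_mem_nhdsWithin] with s hs
    have hs' : s ≠ 0 := hs
    rw [slope_def_field]
    simp only [add_zero, sub_zero, sub_self]
    field_simp

/-- `f_F` is increasing, so its value at `z` is controlled by the weighted integral over `(z, z+1]`.
-/
lemma Admissible.inv_gauss_bound (hF : Admissible F) (hT : Tendsto F atTop (𝓝 ⊤)) {A : ℝ}
    (hA : 0 < A) (hW : weightIntegral F A < ⊤) {m : ℝ} (hm : m ∈ J F) :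
    ∃ C B : ℝ, 0 < C ∧ 0 < B ∧ ∀ z, inv F (max z m) ≤ C * Real.exp (B * z ^ 2) := by
  set W := (weightIntegral F A).toReal with hWdef
  have h1J : realOf F 1 ∈ J F := hF.realOf_mem_J one_pos
  have hmono := hF.inv_strictMonoOn.monotoneOn
  have key : ∀ z, realOf F 1 ≤ z → inv F z ≤ W * Real.exp (2 * A) * Real.exp (2 * A * z ^ 2) := by
    intro z hz
    have hzJ : z ∈ J F := hF.mem_J_of_le hT h1J hz
    have hle : ENNReal.ofReal (Real.exp (-(A * (2 * z ^ 2 + 2))) * inv F z) ≤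
        weightIntegral F A := by
      calc ENNReal.ofReal (Real.exp (-(A * (2 * z ^ 2 + 2))) * inv F z)
          = ∫⁻ _y in Ioc z (z + 1), ENNReal.ofReal (Real.exp (-(A * (2 * z ^ 2 + 2))) * inv F z) := by
            rw [setLIntegral_const]; simp
        _ ≤ ∫⁻ y in Ioc z (z + 1), ENNReal.ofReal (Real.exp (-A * y ^ 2) * inv F y) := by
            refine setLIntegral_mono' measurableSet_Ioc fun y hy => ENNReal.ofReal_le_ofReal ?_
            have e1 : inv F z ≤ inv F y := hmono hzJ (hF.mem_J_of_le hT hzJ hy.1.le) hy.1.le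
            have e2 : y ^ 2 ≤ 2 * z ^ 2 + 2 := by
              have r1 : (y - z) ^ 2 ≤ 1 := by
                have := hy.1; have := hy.2
                nlinarith
              nlinarith [sq_nonneg (y - 2 * z)]
            have e3 : -(A * (2 * z ^ 2 + 2)) ≤ -A * y ^ 2 := by nlinarith
            have e4 := (inv_pos' hzJ).le
            gcongr
        _ ≤ weightIntegral F A :=
            lintegral_mono_set fun y hy => lt_of_le_of_lt hz hy.1
    have h2 : Real.exp (-(A * (2 * z ^ 2 + 2))) * inv F z ≤ W := by
      rw [hWdef]
      exact (ENNReal.ofReal_le_iff_le_toReal hW.ne).1 hle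
    have h3 := mul_le_mul_of_nonneg_left h2 (Real.exp_pos (A * (2 * z ^ 2 + 2))).le
    rw [← mul_assoc, ← Real.exp_add, add_neg_cancel, Real.exp_zero, one_mul] at h3
    refine h3.trans (le_of_eq ?_)
    rw [mul_assoc, ← Real.exp_add, mul_comm]
    congr 2
    ring
  have hW0 : 0 ≤ W := ENNReal.toReal_nonneg
  have hm0 := inv_pos' hm
  refine ⟨W * Real.exp (2 * A) + 1 + inv F m, 2 * A, by positivity, by positivity, fun z => ?_⟩
  have hone : 1 ≤ Real.exp (2 * A * z ^ 2) := Real.one_le_exp (by positivity)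
  have hWe : 0 ≤ W * Real.exp (2 * A) := by positivity
  have hexp := Real.exp_pos (2 * A * z ^ 2)
  rcases le_total z m with h | h
  · rw [max_eq_right h]
    calc inv F m ≤ (W * Real.exp (2 * A) + 1 + inv F m) * 1 := by linarith
      _ ≤ _ := by gcongr
  · rw [max_eq_left h]
    rcases le_total (realOf F 1) z with h' | h'
    · refine (key z h').trans ?_
      gcongr
      linarith
    · have e1 := hmono (hF.mem_J_of_le hT hm h) h1J h'
      rw [hF.inv_realOf one_pos] at e1
      calc inv F z ≤ (W * Real.exp (2 * A) + 1 + inv F m) * 1 := by linarith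
        _ ≤ _ := by gcongr

/-- The profile `f_F(max(x_i, m))`, whose `F`-transform is the simplest nonconstant convex
function bounded below by `m`. -/
def testFun (F : ℝ → EReal) (m : ℝ) (i : Fin n) (x : EuclideanSpace ℝ (Fin n)) : ℝ :=
  inv F (max (x i) m)

section TestFun

variable {m : ℝ} {i : Fin n}

lemma Admissible.max_mem_J (hF : Admissible F) (hT : Tendsto F atTop (𝓝 ⊤)) (hm : m ∈ J F) (z : ℝ) :
    max z m ∈ J F :=
  hF.mem_J_of_le hT hm (le_max_right _ _)

lemma Admissible.testFun_continuous (hF : Admissible F) (hT : Tendsto F atTop (𝓝 ⊤))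
    (hm : m ∈ J F) : Continuous (testFun F m i) := by
  refine continuous_iff_continuousAt.2 fun x => ?_
  exact ContinuousAt.comp (f := fun x : EuclideanSpace ℝ (Fin n) => max (x i) m)
    (hF.inv_continuousAt (hF.max_mem_J hT hm _)) (by fun_prop)

lemma Admissible.testFun_fconvex (hF : Admissible F) (hT : Tendsto F atTop (𝓝 ⊤))
    (hm : m ∈ J F) : FConvex F (testFun F m i) := by
  refine fconvex_of_convexOn hF (fun x => inv_pos' (hF.max_mem_J hT hm _)) ?_
  refine ⟨convex_univ, fun x _ y _ α β hα hβ hαβ => ?_⟩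
  simp only [testFun, realOf_inv (hF.max_mem_J hT hm _), smul_eq_mul, PiLp.add_apply,
    PiLp.smul_apply]
  have e1 := mul_le_mul_of_nonneg_left (le_max_left (x i) m) hα
  have e2 := mul_le_mul_of_nonneg_left (le_max_left (y i) m) hβ
  have e3 := mul_le_mul_of_nonneg_left (le_max_right (x i) m) hα
  have e4 := mul_le_mul_of_nonneg_left (le_max_right (y i) m) hβ
  have e5 : α * m + β * m = m := by rw [← add_mul, hαβ, one_mul]
  exact max_le (by linarith) (by linarith)

/-- The time derivative at `t = 0` of the `F`-transform of the heat flow of the test function is a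
positive multiple of `g_F`. -/
lemma Admissible.hasDerivWithinAt_testFun (hF : Admissible F)
    (hC2 : ContDiffOn ℝ 2 (realOf F) (Ioi 0)) (hT : Tendsto F atTop (𝓝 ⊤)) (hm : m ∈ J F)
    {C B : ℝ} (hC : 0 < C) (hB : 0 < B) (hbd : ∀ z, inv F (max z m) ≤ C * Real.exp (B * z ^ 2))
    {x : EuclideanSpace ℝ (Fin n)} (hx : m < x i) (hpos : 0 < deriv (realOf F) (inv F (x i))) :
    HasDerivWithinAt (fun t => realOf F (heatFlow (testFun F m i) t x))
      ((∫ ζ : EuclideanSpace ℝ (Fin n), gaussKernel ζ 1 * (ζ i ^ 2 / 2)) * g F (x i)) (Ioi 0) 0 := by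
  set z := x i with hz
  set φ := testFun F m i with hφ
  have hzJ : z ∈ J F := hF.mem_J_of_le hT hm hx.le
  set f : ℝ → ℝ := fun s => inv F (max s m) with hf
  have hf0 : ∀ s, 0 < f s := fun s => inv_pos' (hF.max_mem_J hT hm s)
  have hfc : Continuous f := continuous_iff_continuousAt.2 fun s =>
    ContinuousAt.comp (f := fun s : ℝ => max s m) (hF.inv_continuousAt (hF.max_mem_J hT hm _))
      (by fun_prop)
  have hφc : Continuous φ := hF.testFun_continuous hT hm
  have hcoord : ∀ y : EuclideanSpace ℝ (Fin n), |y i| ≤ ‖y‖ := fun y => PiLp.norm_apply_le y i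
  have hφbd : ∀ y, |φ y| ≤ C * Real.exp (B * ‖y‖ ^ 2) := by
    intro y
    have h0 : 0 < φ y := hf0 (y i)
    rw [abs_of_pos h0]
    refine (hbd (y i)).trans ?_
    have : y i ^ 2 ≤ ‖y‖ ^ 2 := by rw [← sq_abs]; gcongr; exact hcoord y
    gcongr
  -- The second derivative of `f_F` at `z`, in the form `f_F' g_F`.
  set d := (deriv (realOf F) (inv F z))⁻¹ * g F z with hd
  set q : ℝ → ℝ := fun s => f (z + s) + f (z - s) - 2 * f z with hq
  have hqlim : Tendsto (fun s => q s / s ^ 2) (𝓝[≠] 0) (𝓝 d) := by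
    refine second_difference_tendsto (f₁ := fun y => (deriv (realOf F) (inv F y))⁻¹) ?_
      (hF.g_spec hC2 hzJ hpos).2.2
    have hc : ContinuousAt (fun y => deriv (realOf F) (inv F y)) z :=
      ContinuousAt.comp (hasDerivAt_deriv_realOf hC2 (inv_pos' hzJ)).continuousAt
        (hF.inv_continuousAt hzJ)
    filter_upwards [lt_mem_nhds hx, hc.eventually_const_lt hpos] with y hy hy'
    have e1 := hF.hasDerivAt_inv hC2 (hF.mem_J_of_le hT hm (le_of_lt hy)) hy'
    refine e1.congr_of_eventuallyEq ?_
    filter_upwards [lt_mem_nhds hy] with y' hy'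
    rw [hf]
    simp only [max_eq_left (le_of_lt hy')]
  have hq0 : q 0 = 0 := by simp only [hq, add_zero, sub_zero]; ring
  -- global bound of the second difference
  obtain ⟨M, hM, hqM⟩ : ∃ M, 0 < M ∧ ∀ s, |q s| ≤ M * s ^ 2 * Real.exp (2 * B * s ^ 2) := by
    have h1 : ∀ᶠ s in 𝓝[≠] (0 : ℝ), |q s / s ^ 2| < |d| + 1 :=
      hqlim.abs.eventually_lt_const (by linarith)
    rw [eventually_nhdsWithin_iff, Metric.eventually_nhds_iff] at h1
    obtain ⟨δ, hδ, h1⟩ := h1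
    set G := 4 * C * Real.exp (2 * B * z ^ 2) with hG
    have hG0 : 0 < G := by positivity
    refine ⟨|d| + 1 + G / δ ^ 2, by positivity, fun s => ?_⟩
    rcases eq_or_ne s 0 with rfl | hs
    · simp [hq0]
    have hs2 : 0 < s ^ 2 := by positivity
    have hone : 1 ≤ Real.exp (2 * B * s ^ 2) := Real.one_le_exp (by positivity)
    -- Near `0` the limit of the second difference gives the factor `s²`; away from `0` the Gaussian
    -- bound is divided by `δ²` to create it.
    rcases lt_or_ge (dist s 0) δ with hlt | hge
    · have e1 := (h1 hlt hs).le
      rw [abs_div, abs_of_pos hs2, div_le_iff₀ hs2] at e1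
      calc |q s| ≤ (|d| + 1) * s ^ 2 * 1 := by linarith
        _ ≤ (|d| + 1 + G / δ ^ 2) * s ^ 2 * Real.exp (2 * B * s ^ 2) := by
            have : 0 ≤ G / δ ^ 2 := by positivity
            exact mul_le_mul (mul_le_mul_of_nonneg_right (by linarith) hs2.le) hone zero_le_one
              (by positivity)
    · rw [Real.dist_eq, sub_zero] at hge
      have hδs : δ ^ 2 ≤ s ^ 2 := by rw [← sq_abs s]; gcongr
      have hfb : ∀ y, y ^ 2 ≤ 2 * z ^ 2 + 2 * s ^ 2 →
          f y ≤ C * (Real.exp (2 * B * z ^ 2) * Real.exp (2 * B * s ^ 2)) := by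
        intro y hy
        refine (hbd y).trans ?_
        rw [← Real.exp_add]
        gcongr
        have := mul_le_mul_of_nonneg_left hy hB.le
        linarith
      have e1 := hfb (z + s) (by nlinarith [sq_nonneg (z - s)])
      have e2 := hfb (z - s) (by nlinarith [sq_nonneg (z + s)])
      have e3 := hfb z (by nlinarith [sq_nonneg z])
      have e4 : |q s| ≤ G * Real.exp (2 * B * s ^ 2) := by
        have r1 : G * Real.exp (2 * B * s ^ 2) =
          4 * (C * (Real.exp (2 * B * z ^ 2) * Real.exp (2 * B * s ^ 2))) := by rw [hG]; ring
        rw [r1, abs_le]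
        have := hf0 (z + s); have := hf0 (z - s); have := hf0 z
        constructor <;> simp only [hq] <;> linarith
      have e5 : G ≤ G / δ ^ 2 * s ^ 2 := by
        rw [div_mul_eq_mul_div, le_div_iff₀ (by positivity)]
        gcongr
      refine e4.trans ?_
      gcongr
      have : 0 ≤ (|d| + 1) * s ^ 2 := by positivity
      linarith
  -- the symmetrised representation
  have hrep : ∀ t, 0 < t → B * t < 1 / 4 →
      heatFlow φ t x - φ x = ∫ ζ : EuclideanSpace ℝ (Fin n), gaussKernel ζ 1 * (q (√t * ζ i) / 2) := by
    intro t ht htB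
    -- Averaging over `ζ` and `-ζ` removes the first order term of size `√t`, leaving a second
    -- difference of size `t`.
    have i1 := integrable_scaled hφc hφbd hB.le ht.le htB x
    have i2 := i1.comp_neg
    have e1 := heatFlow_eq_scaled φ ht.le x
    have e2 : heatFlow φ t x = ∫ ζ : EuclideanSpace ℝ (Fin n),
        gaussKernel (-ζ) 1 * φ (x - √t • (-ζ)) := by
      rw [e1, integral_neg_eq_self (fun ζ => gaussKernel ζ 1 * φ (x - √t • ζ))]
    have e3 : φ x = ∫ ζ : EuclideanSpace ℝ (Fin n), gaussKernel ζ 1 * φ x := by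
      rw [integral_mul_const, integral_gaussKernel_one, one_mul]
    have i3 : Integrable fun ζ : EuclideanSpace ℝ (Fin n) => gaussKernel ζ 1 * φ x :=
      integrable_gaussKernel_one.mul_const _
    have e4 : heatFlow φ t x - φ x = (1 / 2) * ((heatFlow φ t x + heatFlow φ t x) - 2 * φ x) := by
      ring
    have i12 : Integrable fun ζ : EuclideanSpace ℝ (Fin n) =>
        gaussKernel ζ 1 * φ (x - √t • ζ) + gaussKernel (-ζ) 1 * φ (x - √t • (-ζ)) := i1.add i2
    have e5 : ∫ ζ : EuclideanSpace ℝ (Fin n), (gaussKernel ζ 1 * φ (x - √t • ζ) +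
        gaussKernel (-ζ) 1 * φ (x - √t • (-ζ))) = heatFlow φ t x + heatFlow φ t x :=
      (integral_add i1 i2).trans (congrArg₂ (· + ·) e1.symm e2.symm)
    have e6 : ∫ ζ : EuclideanSpace ℝ (Fin n), (gaussKernel ζ 1 * φ (x - √t • ζ) +
        gaussKernel (-ζ) 1 * φ (x - √t • (-ζ)) - 2 * (gaussKernel ζ 1 * φ x)) =
          heatFlow φ t x + heatFlow φ t x - 2 * φ x := by
      rw [integral_sub i12 (i3.const_mul 2), e5, integral_const_mul, ← e3]
    rw [e4, ← e6, ← integral_const_mul]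
    refine integral_congr_ae (Eventually.of_forall fun ζ => ?_)
    have hneg : gaussKernel (-ζ) 1 = gaussKernel ζ 1 := by simp [gaussKernel]
    simp only [hneg, hφ, testFun, hq, hf]
    simp only [PiLp.sub_apply, PiLp.smul_apply, PiLp.neg_apply, smul_eq_mul, mul_neg, sub_neg_eq_add,
      ← hz]
    ring
  -- the limit of the difference quotient
  have hv0 : heatFlow φ 0 x = φ x := by simp [heatFlow]
  have hderiv : HasDerivWithinAt (fun t => heatFlow φ t x)
      ((∫ ζ : EuclideanSpace ℝ (Fin n), gaussKernel ζ 1 * (ζ i ^ 2 / 2)) * d) (Ioi 0) 0 := by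
    rw [hasDerivWithinAt_iff_tendsto_slope' (by simp)]
    have hk := continuous_gaussKernel (n := n) 1
    have hlim : Tendsto (fun t : ℝ => ∫ ζ : EuclideanSpace ℝ (Fin n),
        gaussKernel ζ 1 * (q (√t * ζ i) / (2 * t))) (𝓝[>] 0)
        (𝓝 (∫ ζ : EuclideanSpace ℝ (Fin n), gaussKernel ζ 1 * (ζ i ^ 2 / 2 * d))) := by
      refine tendsto_integral_filter_of_dominated_convergence
        (fun ζ => (4 * Real.pi * 1) ^ (-(n : ℝ) / 2) * M *
          Real.exp (-(1 / 8) * ‖ζ‖ ^ 2 + 2 * ‖ζ‖)) ?_ ?_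
        (integrable_exp_quadratic (by norm_num) _ _) ?_
      · refine Eventually.of_forall fun t => ?_
        have : Continuous q := by fun_prop
        exact Continuous.aestronglyMeasurable (by fun_prop)
      · filter_upwards [Ioo_mem_nhdsGT (show (0 : ℝ) < 1 / (16 * B) by positivity)] with t ht
        refine Eventually.of_forall fun ζ => ?_
        have ht0 : 0 < t := ht.1
        have htB : 2 * B * t ≤ 1 / 8 := by
          have := ht.2.le
          rw [le_div_iff₀ (by positivity)] at this
          linarith
        have e1 := hqM (√t * ζ i)
        rw [mul_pow, Real.sq_sqrt ht0.le] at e1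
        have hζ : ζ i ^ 2 ≤ ‖ζ‖ ^ 2 := by rw [← sq_abs]; gcongr; exact hcoord ζ
        have e2 : |q (√t * ζ i) / (2 * t)| ≤ M * Real.exp (2 * ‖ζ‖) * Real.exp (1 / 8 * ‖ζ‖ ^ 2) := by
          rw [abs_div, abs_of_pos (by positivity : 0 < 2 * t), div_le_iff₀ (by positivity)]
          refine e1.trans ?_
          have r1 : M * (t * ζ i ^ 2) * Real.exp (2 * B * (t * ζ i ^ 2)) ≤
              M * (t * Real.exp (2 * ‖ζ‖)) * Real.exp (1 / 8 * ‖ζ‖ ^ 2) := by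
            have r2 : ζ i ^ 2 ≤ Real.exp (2 * ‖ζ‖) :=
              hζ.trans (sq_le_exp_two_mul (norm_nonneg ζ))
            have r3 : 2 * B * (t * ζ i ^ 2) ≤ 1 / 8 * ‖ζ‖ ^ 2 := by
              calc 2 * B * (t * ζ i ^ 2) = 2 * B * t * ζ i ^ 2 := by ring
                _ ≤ 1 / 8 * ‖ζ‖ ^ 2 := by gcongr
            gcongr
          refine r1.trans ?_
          have r4 : 0 ≤ M * (t * Real.exp (2 * ‖ζ‖)) * Real.exp (1 / 8 * ‖ζ‖ ^ 2) := by positivity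
          linarith
        have hp := gaussKernel_pos ζ one_pos
        rw [norm_mul, Real.norm_of_nonneg hp.le, Real.norm_eq_abs]
        calc gaussKernel ζ 1 * |q (√t * ζ i) / (2 * t)|
            ≤ gaussKernel ζ 1 * (M * Real.exp (2 * ‖ζ‖) * Real.exp (1 / 8 * ‖ζ‖ ^ 2)) := by gcongr
          _ = (4 * Real.pi * 1) ^ (-(n : ℝ) / 2) * M * (Real.exp (-‖ζ‖ ^ 2 / (4 * 1)) *
                Real.exp (2 * ‖ζ‖) * Real.exp (1 / 8 * ‖ζ‖ ^ 2)) := by unfold gaussKernel; ring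
          _ = _ := by
              rw [← Real.exp_add, ← Real.exp_add]
              congr 2
              ring
      · refine Eventually.of_forall fun ζ => Tendsto.const_mul _ ?_
        rcases eq_or_ne (ζ i) 0 with h0 | h0
        · simp [h0, hq0]
        · have hs : Tendsto (fun t : ℝ => √t * ζ i) (𝓝[>] 0) (𝓝[≠] 0) := by
            refine tendsto_nhdsWithin_iff.2 ⟨?_, ?_⟩
            · have : Tendsto (fun t : ℝ => √t * ζ i) (𝓝 0) (𝓝 (√0 * ζ i)) :=
                Continuous.tendsto (by fun_prop) 0
              rw [Real.sqrt_zero, zero_mul] at this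
              exact this.mono_left nhdsWithin_le_nhds
            · filter_upwards [self_mem_nhdsWithin] with t ht
              exact mul_ne_zero (Real.sqrt_pos.2 ht).ne' h0
          have e1 := (hqlim.comp hs).const_mul (ζ i ^ 2 / 2)
          refine e1.congr' ?_
          filter_upwards [self_mem_nhdsWithin] with t ht
          have ht0 : (0 : ℝ) < t := ht
          simp only [Function.comp_apply]
          rw [mul_pow, Real.sq_sqrt ht0.le]
          field_simp
    have e0 : (∫ ζ : EuclideanSpace ℝ (Fin n), gaussKernel ζ 1 * (ζ i ^ 2 / 2)) * d =
        ∫ ζ : EuclideanSpace ℝ (Fin n), gaussKernel ζ 1 * (ζ i ^ 2 / 2 * d) := by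
      rw [← integral_mul_const]
      exact integral_congr_ae (Eventually.of_forall fun ζ => by ring)
    rw [e0]
    refine hlim.congr' ?_
    filter_upwards [Ioo_mem_nhdsGT (show (0 : ℝ) < 1 / (4 * B) by positivity)] with t ht
    have ht0 : 0 < t := ht.1
    have htB : B * t < 1 / 4 := by
      have := ht.2
      rw [lt_div_iff₀ (by positivity)] at this
      linarith
    rw [slope_def_field, hv0, hrep t ht0 htB, sub_zero, div_eq_inv_mul, ← integral_const_mul]
    refine integral_congr_ae (Eventually.of_forall fun ζ => ?_)
    dsimp only
    field_simp
  have hφx : φ x = inv F z := by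
    rw [hφ, testFun, ← hz, max_eq_left hx.le]
  have h3 : HasDerivAt (realOf F) (deriv (realOf F) (inv F z)) (heatFlow φ 0 x) := by
    rw [hv0, hφx]
    exact hasDerivAt_realOf hC2 (inv_pos' hzJ)
  -- The chain rule factor `F'` cancels the `f_F' = 1/F'` contained in `d`.
  refine (h3.comp_hasDerivWithinAt (0 : ℝ) hderiv).congr_deriv ?_
  rw [hd]
  field_simp

end TestFun

lemma integral_coord_sq_pos (i : Fin n) :
    0 < ∫ ζ : EuclideanSpace ℝ (Fin n), gaussKernel ζ 1 * (ζ i ^ 2 / 2) := by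
  have hk := continuous_gaussKernel (n := n) 1
  have hint : Integrable fun ζ : EuclideanSpace ℝ (Fin n) => gaussKernel ζ 1 * (ζ i ^ 2 / 2) := by
    refine integrable_of_gauss_bound (Continuous.aestronglyMeasurable (by fun_prop))
      (by norm_num : (0 : ℝ) < 1 / 4) (A := (4 * Real.pi * 1) ^ (-(n : ℝ) / 2)) (c := 2) fun ζ => ?_
    have hζ : ζ i ^ 2 ≤ ‖ζ‖ ^ 2 := by rw [← sq_abs]; gcongr; exact PiLp.norm_apply_le ζ i
    have h1 : ζ i ^ 2 / 2 ≤ Real.exp (2 * ‖ζ‖) := by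
      have := hζ.trans (sq_le_exp_two_mul (norm_nonneg ζ))
      linarith [sq_nonneg (ζ i)]
    have hp := gaussKernel_pos ζ one_pos
    rw [Real.norm_of_nonneg (by positivity)]
    calc gaussKernel ζ 1 * (ζ i ^ 2 / 2) ≤ gaussKernel ζ 1 * Real.exp (2 * ‖ζ‖) := by gcongr
      _ = (4 * Real.pi * 1) ^ (-(n : ℝ) / 2) * (Real.exp (-‖ζ‖ ^ 2 / (4 * 1)) *
            Real.exp (2 * ‖ζ‖)) := by unfold gaussKernel; ring
      _ = _ := by
          rw [← Real.exp_add]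
          congr 2
          ring
  rw [integral_pos_iff_support_of_nonneg (fun ζ => by
    have := gaussKernel_pos ζ one_pos
    dsimp only [Pi.zero_apply]
    positivity) hint]
  have hopen : IsOpen (Function.support fun ζ : EuclideanSpace ℝ (Fin n) =>
      gaussKernel ζ 1 * (ζ i ^ 2 / 2)) := Continuous.isOpen_support (by fun_prop)
  refine hopen.measure_pos volume ⟨EuclideanSpace.single i 1, ?_⟩
  have := gaussKernel_pos (EuclideanSpace.single i (1 : ℝ)) one_pos
  simp only [Function.mem_support]
  simp
  exact this.ne'

/-- If `F`-convexity is preserved, then `g_F` satisfies the convexity inequality at points where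
`F' > 0`. -/
lemma Preserved.g_convex_ineq (hn : 1 ≤ n) (hP : Preserved n F) (hF : Admissible F)
    (hC2 : ContDiffOn ℝ 2 (realOf F) (Ioi 0)) (hT : Tendsto F atTop (𝓝 ⊤))
    (hW : ∃ A : ℝ, 0 < A ∧ weightIntegral F A < ⊤) {z₁ z₂ α β : ℝ} (hz₁ : z₁ ∈ J F)
    (hz₂ : z₂ ∈ J F) (hα : 0 < α) (hβ : 0 < β) (hαβ : α + β = 1)
    (h₁ : 0 < deriv (realOf F) (inv F z₁)) (h₂ : 0 < deriv (realOf F) (inv F z₂))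
    (h₃ : 0 < deriv (realOf F) (inv F (α * z₁ + β * z₂))) :
    g F (α * z₁ + β * z₂) ≤ α * g F z₁ + β * g F z₂ := by
  obtain ⟨A, hA, hWA⟩ := hW
  -- A truncation level strictly below all the points used, so that the initial transform is affine
  -- near each of them.
  obtain ⟨m, hm, hm₁, hm₂⟩ : ∃ m ∈ J F, m < z₁ ∧ m < z₂ := by
    have hz : min z₁ z₂ ∈ J F := by
      rcases min_choice z₁ z₂ with h | h <;> rw [h] <;> assumption
    have h0 : ∀ᶠ z in 𝓝 (min z₁ z₂), z ∈ J F := hF.J_isOpen.mem_nhds hz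
    have h1 : ∀ᶠ z in 𝓝[<] (min z₁ z₂), z ∈ J F := h0.filter_mono nhdsWithin_le_nhds
    obtain ⟨z, hz, hz'⟩ := (h1.and self_mem_nhdsWithin).exists
    exact ⟨z, hz, lt_min_iff.1 hz'⟩
  have hm₃ : m < α * z₁ + β * z₂ := by
    have e1 := mul_lt_mul_of_pos_left hm₁ hα
    have e2 := mul_lt_mul_of_pos_left hm₂ hβ
    have e3 : α * m + β * m = m := by rw [← add_mul, hαβ, one_mul]
    linarith
  obtain ⟨C, B, hC, hB, hbd⟩ := hF.inv_gauss_bound hT hA hWA hm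
  set i : Fin n := ⟨0, hn⟩ with hi
  set φ : EuclideanSpace ℝ (Fin n) → ℝ := testFun F m i with hφ
  have hφc : Continuous φ := hF.testFun_continuous hT hm
  have hφF : FConvex F φ := hF.testFun_fconvex hT hm
  have hφbd : ∀ y, |φ y| ≤ C * Real.exp (B * ‖y‖ ^ 2) := by
    intro y
    rw [abs_of_nonneg (hφF.1 y)]
    refine (hbd (y i)).trans ?_
    have : y i ^ 2 ≤ ‖y‖ ^ 2 := by rw [← sq_abs]; gcongr; exact PiLp.norm_apply_le y i
    gcongr
  have hmax : ENNReal.ofReal (1 / (4 * B)) ≤ maxTime φ := by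
    refine le_sSup fun t ht htB x => ?_
    have h1 : t < 1 / (4 * B) := (ENNReal.ofReal_lt_ofReal_iff (by positivity)).1 htB
    refine integrable_kernel_mul hφc hφbd ht ((mul_lt_quarter_iff ht).1 ?_) x
    rw [lt_div_iff₀ (by positivity)] at h1
    linarith
  have hmax0 : 0 < maxTime φ := lt_of_lt_of_le (ENNReal.ofReal_pos.2 (by positivity)) hmax
  have hρ0 : 0 < inv F m := inv_pos' hm
  have hρ : ∀ y, inv F m ≤ φ y := fun y =>
    hF.inv_strictMonoOn.monotoneOn hm (hF.max_mem_J hT hm _) (le_max_right _ _)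
  set x₁ : EuclideanSpace ℝ (Fin n) := EuclideanSpace.single i z₁ with hx₁
  set x₂ : EuclideanSpace ℝ (Fin n) := EuclideanSpace.single i z₂ with hx₂
  set c := ∫ ζ : EuclideanSpace ℝ (Fin n), gaussKernel ζ 1 * (ζ i ^ 2 / 2) with hc
  have hcpos : 0 < c := integral_coord_sq_pos i
  have e₁ : x₁ i = z₁ := by simp [hx₁]
  have e₂ : x₂ i = z₂ := by simp [hx₂]
  have e₃ : (α • x₁ + β • x₂) i = α * z₁ + β * z₂ := by simp [hx₁, hx₂]
  have d₁ := hF.hasDerivWithinAt_testFun hC2 hT hm hC hB hbd (i := i) (x := x₁) (by rwa [e₁])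
    (by rwa [e₁])
  have d₂ := hF.hasDerivWithinAt_testFun hC2 hT hm hC hB hbd (i := i) (x := x₂) (by rwa [e₂])
    (by rwa [e₂])
  have d₃ := hF.hasDerivWithinAt_testFun hC2 hT hm hC hB hbd (i := i) (x := α • x₁ + β • x₂)
    (by rwa [e₃]) (by rwa [e₃])
  rw [e₁] at d₁
  rw [e₂] at d₂
  rw [e₃] at d₃
  -- The convexity defect vanishes at time `0` and is nonpositive for small positive times, so its
  -- right derivative is nonpositive.
  have hD := (d₃.sub (d₁.const_mul α)).sub (d₂.const_mul β)
  rw [hasDerivWithinAt_iff_tendsto_slope' (by simp)] at hD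
  have hv0 : ∀ x, m < x i → realOf F (heatFlow φ 0 x) = x i := by
    intro x hx
    have : heatFlow φ 0 x = φ x := by simp [heatFlow]
    rw [this, hφ, testFun, max_eq_left hx.le, realOf_inv (hF.mem_J_of_le hT hm hx.le)]
  have hle : c * g F (α * z₁ + β * z₂) - α * (c * g F z₁) - β * (c * g F z₂) ≤ 0 := by
    refine le_of_tendsto hD ?_
    filter_upwards [Ioo_mem_nhdsGT (show (0 : ℝ) < 1 / (4 * B) by positivity)] with t ht
    have ht0 : 0 < t := ht.1
    have htB : B * t < 1 / 4 := by
      have := ht.2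
      rw [lt_div_iff₀ (by positivity)] at this
      linarith
    have hconv := hP φ hφF hmax0 t ht0
      (lt_of_lt_of_le ((ENNReal.ofReal_lt_ofReal_iff (by positivity)).2 ht.2) hmax)
    have hreal := hconv.convexOn_max hF hρ0
    have hvρ : ∀ x, max (heatFlow φ t x) (inv F m) = heatFlow φ t x := fun x =>
      max_eq_left (le_heatFlow hφc hφbd hB.le hρ ht0.le htB x)
    simp only [hvρ] at hreal
    have h1 := hreal.2 (mem_univ x₁) (mem_univ x₂) hα.le hβ.le hαβ
    simp only [smul_eq_mul] at h1
    rw [slope_def_field]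
    refine div_nonpos_of_nonpos_of_nonneg ?_ (by linarith)
    simp only [Pi.sub_apply]
    rw [hv0 x₁ (by rwa [e₁]), hv0 x₂ (by rwa [e₂]), hv0 (α • x₁ + β • x₂) (by rwa [e₃]), e₁, e₂, e₃]
    linarith
  have h2 : c * g F (α * z₁ + β * z₂) ≤ c * (α * g F z₁ + β * g F z₂) := by linarith
  exact le_of_mul_le_mul_left h2 hcpos

/-- To the right of a zero `c` of `F'`, the function `-log F'(f_F)` would have to tend to `+∞`. Its
derivative is `g_F`, which the convexity inequality bounds from below near `F(c)`, so it stays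
bounded above. -/
lemma Preserved.deriv_pos (hn : 1 ≤ n) (hP : Preserved n F) (hF : Admissible F)
    (hC2 : ContDiffOn ℝ 2 (realOf F) (Ioi 0)) (hT : Tendsto F atTop (𝓝 ⊤))
    (hW : ∃ A : ℝ, 0 < A ∧ weightIntegral F A < ⊤) {r : ℝ} (hr : 0 < r) :
    0 < deriv (realOf F) r := by
  set F₁ := deriv (realOf F) with hF₁
  have hnonneg : ∀ s, 0 < s → 0 ≤ F₁ s := by
    intro s hs
    have h1 := (hasDerivAt_realOf hC2 hs).hasDerivWithinAt (s := Ioi s)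
    rw [hasDerivWithinAt_iff_tendsto_slope' (by simp)] at h1
    refine ge_of_tendsto h1 ?_
    filter_upwards [self_mem_nhdsWithin] with y hy
    rw [slope_def_field]
    have hy' : s < y := hy
    have := hF.realOf_strictMonoOn hs (hs.trans hy') hy'
    exact div_nonneg (by linarith) (by linarith)
  by_contra hcon
  have hr0 : F₁ r = 0 := le_antisymm (not_lt.1 hcon) (hnonneg r hr)
  have hcF₁ : ContinuousOn F₁ (Ioi 0) := fun s hs =>
    (hasDerivAt_deriv_realOf hC2 hs).continuousAt.continuousWithinAt
  -- Strict monotonicity gives a point past `r` with `F' > 0`; the last zero before it borders an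
  -- interval where `F' > 0` and `g_F` is under control.
  obtain ⟨r₁, hr₁, hr₁s⟩ := exists_hasDerivAt_eq_slope (realOf F) F₁ (by linarith : r < r + 1)
    (fun s hs => (hasDerivAt_realOf hC2 (hr.trans_le hs.1)).continuousAt.continuousWithinAt)
    (fun s hs => hasDerivAt_realOf hC2 (hr.trans hs.1))
  have hr₁0 : 0 < r₁ := hr.trans hr₁.1
  have hF₁r₁ : 0 < F₁ r₁ := by
    rw [hr₁s]
    have := hF.realOf_strictMonoOn hr (by linarith : (0 : ℝ) < r + 1) (by linarith : r < r + 1)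
    exact div_pos (by linarith) (by linarith)
  -- the last zero of `F'` before `r₁`
  obtain ⟨c, ⟨⟨hcr, hcr₁⟩, hc0⟩, hcmax⟩ : ∃ c ∈ Icc r r₁ ∩ F₁ ⁻¹' {0},
      ∀ s ∈ Icc r r₁ ∩ F₁ ⁻¹' {0}, s ≤ c := by
    have hcomp : IsCompact (Icc r r₁ ∩ F₁ ⁻¹' {0}) := by
      refine isCompact_Icc.of_isClosed_subset ?_ inter_subset_left
      exact (hcF₁.mono fun s hs => hr.trans_le hs.1).preimage_isClosed_of_isClosed isClosed_Icc
        isClosed_singleton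
    obtain ⟨c, hc, hmax⟩ := hcomp.exists_isGreatest ⟨r, ⟨le_rfl, hr₁.1.le⟩, hr0⟩
    exact ⟨c, hc, fun s hs => hmax hs⟩
  have hc0' : F₁ c = 0 := hc0
  have hcpos : 0 < c := hr.trans_le hcr
  have hclt : c < r₁ := lt_of_le_of_ne hcr₁ (by rintro rfl; linarith)
  have hposI : ∀ s, c < s → s ≤ r₁ → 0 < F₁ s := by
    intro s hs hs'
    refine lt_of_le_of_ne (hnonneg s (hcpos.trans hs)) fun h0 => ?_
    exact absurd (hcmax s ⟨⟨hcr.trans hs.le, hs'⟩, h0.symm⟩) (not_le.2 hs)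
  set zc := realOf F c with hzc
  set z₁ := realOf F r₁ with hz₁
  have hz₁J : z₁ ∈ J F := hF.realOf_mem_J hr₁0
  have hzcJ : zc ∈ J F := hF.realOf_mem_J hcpos
  have hzlt : zc < z₁ := hF.realOf_strictMonoOn hcpos hr₁0 hclt
  have hJ : ∀ z, zc < z → z ≤ z₁ → z ∈ J F ∧ 0 < F₁ (inv F z) := by
    intro z h1 h2
    have hzJ : z ∈ J F := hF.mem_J_of_le hT hzcJ h1.le
    refine ⟨hzJ, hposI _ ?_ ?_⟩
    · have := hF.inv_strictMonoOn hzcJ hzJ h1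
      rwa [hzc, hF.inv_realOf hcpos] at this
    · have := hF.inv_strictMonoOn.monotoneOn hzJ hz₁J h2
      rwa [hz₁, hF.inv_realOf hr₁0] at this
  set z₂ := (zc + z₁) / 2 with hz₂
  have hz₂c : zc < z₂ := by rw [hz₂]; linarith
  have hz₂1 : z₂ < z₁ := by rw [hz₂]; linarith
  obtain ⟨hz₂J, hz₂pos⟩ := hJ z₂ hz₂c hz₂1.le
  -- a lower bound for `g` near `zc`
  set K := 2 * |g F z₂| + |g F z₁| with hK
  have hglow : ∀ z, zc < z → z < z₂ → -K ≤ g F z := by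
    intro z h1 h2
    obtain ⟨hzJ, hzpos⟩ := hJ z h1 (h2.trans hz₂1).le
    have hdpos : 0 < z₁ - z := by linarith
    set α := (z₁ - z₂) / (z₁ - z) with hα
    set β := (z₂ - z) / (z₁ - z) with hβ
    have hα0 : 0 < α := div_pos (by linarith) hdpos
    have hβ0 : 0 < β := div_pos (by linarith) hdpos
    have hαβ : α + β = 1 := by rw [hα, hβ, ← add_div]; field_simp; ring
    have hcomb : α * z + β * z₁ = z₂ := by rw [hα, hβ]; field_simp; ring
    have h3 := hP.g_convex_ineq hn hF hC2 hT hW hzJ hz₁J hα0 hβ0 hαβ hzpos (hJ z₁ hzlt le_rfl).2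
      (by rw [hcomb]; exact hz₂pos)
    rw [hcomb] at h3
    -- `z₂` is the midpoint of `zc` and `z₁`, and `z > zc`, so `z₂` lies closer to `z` than to `z₁`;
    -- this keeps the bound uniform as `z` approaches `zc`.
    have hα2 : 1 / 2 ≤ α := by
      rw [hα, le_div_iff₀ hdpos, hz₂]
      linarith
    have hβ1 : β ≤ α := by linarith
    by_contra! hlt
    have e1 : α * g F z < α * (-K) := mul_lt_mul_of_pos_left hlt hα0
    have e2 : β * g F z₁ ≤ α * |g F z₁| :=
      (mul_le_mul_of_nonneg_left (le_abs_self _) hβ0.le).trans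
        (mul_le_mul_of_nonneg_right hβ1 (abs_nonneg _))
    have e3 : 1 * |g F z₂| ≤ 2 * α * |g F z₂| := by
      gcongr; linarith
    have e4 : α * K = 2 * α * |g F z₂| + α * |g F z₁| := by rw [hK]; ring
    linarith [neg_abs_le (g F z₂)]
  have hK0 : 0 ≤ K := by positivity
  have hup : ∀ z, zc < z → z < z₂ → -Real.log (F₁ (inv F z)) ≤
      -Real.log (F₁ (inv F z₂)) + K * (z₂ - zc) := by
    intro z h1 h2
    have h3 := le_of_hasDerivAt_nonpos h2.le
      (q := fun y => -(-Real.log (F₁ (inv F y))) - K * y) (q' := fun y => -g F y - K * 1)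
      (fun y hy => by
        obtain ⟨hyJ, hypos⟩ := hJ y (h1.trans_le hy.1) (hy.2.trans hz₂1.le)
        exact (hF.g_spec hC2 hyJ hypos).2.1.neg.sub ((hasDerivAt_id y).const_mul K))
      (fun y hy => by
        rcases hy.2.eq_or_lt with rfl | hlt
        · have : -K ≤ g F z₂ := by
            rw [hK]
            linarith [neg_abs_le (g F z₂), abs_nonneg (g F z₂), abs_nonneg (g F z₁)]
          linarith
        · linarith [hglow y (h1.trans_le hy.1) hlt])
    have h4 : K * (z₂ - z) ≤ K * (z₂ - zc) := by gcongr
    linarith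
  -- but `-log F'` tends to `+∞` at `zc`
  have hlim : Tendsto (fun z => F₁ (inv F z)) (𝓝[>] zc) (𝓝[>] 0) := by
    refine tendsto_nhdsWithin_iff.2 ⟨?_, ?_⟩
    · have hc1 : ContinuousAt F₁ (inv F zc) :=
        (hasDerivAt_deriv_realOf hC2 (inv_pos' hzcJ)).continuousAt
      have hc2 : ContinuousAt (fun z => F₁ (inv F z)) zc :=
        ContinuousAt.comp hc1 (hF.inv_continuousAt hzcJ)
      have := hc2.tendsto
      rw [hzc, hF.inv_realOf hcpos, hc0'] at this
      exact this.mono_left nhdsWithin_le_nhds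
    · filter_upwards [Ioo_mem_nhdsGT hzlt] with z hz using (hJ z hz.1 hz.2.le).2
  have hlog : Tendsto (fun z => -Real.log (F₁ (inv F z))) (𝓝[>] zc) atTop :=
    tendsto_neg_atBot_atTop.comp (Real.tendsto_log_nhdsGT_zero.comp hlim)
  have hev := hlog.eventually_gt_atTop (-Real.log (F₁ (inv F z₂)) + K * (z₂ - zc))
  obtain ⟨z, hz, hzI⟩ := (hev.and (Ioo_mem_nhdsGT hz₂c)).exists
  exact absurd (hup z hzI.1 hzI.2) (not_le.2 hz)

theorem Preserved.convexProfile (hn : 1 ≤ n) (hP : Preserved n F) (hF : Admissible F)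
    (hC2 : ContDiffOn ℝ 2 (realOf F) (Ioi 0)) (hT : Tendsto F atTop (𝓝 ⊤))
    (hW : ∃ A : ℝ, 0 < A ∧ weightIntegral F A < ⊤) : ConvexProfile F := by
  have hpos : ∀ r : ℝ, 0 < r → 0 < deriv (realOf F) r := fun r hr =>
    hP.deriv_pos hn hF hC2 hT hW hr
  have hJc : Convex ℝ (J F) := hF.J_ordConnected.convex
  refine ⟨hF, hC2, hT, hpos, convexOn_iff_forall_pos.2 ⟨hJc, fun x hx y hy α β hα hβ hαβ => ?_⟩⟩
  exact hP.g_convex_ineq hn hF hC2 hT hW hx hy hα hβ hαβ (hpos _ (inv_pos' hx))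
    (hpos _ (inv_pos' hy)) (hpos _ (inv_pos' (hJc hx hy hα.le hβ.le hαβ)))

end Necessity

end HeatFConvex

end

theorem theorem1p1 (n : ℕ) (hn : 1 ≤ n) (F : ℝ → EReal) (hF : HeatFConvex.Admissible F) :
    ((∃ L : EReal, L < ⊤ ∧ Tendsto F atTop (𝓝 L)) →
      HeatFConvex.OnlyTriviallyPreserved n F) ∧
    (Tendsto F atTop (𝓝 ⊤) →
      (∀ A : ℝ, 0 < A → HeatFConvex.weightIntegral F A = ⊤) →
      HeatFConvex.OnlyTriviallyPreserved n F) ∧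
    (ContDiffOn ℝ 2 (HeatFConvex.realOf F) (Ioi 0) →
      Tendsto F atTop (𝓝 ⊤) →
      (∃ A : ℝ, 0 < A ∧ HeatFConvex.weightIntegral F A < ⊤) →
      (HeatFConvex.Preserved n F ↔
        (∀ r : ℝ, 0 < r → 0 < deriv (HeatFConvex.realOf F) r) ∧
          ConvexOn ℝ (HeatFConvex.J F) (HeatFConvex.g F))) := by
  exact ⟨HeatFConvex.onlyTriviallyPreserved_of_bounded hF,
    HeatFConvex.onlyTriviallyPreserved_of_weightIntegral_eq_top hF,
    fun hC hT hW => ⟨fun hP => have h := hP.convexProfile hn hF hC hT hW; ⟨h.deriv_pos, h.convexOn⟩,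
      fun h => HeatFConvex.ConvexProfile.preserved ⟨hF, hC, hT, h.1, h.2⟩ n⟩⟩
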